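/- **Setting.** Let $\omega=e^{i\pi/4}$, $R=\mathbb Z[i,1/\sqrt2]$, $R_z(\varphi)=\mathrm{diag}(e^{-i\varphi/2},e^{i\varphi/2})$, $T=\mathrm{diag}(1,\omega)$. For $k\in\mathbb Z$ put $$U[x,y,k]=\begin{pmatrix}x&-y^*\omega^k\\ y&x^*\omega^k\end{pmatrix};$$ it is an *exact unitary* if $x,y\in R$ and the matrix is unitary. A Clifford operator is a product of gates $X,Y,Z$, $H$, $P=T^2$. The T-count $\mathcal T(U)$ is the least $n$ with $U=e^{i\alpha}C_1TC_2T\cdots C_nTC_{n+1}$, $\alpha\in\mathbb R$, all $C_j$ Clifford. Let $\mathcal T_k(x)=\min\{\mathcal T(U[x,y,k])\}$ over all exact unitaries $U[x,y,k]$ with $x,k$ fixed ($\infty$ if there are none); an exact unitary $U[x,y,k]$ is *minimal* if $\mathcal T(U[x,y,k])=\mathcal T_k(x)$. Distance: $d(U,V)=\sqrt{1-|\mathrm{tr}(UV^\dagger)|/2}$. $\mathrm{RCUP}[n,\varphi,\delta]$: let $M$ be the set of minimal exact unitaries $U$ with $\mathcal T(U)=n$ and $d(R_z(\varphi),U)\le\delta$.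 Find the distance $\varepsilon[n,\varphi,\delta]$ from $R_z(\varphi)$ to $M$ (set to $\delta$ if $M=\varnothing$), and the set $D[n,\varphi,\delta]$ of minimal exact unitaries $U$ with $\mathcal T(U)=n$ and $d(R_z(\varphi),U)\le\varepsilon[n,\varphi,\delta]$. **RCU-Algorithm** (exact real arithmetic). Input $n,\varphi,\delta$ and an interval length $\alpha>0$. Put $m=\lfloor (n+1)/2\rfloor+2$, $\theta_k=\pi k/8-\varphi/2$. 1. For $k=0,1$ let $L_{re,k}=\text{FIND-HALVES}(\cos\theta_k,m,\delta)$ and $L_{im,k}=\text{FIND-HALVES}(\sin\theta_k,m,\delta)$. 2. Start with $I=[\alpha_0,\alpha_1]=[0,\alpha]$. While $I\cap[0,\delta]\neq\varnothing$: form the array $A$ of all tuples $(\varepsilon,a_0,b_0,a_1,b_1,k)$, $k\in\{0,1\}$, with $(\varepsilon_{re},a_0,b_0)\in L_{re,k}$, $(\varepsilon_{im},a_1,b_1)\in L_{im,k}$, $\varepsilon_{re}+\varepsilon_{im}\ge 0$, $\varepsilon=\sqrt{\varepsilon_{re}+\varepsilon_{im}}\in I\cap[0,\delta]$. Sort $A$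 by $\varepsilon$. For the distinct values $\varepsilon_1<\dots<\varepsilon_M$ of $\varepsilon$ in turn, let $Sol$ be the union of $\text{ALL-UNITARIES}(x',m,k)$ over the tuples of $A$ with $\varepsilon=\varepsilon_j$, $x'=a_0+b_0\sqrt2+i(a_1+b_1\sqrt2)$ and $\text{MIN-T-COUNT}(x',m,k)=n$; if $Sol\ne\varnothing$, return $(\varepsilon_j,Sol)$. If nothing was returned, replace $I=[\alpha_0,\alpha_1]$ by $[\alpha_1,2\alpha_1-\alpha_0]$. 3. When the while loop ends, return $(\delta,\varnothing)$. *FIND-HALVES*$(c,m,\delta)$: for each integer $b$ from $\lfloor-\sqrt{2^m}\rfloor$ to $\lceil\sqrt{2^m}\rceil$, with $v=c\sqrt{2^m}-b\sqrt2$, and each integer $a$ with $|v-a|\le\delta\sqrt{2^{m+1}}$ and $a^2+2b^2\le2^m$, list $((v-a)\,c/\sqrt{2^m},\,a,\,b)$; sort by first entry. *MIN-T-COUNT*$(x',m,k)$: let $s$ be the least integer such that $|x'|^2/2^m\in \sqrt2^{\,-s}\mathbb Z[\sqrt2]$. Return $\infty$ if $s\le4$. Otherwise return $s-2+((k+s)\bmod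 2)$ if $\text{IS-SOLVABLE}(2^m-|x'|^2)$, and $\infty$ if not. Here $\text{IS-SOLVABLE}(\xi)$, for $\xi\in\mathbb Z[\sqrt2]$, tests that $\xi$ and its conjugate under $\sqrt2\mapsto-\sqrt2$ are $\ge0$ and that every prime of $\mathbb Z[\sqrt2]$ whose norm is, up to sign, a rational prime $\equiv7\pmod 8$ divides $\xi$ to an even power. *ALL-UNITARIES*$(x',m,k)$: factor $\xi=2^m-|x'|^2=(\sqrt2-1)^{l_0}\sqrt2^{\,k_0}\prod_j p_j^{e_j}$ in $\mathbb Z[\sqrt2]$, the $p_j$ pairwise non-associated primes not dividing $2$ and positive in both real embeddings. For each $p_j$ whose norm is not a rational prime $\equiv 7\pmod 8$ find $y_j\in\mathbb Z[\omega]$ with $|y_j|^2=p_j$. Form all $$y'=(\sqrt2-1)^{(l_0-k_0)/2}\,\omega^g\,(1-\omega)^{k_0}\prod_jY_j,\qquad 0\le g\le7,$$ where $Y_j=p_j^{e_j/2}$ if the norm of $p_j$ is a rational prime $\equiv7\pmod8$, and $Y_j\in\{y_j^a(y_j^*)^{e_j-a}:0\le a\le e_j\}$ otherwise. Return those matrices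 $\omega^hU[x'/\sqrt{2^m},y'/\sqrt{2^m},k]$, $0\le h\le7$, whose T-count equals $\text{MIN-T-COUNT}(x',m,k)$. **Theorem.** Let $n\ge4$ be an integer, $\varphi\in\mathbb R$, $\delta\le1/2$. For every $\alpha>0$ the RCU-Algorithm terminates and solves $\mathrm{RCUP}[n,\varphi,\delta]$: its output is $(\varepsilon[n,\varphi,\delta],D[n,\varphi,\delta])$. If $M\neq\varnothing$, then $\varepsilon[n,\varphi,\delta]$ is the minimum of $d(R_z(\varphi),\cdot)$ on $M$ and $D[n,\varphi,\delta]\ne\varnothing$; if $M=\varnothing$, the output is $(\delta,\varnothing)$. -/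

import Mathlib

noncomputable section

namespace RCU

/-! ### Gates, circuits, T-count -/

/-- Single-qubit operators. -/
abbrev Mat : Type := Matrix (Fin 2) (Fin 2) ℂ

/-- `ω = e^{iπ/4}`. -/
def omega : ℂ := Complex.exp (Complex.I * (Real.pi / 4 : ℝ))

/-- `√2` as a complex number. -/
def sqrtTwo : ℂ := ((Real.sqrt 2 : ℝ) : ℂ)

def gateX : Mat := !![0, 1; 1, 0]

def gateZ : Mat := !![1, 0; 0, -1]

def gateY : Mat := Complex.I • (gateX * gateZ)

def gateH : Mat := sqrtTwo⁻¹ • !![1, 1; 1, -1]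

def gateT : Mat := !![1, 0; 0, omega]

def gateP : Mat := gateT ^ 2

/-- Operators computed by single-qubit circuits over the Clifford gates. -/
def clifford : Submonoid Mat :=
  Submonoid.closure {gateX, gateY, gateZ, gateH, gateP}

/-- Operators `C₁ T C₂ T ⋯ Cₙ T Cₙ₊₁` with exactly `n` gates `T` and all `Cᵢ` Clifford. -/
def circuits : ℕ → Set Mat
  | 0 => {U | U ∈ clifford}
  | n + 1 => {U | ∃ V ∈ circuits n, ∃ C ∈ clifford, U = V * gateT * C}

/-- `U` is, up to a global phase, a circuit with `n` gates `T`. -/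
def ImplementableWith (n : ℕ) (U : Mat) : Prop :=
  ∃ c : ℂ, ‖c‖ = 1 ∧ ∃ V ∈ circuits n, U = c • V

/-- The T-count of an operator (`⊤` if no circuit implements it). -/
def tCount (U : Mat) : ℕ∞ :=
  ⨅ (n : ℕ) (_ : ImplementableWith n U), (n : ℕ∞)

/-! ### Exact and minimal unitaries, the problem RCUP -/

/-- The ring `ℤ[i, 1/√2]`. -/
def exactRing : Subalgebra ℤ ℂ := Algebra.adjoin ℤ {Complex.I, sqrtTwo⁻¹}

/-- The matrix `U[x, y, k]`. -/
def uMat (x y : ℂ) (k : ℤ) : Mat :=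
  !![x, -(starRingEnd ℂ y) * omega ^ k; y, starRingEnd ℂ x * omega ^ k]

/-- `U[x, y, k]` is an exact unitary. -/
def IsExactTriple (x y : ℂ) (k : ℤ) : Prop :=
  x ∈ exactRing ∧ y ∈ exactRing ∧ uMat x y k ∈ Matrix.unitaryGroup (Fin 2) ℂ

/-- `T_k(x)`: the minimal T-count of the exact unitaries `U[x, y, k]`; `⊤` if there are none. -/
def entryTCount (k : ℤ) (x : ℂ) : ℕ∞ :=
  ⨅ (y : ℂ) (_ : IsExactTriple x y k), tCount (uMat x y k)

/-- `U` is a minimal exact unitary. -/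
def IsMinimal (U : Mat) : Prop :=
  ∃ (x y : ℂ) (k : ℤ), IsExactTriple x y k ∧ U = uMat x y k ∧ tCount U = entryTCount k x

/-- The rotation `R_z(φ)`. -/
def Rz (φ : ℝ) : Mat :=
  !![Complex.exp (-(Complex.I * (φ / 2 : ℝ))), 0; 0, Complex.exp (Complex.I * (φ / 2 : ℝ))]

/-- The global phase invariant distance. -/
def gpDist (U V : Mat) : ℝ :=
  Real.sqrt (1 - ‖(U * V.conjTranspose).trace‖ / 2)

/-- Minimal exact unitaries of T-count exactly `n` within distance `δ` of `R_z(φ)`. -/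
def feasible (n : ℕ) (φ δ : ℝ) : Set Mat :=
  {U | IsMinimal U ∧ tCount U = (n : ℕ∞) ∧ gpDist (Rz φ) U ≤ δ}

open scoped Classical in
/-- `ε[n, φ, δ]`: the distance from `R_z(φ)` to `feasible n φ δ`, or `δ` if that set is empty. -/
def rcupDist (n : ℕ) (φ δ : ℝ) : ℝ :=
  if (feasible n φ δ).Nonempty then sInf (gpDist (Rz φ) '' feasible n φ δ) else δ

/-- `D[n, φ, δ]`. -/
def rcupSet (n : ℕ) (φ δ : ℝ) : Set Mat :=
  {U | IsMinimal U ∧ tCount U = (n : ℕ∞) ∧ gpDist (Rz φ) U ≤ rcupDist n φ δ}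

/-! ### Arithmetic in `ℤ[√2]` and the relative norm equation `|y|² = ξ` over `ℤ[ω]` -/

/-- The real number `a + b√2`. -/
def toReal (z : Zsqrtd 2) : ℝ := z.re + z.im * Real.sqrt 2

/-- The smallest denominator exponent: the least integer `m` such that
`r = (a + b√2) / √2^m` for some integers `a, b`. -/
def sde (r : ℝ) : ℤ :=
  sInf {m : ℤ | ∃ z : Zsqrtd 2, r = toReal z / Real.sqrt 2 ^ m}

/-- IS-SOLVABLE: `ξ` and its image under `√2 ↦ -√2` are non-negative, and each prime `p` of
`ℤ[√2]` lying over a rational prime `8n - 1` divides `ξ` to an even power. -/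
def IsSolvable (ξ : Zsqrtd 2) : Prop :=
  0 ≤ toReal ξ ∧ 0 ≤ toReal (star ξ) ∧
    ∀ p : Zsqrtd 2, Prime p → p.norm.natAbs.Prime → p.norm.natAbs % 8 = 7 →
      Even (emultiplicity p ξ)

/-- The ring `ℤ[ω]`. -/
def ringOmega : Subalgebra ℤ ℂ := Algebra.adjoin ℤ {omega}

/-- One prime power `prime ^ exponent` of a factorization in `ℤ[√2]`, with a recorded solution
`root` of `|root|² = prime` (unused if the prime lies over a rational prime `8n - 1`). -/
structure PrimePower where
  prime : Zsqrtd 2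
  exponent : ℕ
  root : ℂ

/-- Raw data for `(√2 - 1)^unitExp * √2^sqrtExp * ∏ prime ^ exponent`. -/
structure Factorization where
  unitExp : ℤ
  sqrtExp : ℕ
  primes : List PrimePower

instance : Inhabited Factorization := ⟨⟨0, 0, []⟩⟩

/-- The prime lies over a rational prime of the form `8n - 1`. -/
def PrimePower.IsInert (f : PrimePower) : Prop :=
  f.prime.norm.natAbs.Prime ∧ f.prime.norm.natAbs % 8 = 7

/-- `F` is a factorization of `ξ`: the listed primes of `ℤ[√2]` are odd, pairwise
non-associated and positive in both real embeddings, and come with solutions of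
`|root|² = prime` in `ℤ[ω]` unless they lie over a rational prime `8n - 1`. -/
structure Factorization.IsFor (F : Factorization) (ξ : Zsqrtd 2) : Prop where
  eq : toReal ξ = (Real.sqrt 2 - 1) ^ F.unitExp * Real.sqrt 2 ^ F.sqrtExp *
    (F.primes.map fun f => toReal f.prime ^ f.exponent).prod
  prime : ∀ f ∈ F.primes, Prime f.prime
  odd : ∀ f ∈ F.primes, ¬ f.prime ∣ 2
  pos : ∀ f ∈ F.primes, 0 < toReal f.prime ∧ 0 < toReal (star f.prime)
  distinct : F.primes.Pairwise fun f g => ¬ Associated f.prime g.prime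
  root : ∀ f ∈ F.primes, ¬ f.IsInert →
    f.root ∈ ringOmega ∧ f.root * starRingEnd ℂ f.root = (toReal f.prime : ℂ)

/-- The factoring subroutine: some factorization of `ξ`. -/
def factorize (ξ : Zsqrtd 2) : Factorization :=
  Classical.epsilon fun F => F.IsFor ξ

open scoped Classical in
/-- The solutions of `|Y|² = prime ^ exponent` up to units: `prime ^ (exponent / 2)` over a
rational prime `8n - 1`, and `root ^ a * conj root ^ (exponent - a)`, `0 ≤ a ≤ exponent`,
otherwise. -/
def PrimePower.solutions (f : PrimePower) : List ℂ :=
  if f.IsInert then [((toReal f.prime : ℝ) : ℂ) ^ (f.exponent / 2)]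
  else (List.range (f.exponent + 1)).map fun a =>
    f.root ^ a * starRingEnd ℂ f.root ^ (f.exponent - a)

/-- All products with one solution taken for each prime power. -/
def productSolutions : List PrimePower → List ℂ
  | [] => [1]
  | f :: fs => f.solutions.flatMap fun z => (productSolutions fs).map fun w => z * w

/-- The solutions of the relative norm equation assembled from a factorization; the factor `√2`
contributes powers of `1 - ω`, for which `|1 - ω|² = (√2 - 1)√2`. -/
def Factorization.solutions (F : Factorization) : List ℂ :=
  (List.range 8).flatMap fun g => (productSolutions F.primes).map fun z =>
    (sqrtTwo - 1) ^ ((F.unitExp - F.sqrtExp) / 2) * omega ^ g * (1 - omega) ^ F.sqrtExp * z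

/-! ### The procedures -/

/-- `x' = re + i im` with `re, im ∈ ℤ[√2]`. -/
structure Numerator where
  re : Zsqrtd 2
  im : Zsqrtd 2

def Numerator.toComplex (x' : Numerator) : ℂ :=
  (toReal x'.re : ℂ) + Complex.I * (toReal x'.im : ℂ)

/-- `|x'|²` as an element of `ℤ[√2]`. -/
def Numerator.normSq (x' : Numerator) : Zsqrtd 2 := x'.re ^ 2 + x'.im ^ 2

open scoped Classical in
/-- MIN-T-COUNT. -/
def minTCount (x' : Numerator) (m : ℕ) (k : ℤ) : ℕ∞ :=
  let s := sde (toReal x'.normSq / 2 ^ m)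
  if s ≤ 4 then ⊤
  else if IsSolvable (2 ^ m - x'.normSq) then (((s - 2 + (k + s) % 2).toNat : ℕ) : ℕ∞)
  else ⊤

open scoped Classical in
/-- ALL-UNITARIES: solve the norm equation `|y'|² = 2^m - |x'|²` from a factorization of its
right-hand side, write down the unitaries `ω^g U[x'/√2^m, y'/√2^m, k]`, and keep those whose
T-count is the minimal one. -/
def allUnitaries (x' : Numerator) (m : ℕ) (k : ℤ) : Finset Mat :=
  (((factorize (2 ^ m - x'.normSq)).solutions.flatMap fun y' =>
    (List.range 8).map fun g =>
      omega ^ g • uMat (x'.toComplex / sqrtTwo ^ m) (y' / sqrtTwo ^ m) k).filter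
    fun U => decide (tCount U = minTCount x' m k)).toFinset

/-- An entry `(value, a, b)` of the list returned by FIND-HALVES. -/
structure Half where
  value : ℝ
  a : ℤ
  b : ℤ

open scoped Classical in
/-- FIND-HALVES: all `a + b√2` with `|α√2^m - (a + b√2)| ≤ δ√2^(m+1)` and `a² + 2b² ≤ 2^m`,
each with the value `α√2^(-m) (α√2^m - (a + b√2))`, sorted by the value.
(`Int.range p q` lists the integers `p, …, q - 1`.) -/
def findHalves (α : ℝ) (m : ℕ) (δ : ℝ) : List Half :=
  let W : ℝ := α / Real.sqrt 2 ^ m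
  let ρ : ℝ := δ * Real.sqrt 2 ^ (m + 1)
  ((Int.range ⌊-(Real.sqrt 2 ^ m)⌋ (⌈Real.sqrt 2 ^ m⌉ + 1)).flatMap fun b : ℤ =>
    let v : ℝ := α * Real.sqrt 2 ^ m - b * Real.sqrt 2
    ((Int.range ⌈v - ρ⌉ (⌊v + ρ⌋ + 1)).filter
      fun a : ℤ => decide (a ^ 2 + 2 * b ^ 2 ≤ 2 ^ m)).map
        fun a : ℤ => ({ value := (v - a) * W, a := a, b := b } : Half)).mergeSort
    fun s t => decide (s.value ≤ t.value)

/-- The angle `θ_k = πk/8 - φ/2`. -/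
def theta (φ : ℝ) (k : ℕ) : ℝ := Real.pi * k / 8 - φ / 2

/-- A tuple `(ε, a₀, b₀, a₁, b₁, k)`. -/
structure Candidate where
  eps : ℝ
  num : Numerator
  k : ℕ

/-- The denominator exponent `⌊(n+1)/2⌋ + 2`. -/
def denomExp (n : ℕ) : ℕ := (n + 1) / 2 + 2

open scoped Classical in
/-- The array `A` for the interval `I`: tuples from `L_{re,k} × L_{im,k}` with
`ε = √(ε_re + ε_im) ∈ I ∩ [0, δ]`, sorted by `ε`. -/
def mergeHalves (n : ℕ) (φ δ : ℝ) (I : Set ℝ) : List Candidate :=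
  (((List.range 2).flatMap fun k =>
    (findHalves (Real.cos (theta φ k)) (denomExp n) δ).flatMap fun s =>
      ((findHalves (Real.sin (theta φ k)) (denomExp n) δ).filter fun t =>
        decide (0 ≤ s.value + t.value ∧
          Real.sqrt (s.value + t.value) ∈ I ∩ Set.Icc 0 δ)).map fun t =>
        { eps := Real.sqrt (s.value + t.value), num := ⟨⟨s.a, s.b⟩, ⟨t.a, t.b⟩⟩, k := k })).mergeSort
    fun c d => decide (c.eps ≤ d.eps)

open scoped Classical in
/-- The set `Sol` accumulated over the tuples of `A` whose first entry is `e`. -/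
def solAt (n : ℕ) (A : List Candidate) (e : ℝ) : Finset Mat :=
  (A.filter fun c => decide (c.eps = e)).foldl (fun sol c =>
    if minTCount c.num (denomExp n) c.k = (n : ℕ∞) then
      sol ∪ allUnitaries c.num (denomExp n) c.k
    else sol) ∅

open scoped Classical in
/-- The loop over the distinct values `ε₁ < ⋯ < ε_M`: it stops at the first non-empty `Sol`. -/
def firstSolution (n : ℕ) (A : List Candidate) : List ℝ → Option (ℝ × Finset Mat)
  | [] => none
  | e :: es => if solAt n A e ≠ ∅ then some (e, solAt n A e) else firstSolution n A es

open scoped Classical in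
/-- The body of the `while` loop for the interval `I`; `none` if it does not return. -/
def processInterval (n : ℕ) (φ δ : ℝ) (I : Set ℝ) : Option (ℝ × Finset Mat) :=
  let A := mergeHalves n φ δ I
  firstSolution n A ((A.map Candidate.eps).toFinset.sort)

/-- `WhileLoop n φ δ α₀ α₁ out`: the `while` loop, entered with `I = [α₀, α₁]`, terminates and
the algorithm returns `out`. -/
inductive WhileLoop (n : ℕ) (φ δ : ℝ) : ℝ → ℝ → ℝ × Finset Mat → Prop
  | exit {α₀ α₁ : ℝ} (h : ¬ (Set.Icc α₀ α₁ ∩ Set.Icc 0 δ).Nonempty) :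
      WhileLoop n φ δ α₀ α₁ (δ, ∅)
  | found {α₀ α₁ : ℝ} {out : ℝ × Finset Mat} (h : (Set.Icc α₀ α₁ ∩ Set.Icc 0 δ).Nonempty)
      (hout : processInterval n φ δ (Set.Icc α₀ α₁) = some out) :
      WhileLoop n φ δ α₀ α₁ out
  | next {α₀ α₁ : ℝ} {out : ℝ × Finset Mat} (h : (Set.Icc α₀ α₁ ∩ Set.Icc 0 δ).Nonempty)
      (hnone : processInterval n φ δ (Set.Icc α₀ α₁) = none)
      (hrest : WhileLoop n φ δ α₁ (2 * α₁ - α₀) out) :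
      WhileLoop n φ δ α₀ α₁ out

/-- The RCU-Algorithm on input `n, φ, δ`, with initial interval `[0, α]`, terminates and
returns `out`. -/
def Returns (n : ℕ) (φ δ α : ℝ) (out : ℝ × Finset Mat) : Prop :=
  WhileLoop n φ δ 0 α out

end RCU

end

noncomputable section

namespace RCU

/-! ### The ring `ℤ[√2]` -/

/-! The distance from `Rz φ` to U[x, y, k] is √(1 - |Re(e^{-iθ_k} x)|) and does not involve y
(`gpDist_uMat`). Multiplication by ω^h preserves distance and T-count and replaces k by k + 2h, so k
∈ {0, 1} suffices, and ω⁴ = -1 makes the real part non-negative. What remains is a search over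
entries x, made finite and exact by the following facts.

T-count and denominators. Conjugation turns U into an orthogonal 3×3 matrix `adj U`. Clifford gates
become integral and T has denominator √2. Conversely, orthogonality modulo √2 forces a row of the
scaled matrix to vanish, and then one T gate, after a Clifford, removes a factor √2. Hence T-count ≤
N exactly when √2^N `adj U` has entries in ℤ[√2] (`tCount_le_iff`). The corner entry of `adj U` is
2|x|² - 1, so with s the denominator exponent of |x|² the minimal T-count t of x is at least s - 2.
A matrix of least level among the T^a U T^b shows t ≤ s - 1 unless t ≤ 1, and determinants give t ≡
k (mod 2). For s ≥ 5 this is the formula of MIN-T-COUNT (`entryTCount_spec`).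

The norm equation. Given x = x'/√2^m, the possible y are y'/√2^m with y' ∈ ℤ[ω] and |y'|² = 2^m -
|x'|². Both ℤ[√2] and ℤ[ω] are norm-Euclidean, so unique factorization decides solvability and lists
every solution (`mem_solutions_factorize`).

Enumeration. T-count n bounds the denominator of x, existence of y bounds both real embeddings of
x', and distance at most δ confines each coordinate to a window. The two values of FIND-HALVES add
up to ε². So the tuples with a given ε produce precisely the minimal unitaries at that distance
(`coe_solAt_mergeHalves`), and consecutive intervals sweep [0, δ] in increasing order
(`whileLoop_spec`). -/

theorem sqrtTwo_irrational_coords {a b : ℤ} (h : (a : ℝ) + b * Real.sqrt 2 = 0) :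
    a = 0 ∧ b = 0 := by
  have hb : b = 0 := by
    by_contra hb
    have hb' : (b : ℝ) ≠ 0 := by exact_mod_cast hb
    apply irrational_sqrt_two
    refine ⟨-(a : ℚ) / b, ?_⟩
    push_cast
    field_simp
    linarith
  subst hb
  simpa using h

/-- `toReal` as a ring homomorphism. -/
def toRealHom : ℤ√2 →+* ℝ :=
  Zsqrtd.lift ⟨Real.sqrt 2, by norm_num⟩

theorem toRealHom_apply (z : ℤ√2) : toRealHom z = toReal z := by
  simp [toRealHom, toReal, Zsqrtd.lift]

theorem toReal_eq (z : ℤ√2) : toReal z = toRealHom z := (toRealHom_apply z).symm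

@[simp] theorem toReal_zero : toReal 0 = 0 := by simp [toReal]
@[simp] theorem toReal_one : toReal 1 = 1 := by simp [toReal]
@[simp] theorem toReal_add (z w : ℤ√2) : toReal (z + w) = toReal z + toReal w := by
  simp [toReal_eq]
@[simp] theorem toReal_sub (z w : ℤ√2) : toReal (z - w) = toReal z - toReal w := by
  simp [toReal_eq]
@[simp] theorem toReal_neg (z : ℤ√2) : toReal (-z) = -toReal z := by
  simp [toReal_eq]
@[simp] theorem toReal_mul (z w : ℤ√2) : toReal (z * w) = toReal z * toReal w := by
  simp [toReal_eq]
@[simp] theorem toReal_pow (z : ℤ√2) (n : ℕ) : toReal (z ^ n) = toReal z ^ n := by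
  simp [toReal_eq]
@[simp] theorem toReal_intCast (n : ℤ) : toReal (n : ℤ√2) = n := by
  simp [toReal]
@[simp] theorem toReal_natCast (n : ℕ) : toReal (n : ℤ√2) = n := by
  simp [toReal]
@[simp] theorem toReal_two : toReal (2 : ℤ√2) = 2 := by
  simpa using toReal_natCast 2

theorem toReal_injective : Function.Injective toReal := by
  intro z w h
  have h1 : ((z.re - w.re : ℤ) : ℝ) + ((z.im - w.im : ℤ) : ℝ) * Real.sqrt 2 = 0 := by
    simp only [toReal] at h
    push_cast
    linarith
  obtain ⟨h2, h3⟩ := sqrtTwo_irrational_coords h1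
  ext <;> omega

theorem toReal_inj {z w : ℤ√2} : toReal z = toReal w ↔ z = w := toReal_injective.eq_iff

@[simp] theorem toReal_eq_zero {z : ℤ√2} : toReal z = 0 ↔ z = 0 := by
  rw [← toReal_zero, toReal_inj]

instance : IsDomain (ℤ√2) :=
  Function.Injective.isDomain toRealHom (fun z w h => toReal_injective (by simpa [toReal_eq] using h))

/-- `√2` as an element of `ℤ[√2]`. -/
def root2 : ℤ√2 := ⟨0, 1⟩

@[simp] theorem re_root2 : root2.re = 0 := rfl

@[simp] theorem im_root2 : root2.im = 1 := rfl

@[simp] theorem toReal_root2 : toReal root2 = Real.sqrt 2 := by simp [toReal, root2]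

theorem root2_sq : root2 ^ 2 = 2 := by
  apply toReal_injective
  simp

theorem root2_mul_self : root2 * root2 = 2 := by rw [← sq, root2_sq]

theorem star_root2 : star root2 = -root2 := by ext <;> simp [root2]

theorem root2_ne_zero : root2 ≠ 0 := by
  intro h
  simpa [root2] using congrArg Zsqrtd.im h

theorem root2_dvd_iff {z : ℤ√2} : root2 ∣ z ↔ 2 ∣ z.re := by
  constructor
  · rintro ⟨w, rfl⟩
    simp [root2]
  · rintro ⟨a, ha⟩
    exact ⟨⟨z.im, a⟩, by ext <;> simp [root2, ha]⟩

theorem two_dvd_iff {z : ℤ√2} : 2 ∣ z ↔ 2 ∣ z.re ∧ 2 ∣ z.im := by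
  simpa using Zsqrtd.intCast_dvd 2 z

theorem star_mul' (z w : ℤ√2) : star (z * w) = star z * star w := by
  rw [star_mul, mul_comm]

theorem star_pow' (z : ℤ√2) (n : ℕ) : star (z ^ n) = star z ^ n := star_pow z n

theorem norm_eq_zero_iff {z : ℤ√2} : z.norm = 0 ↔ z = 0 := by
  constructor
  · intro h
    have h1 : z * star z = 0 := by rw [← Zsqrtd.norm_eq_mul_conj, h]; simp
    rcases mul_eq_zero.1 h1 with h2 | h2
    · exact h2
    · exact star_eq_zero.1 h2
  · rintro rfl
    simp

/-! ### A criterion for principal ideal rings -/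

/-- An element of least size in a nonzero ideal divides all the others, since a nonzero remainder
would be a smaller element of the ideal. -/
theorem isPrincipalIdealRing_of_size {R : Type*} [CommRing R] (f : R → ℕ)
    (h : ∀ x y : R, y ≠ 0 → ∃ q, x - q * y = 0 ∨ f (x - q * y) < f y) :
    IsPrincipalIdealRing R := by
  refine ⟨fun I => ?_⟩
  by_cases hI : ∃ y ∈ I, y ≠ 0
  · have hne : {y : R | y ∈ I ∧ y ≠ 0}.Nonempty := hI
    let y := Function.argminOn f _ hne
    have hy : y ∈ I ∧ y ≠ 0 := Function.argminOn_mem f _ hne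
    refine ⟨y, le_antisymm (fun x hx => ?_) ?_⟩
    · obtain ⟨q, hq⟩ := h x y hy.2
      have hmem : x - q * y ∈ I := I.sub_mem hx (I.mul_mem_left q hy.1)
      have h0 : x - q * y = 0 := by
        rcases hq with hq | hq
        · exact hq
        · by_contra hne0
          exact absurd hq (not_lt.2 (Function.argminOn_le f {y : R | y ∈ I ∧ y ≠ 0} (a := x - q * y) ⟨hmem, hne0⟩))
      exact Submodule.mem_span_singleton.2 ⟨q, by simpa using (sub_eq_zero.1 h0).symm⟩
    · exact (Submodule.span_singleton_le_iff_mem _ _).2 hy.1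
  · push Not at hI
    refine ⟨0, le_antisymm (fun x hx => ?_) (by simp)⟩
    simp [hI x hx]

theorem exists_int_round (w n : ℤ) (hn : 0 < n) : ∃ q : ℤ, |2 * (w - q * n)| ≤ n := by
  refine ⟨(2 * w + n) / (2 * n), ?_⟩
  have h1 := Int.mul_ediv_add_emod (2 * w + n) (2 * n)
  have h2 := Int.emod_nonneg (2 * w + n) (show 2 * n ≠ 0 by omega)
  have h3 := Int.emod_lt_of_pos (2 * w + n) (show 0 < 2 * n by omega)
  rw [abs_le]
  constructor <;> nlinarith

/-- Rounding both coordinates of x/y leaves u + v√2 with |u|, |v| ≤ 1/2, and |u² - 2v²| ≤ max(u²,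
2v²) ≤ 1/2 < 1. -/
instance : IsPrincipalIdealRing (ℤ√2) := by
  refine isPrincipalIdealRing_of_size (fun z => z.norm.natAbs) fun x y hy => ?_
  have hN : y.norm ≠ 0 := fun h => hy (norm_eq_zero_iff.1 h)
  -- The norm is indefinite; its sign e is split off so that the rounding uses a positive
  -- denominator n.
  obtain ⟨n, hn, e, he, hyn⟩ : ∃ n : ℤ, 0 < n ∧ ∃ e : ℤ, (e = 1 ∨ e = -1) ∧ y.norm = e * n := by
    rcases lt_or_gt_of_ne hN with h | h
    · exact ⟨-y.norm, by omega, -1, by simp, by ring⟩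
    · exact ⟨y.norm, h, 1, by simp, by ring⟩
  set w : ℤ√2 := x * star y * (e : ℤ√2) with hw
  obtain ⟨a, ha⟩ := exists_int_round w.re n hn
  obtain ⟨b, hb⟩ := exists_int_round w.im n hn
  refine ⟨⟨a, b⟩, Or.inr ?_⟩
  set r : ℤ√2 := x - ⟨a, b⟩ * y with hr
  set t : ℤ√2 := ⟨w.re - a * n, w.im - b * n⟩ with ht
  have ht' : t = w - (⟨a, b⟩ : ℤ√2) * (n : ℤ√2) := by
    ext <;> simp [ht]
  have hyy : y * star y = ((e * n : ℤ) : ℤ√2) := by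
    rw [← Zsqrtd.norm_eq_mul_conj, hyn]
  have he' : (e : ℤ√2) * (e : ℤ√2) = 1 := by rcases he with rfl | rfl <;> simp
  have key : r * (n : ℤ√2) = t * y := by
    rw [ht', hw, hr]
    push_cast at hyy
    linear_combination (-x * e) * hyy - x * n * he'
  have hnorm : r.norm * (n * n) = t.norm * (e * n) := by
    have := congrArg Zsqrtd.norm key
    rwa [Zsqrtd.norm_mul, Zsqrtd.norm_mul, Zsqrtd.norm_intCast, hyn] at this
  have hrt : r.norm * n = t.norm * e := by
    have : n * (r.norm * n - t.norm * e) = 0 := by linear_combination hnorm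
    rcases mul_eq_zero.1 this with h | h
    · omega
    · linarith
  have habs : |r.norm| * n = |t.norm| := by
    have h1 : |e| = 1 := by
        rcases he with rfl | rfl <;> simp
    rw [← abs_of_pos hn, ← abs_mul, hrt, abs_mul, h1, mul_one]
  have htn : 2 * |t.norm| ≤ n * n := by
    have e1 : t.norm = (w.re - a * n) ^ 2 - 2 * (w.im - b * n) ^ 2 := by
      rw [Zsqrtd.norm_def]; ring
    have h1 : 4 * (w.re - a * n) ^ 2 ≤ n ^ 2 := by
      have := sq_le_sq' (abs_le.1 ha).1 (abs_le.1 ha).2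
      nlinarith
    have h2 : 4 * (w.im - b * n) ^ 2 ≤ n ^ 2 := by
      have := sq_le_sq' (abs_le.1 hb).1 (abs_le.1 hb).2
      nlinarith
    rcases abs_cases t.norm with ⟨h, _⟩ | ⟨h, _⟩ <;> rw [h, e1] <;>
      nlinarith [sq_nonneg (w.re - a * n), sq_nonneg (w.im - b * n)]
  have hlt : |r.norm| < n := by nlinarith [abs_nonneg r.norm]
  have hy2 : |y.norm| = n := by
    rw [hyn, abs_mul, abs_of_pos hn]
    rcases he with rfl | rfl <;> simp
  have : (r.norm.natAbs : ℤ) < (y.norm.natAbs : ℤ) := by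
    rw [Int.natCast_natAbs, Int.natCast_natAbs, hy2]; exact hlt
  exact_mod_cast this

/-! ### Units of `ℤ[√2]` -/

/-- The fundamental unit `√2 - 1`. -/
def fundUnit : (ℤ√2)ˣ where
  val := ⟨-1, 1⟩
  inv := ⟨1, 1⟩
  val_inv := by ext <;> simp
  inv_val := by ext <;> simp

theorem toReal_fundUnit : toReal (fundUnit : ℤ√2) = Real.sqrt 2 - 1 := by
  simp [toReal, fundUnit]; ring

theorem toReal_fundUnit_pos : 0 < toReal (fundUnit : ℤ√2) := by
  rw [toReal_fundUnit]
  have : (1 : ℝ) < Real.sqrt 2 := Real.lt_sqrt_of_sq_lt (by norm_num)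
  linarith

theorem toReal_fundUnit_zpow (l : ℤ) :
    toReal ((fundUnit ^ l : (ℤ√2)ˣ) : ℤ√2) = (Real.sqrt 2 - 1) ^ l := by
  have h := map_zpow (Units.map (toRealHom : ℤ√2 →* ℝ)) fundUnit l
  have h2 := congrArg (Units.val) h
  simp only [Units.coe_map, Units.val_zpow_eq_zpow_val] at h2
  rw [toReal_eq, ← toReal_fundUnit, toReal_eq]
  exact h2

theorem pell_fundamental : Pell.IsFundamental (Pell.Solution₁.mk 3 2 (by norm_num) : Pell.Solution₁ 2) := by
  refine ⟨by simp, by simp, fun {b} hb => ?_⟩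
  by_contra h
  simp only [Pell.Solution₁.x_mk] at h
  have h2 : b.x = 2 := by omega
  have := b.prop
  rw [h2] at this
  omega

/-- Units of norm 1 are the solutions of the Pell equation x² - 2y² = 1, generated up to sign by 3 +
2√2 = (√2 - 1)⁻²; hence the even exponents. -/
theorem unit_of_norm_one {z : ℤ√2} (hz : z.norm = 1) :
    ∃ l : ℤ, z = (fundUnit ^ (2 * l) : (ℤ√2)ˣ) ∨ z = -(fundUnit ^ (2 * l) : (ℤ√2)ˣ) := by
  have hp : z.re ^ 2 - 2 * z.im ^ 2 = 1 := by
    rw [← hz, Zsqrtd.norm_def]; ring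
  let a : Pell.Solution₁ 2 := Pell.Solution₁.mk z.re z.im hp
  let F : Pell.Solution₁ 2 →* ℤ√2 := ⟨⟨fun s => (s : ℤ√2), rfl⟩, fun _ _ => rfl⟩
  have haz : F a = z := by
    ext <;> rfl
  have hfund : ∀ n : ℤ, F ((Pell.Solution₁.mk 3 2 (by norm_num) : Pell.Solution₁ 2) ^ n) =
      (fundUnit ^ (2 * -n) : (ℤ√2)ˣ) := by
    intro n
    have h1 := map_zpow F.toHomUnits (Pell.Solution₁.mk 3 2 (by norm_num) : Pell.Solution₁ 2) n
    have h2 : F.toHomUnits (Pell.Solution₁.mk 3 2 (by norm_num) : Pell.Solution₁ 2) =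
        (fundUnit ^ (2 * (-1) : ℤ) : (ℤ√2)ˣ) := by
      apply Units.ext
      have : (fundUnit ^ (2 * (-1) : ℤ) : (ℤ√2)ˣ) = fundUnit⁻¹ * fundUnit⁻¹ := by
        rw [← sq, ← zpow_natCast, inv_zpow', ]; norm_num
      rw [this]
      ext <;> simp [fundUnit, F, Pell.Solution₁.mk] <;> rfl
    have h3 := congrArg Units.val h1
    rw [h2, ← zpow_mul] at h3
    rw [show (2 * -n : ℤ) = 2 * -1 * n by ring]
    exact h3
  rcases pell_fundamental.eq_zpow_or_neg_zpow a with ⟨n, hn | hn⟩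
  · refine ⟨-n, Or.inl ?_⟩
    rw [← haz, hn, hfund]
  · refine ⟨-n, Or.inr ?_⟩
    rw [← haz, hn, ← hfund]
    rfl

theorem norm_fundUnit : (fundUnit : ℤ√2).norm = -1 := by
  simp [fundUnit, Zsqrtd.norm_def]

theorem exists_fundUnit_zpow {z : ℤ√2} (hz : IsUnit z) :
    ∃ l : ℤ, z = (fundUnit ^ l : (ℤ√2)ˣ) ∨ z = -(fundUnit ^ l : (ℤ√2)ˣ) := by
  rw [Zsqrtd.isUnit_iff_norm_isUnit] at hz
  rcases Int.isUnit_iff.1 hz with h | h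
  · obtain ⟨l, hl⟩ := unit_of_norm_one h
    exact ⟨_, hl⟩
  · obtain ⟨l, hl⟩ := unit_of_norm_one (z := z * (fundUnit : ℤ√2))
      (by rw [Zsqrtd.norm_mul, norm_fundUnit, h]; norm_num)
    refine ⟨2 * l - 1, ?_⟩
    rw [zpow_sub_one]
    rcases hl with hl | hl
    · left
      rw [Units.val_mul, ← hl, mul_assoc, Units.mul_inv, mul_one]
    · right
      rw [Units.val_mul, ← neg_mul, ← hl, mul_assoc, Units.mul_inv, mul_one]

/-- Positivity in both real embeddings. -/
def TotPos (z : ℤ√2) : Prop := 0 < toReal z ∧ 0 < toReal (star z)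

theorem norm_eq_toReal_mul (z : ℤ√2) : (z.norm : ℝ) = toReal z * toReal (star z) := by
  rw [← toReal_mul, ← Zsqrtd.norm_eq_mul_conj, toReal_intCast]

theorem TotPos.norm_pos {z : ℤ√2} (h : TotPos z) : 0 < z.norm := by
  have := mul_pos h.1 h.2
  rw [← norm_eq_toReal_mul] at this
  exact_mod_cast this

/-- Totally positive units are squares, so each is the relative norm of a scalar unit and can be
absorbed when solving norm equations. -/
theorem totPos_unit {z : ℤ√2} (hz : IsUnit z) (hp : TotPos z) :
    ∃ l : ℤ, z = (fundUnit ^ (2 * l) : (ℤ√2)ˣ) := by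
  have h1 := hp.norm_pos
  rw [Zsqrtd.isUnit_iff_norm_isUnit] at hz
  have h2 : z.norm = 1 := by
    rcases Int.isUnit_iff.1 hz with h | h <;> omega
  obtain ⟨l, hl | hl⟩ := unit_of_norm_one h2
  · exact ⟨l, hl⟩
  · exfalso
    have h3 := hp.1
    rw [hl, toReal_neg, toReal_fundUnit_zpow, ← toReal_fundUnit] at h3
    have := zpow_pos toReal_fundUnit_pos (2 * l)
    linarith

/-- `fundUnit` has norm -1 and corrects the sign of the norm; after that the element or its negative
is positive in both embeddings. -/
theorem exists_totPos_associated {z : ℤ√2} (hz : z ≠ 0) :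
    ∃ l : ℤ, ∃ w : ℤ√2, TotPos w ∧
      (z = (fundUnit ^ l : (ℤ√2)ˣ) * w ∨ z = -((fundUnit ^ l : (ℤ√2)ˣ) * w)) := by
  have key : ∀ w : ℤ√2, 0 < w.norm → TotPos w ∨ TotPos (-w) := by
    intro w hw
    have : (0 : ℝ) < w.norm := by exact_mod_cast hw
    rw [norm_eq_toReal_mul] at this
    rcases pos_and_pos_or_neg_and_neg_of_mul_pos this with h | h
    · exact Or.inl h
    · right
      exact ⟨by simpa using h.1, by simpa using h.2⟩
  have hN : z.norm ≠ 0 := fun h => hz (norm_eq_zero_iff.1 h)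
  rcases lt_or_gt_of_ne hN with h | h
  · have h1 : 0 < ((fundUnit : ℤ√2) * z).norm := by
      rw [Zsqrtd.norm_mul, norm_fundUnit]; omega
    rcases key _ h1 with h2 | h2
    · exact ⟨-1, _, h2, Or.inl (by simp)⟩
    · exact ⟨-1, _, h2, Or.inr (by simp)⟩
  · rcases key _ h with h2 | h2
    · exact ⟨0, _, h2, Or.inl (by simp)⟩
    · exact ⟨0, _, h2, Or.inr (by simp)⟩

/-! ### Primes of `ℤ[√2]` -/

/-- For p = a + b√2 of prime norm ±q the residue field is 𝔽_q, with √2 ↦ -a/b; this is a square root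
of 2 because a² ≡ 2b² (mod q). -/
theorem exists_hom_zmod {p : ℤ√2} (hq : p.norm.natAbs.Prime) :
    ∃ f : ℤ√2 →+* ZMod p.norm.natAbs, ∀ t, f t = 0 ↔ p ∣ t := by
  set q := p.norm.natAbs with hqdef
  have : Fact q.Prime := ⟨hq⟩
  have hqn : (q : ℤ) ∣ p.norm := Int.natAbs_dvd_natAbs.1 (by simp [hqdef])
  have hN : p.norm = p.re * p.re - 2 * p.im * p.im := Zsqrtd.norm_def p
  have hnz : ((p.norm : ℤ) : ZMod q) = 0 := (ZMod.intCast_zmod_eq_zero_iff_dvd _ _).2 hqn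
  have hnorm : (p.re : ZMod q) * p.re - 2 * p.im * p.im = 0 := by
    rw [hN] at hnz
    exact_mod_cast hnz
  have hb : (p.im : ZMod q) ≠ 0 := by
    -- If q divided b it would divide a as well, and q² would divide the norm ±q.
    intro hb
    have ha : (p.re : ZMod q) = 0 := by
      rw [hb] at hnorm
      simpa using hnorm
    obtain ⟨u, hu⟩ := (ZMod.intCast_zmod_eq_zero_iff_dvd _ _).1 ha
    obtain ⟨v, hv⟩ := (ZMod.intCast_zmod_eq_zero_iff_dvd _ _).1 hb
    have h1 : (q : ℤ) * q ∣ p.norm := ⟨u * u - 2 * v * v, by rw [hN, hu, hv]; ring⟩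
    have h2 : q * q ∣ q := by
      have := Int.natAbs_dvd_natAbs.2 h1
      simpa [Int.natAbs_mul, ← hqdef] using this
    have h3 := Nat.le_of_dvd hq.pos h2
    nlinarith [hq.two_le]
  set r : ZMod q := -p.re / p.im with hr
  have hr2 : r * r = ((2 : ℤ) : ZMod q) := by
    rw [hr]
    field_simp
    push_cast
    linear_combination hnorm
  have hrb : r * p.im = -p.re := by rw [hr]; field_simp
  refine ⟨Zsqrtd.lift ⟨r, hr2⟩, fun t => ?_⟩
  have hf : ∀ t : ℤ√2, Zsqrtd.lift ⟨r, hr2⟩ t = (t.re : ZMod q) + t.im * r := fun t => rfl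
  constructor
  · intro ht
    rw [hf] at ht
    have h1 : ((t.im * p.re - t.re * p.im : ℤ) : ZMod q) = 0 := by
      push_cast
      linear_combination (-(p.im : ZMod q)) * ht + t.im * hrb
    have h2 : ((t.re * p.re - 2 * t.im * p.im : ℤ) : ZMod q) = 0 := by
      push_cast
      push_cast at hr2
      linear_combination (p.re : ZMod q) * ht + (-r * t.im) * hrb + (t.im * p.im) * hr2
    obtain ⟨u, hu⟩ := (ZMod.intCast_zmod_eq_zero_iff_dvd _ _).1 h1
    obtain ⟨v, hv⟩ := (ZMod.intCast_zmod_eq_zero_iff_dvd _ _).1 h2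
    obtain ⟨e, he⟩ : ∃ e : ℤ, (q : ℤ) = e * p.norm := by
      rcases Int.natAbs_eq p.norm with h | h
      · exact ⟨1, by omega⟩
      · exact ⟨-1, by omega⟩
    have hps : p ≠ 0 := by
      rintro rfl
      simp [hqdef] at hq
      exact Nat.not_prime_zero hq
    have hsp : star p ≠ 0 := star_ne_zero.2 hps
    refine ⟨⟨v, u⟩ * e, mul_right_cancel₀ hsp ?_⟩
    have h3 : t * star p = (q : ℤ) * ⟨v, u⟩ := by
      ext
      · simp; linear_combination hv
      · simp; linear_combination hu
    rw [h3, he, mul_right_comm, ← mul_assoc]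
    push_cast
    rw [Zsqrtd.norm_eq_mul_conj]
    ring
  · rintro ⟨s, rfl⟩
    rw [map_mul]
    have : Zsqrtd.lift ⟨r, hr2⟩ p = 0 := by
      rw [hf, mul_comm, hrb]; ring
    rw [this, zero_mul]

/-- A nontrivial zero of x² + y² in the residue field 𝔽_q would give a square root of -1, impossible
for q ≡ 3 (mod 4). -/
theorem dvd_of_dvd_sq_add_sq {p a b : ℤ√2} (hq : p.norm.natAbs.Prime)
    (h7 : p.norm.natAbs % 8 = 7) (h : p ∣ a ^ 2 + b ^ 2) : p ∣ a ∧ p ∣ b := by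
  obtain ⟨f, hf⟩ := exists_hom_zmod hq
  have : Fact p.norm.natAbs.Prime := ⟨hq⟩
  have key : ∀ x y : ZMod p.norm.natAbs, x ^ 2 + y ^ 2 = 0 → x = 0 := by
    intro x y hxy
    by_contra hx
    refine ZMod.mod_four_ne_three_of_sq_eq_neg_one (p := p.norm.natAbs) (y := y / x) ?_ (by omega)
    field_simp
    linear_combination hxy
  have h0 : f a ^ 2 + f b ^ 2 = 0 := by
    simpa using (hf _).2 h
  exact ⟨(hf a).1 (key _ _ h0), (hf b).1 (key _ _ (by rw [add_comm]; exact h0))⟩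

/-- Descent: if p divides a² + b² it divides a and b, and dividing both by p removes p² from the
sum. Odd exponents therefore never occur. -/
theorem pow_dvd_sq_add_sq_succ {p : ℤ√2} (hq : p.norm.natAbs.Prime)
    (h7 : p.norm.natAbs % 8 = 7) (k : ℕ) :
    ∀ a b : ℤ√2, p ^ (2 * k + 1) ∣ a ^ 2 + b ^ 2 → p ^ (2 * k + 2) ∣ a ^ 2 + b ^ 2 := by
  have hp0 : p ≠ 0 := by
    rintro rfl
    simp at hq
    exact Nat.not_prime_zero hq
  induction k with
  | zero =>
    intro a b h
    obtain ⟨⟨u, rfl⟩, ⟨v, rfl⟩⟩ := dvd_of_dvd_sq_add_sq hq h7 (by simpa using h)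
    exact ⟨u ^ 2 + v ^ 2, by ring⟩
  | succ k ih =>
    intro a b h
    obtain ⟨⟨u, rfl⟩, ⟨v, rfl⟩⟩ := dvd_of_dvd_sq_add_sq hq h7 (dvd_trans (dvd_pow_self p (by omega)) h)
    have e1 : (p * u) ^ 2 + (p * v) ^ 2 = p ^ 2 * (u ^ 2 + v ^ 2) := by ring
    have e2 : p ^ (2 * (k + 1) + 1) = p ^ 2 * p ^ (2 * k + 1) := by ring
    have e3 : p ^ (2 * (k + 1) + 2) = p ^ 2 * p ^ (2 * k + 2) := by ring
    rw [e1, e2] at h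
    rw [e1, e3]
    exact mul_dvd_mul_left _ (ih u v ((mul_dvd_mul_iff_left (pow_ne_zero 2 hp0)).1 h))

theorem even_emultiplicity_sq_add_sq {p : ℤ√2} (hq : p.norm.natAbs.Prime)
    (h7 : p.norm.natAbs % 8 = 7) (a b : ℤ√2) : Even (emultiplicity p (a ^ 2 + b ^ 2)) := by
  by_cases hfin : FiniteMultiplicity p (a ^ 2 + b ^ 2)
  · rw [hfin.emultiplicity_eq_multiplicity]
    have hev : Even (multiplicity p (a ^ 2 + b ^ 2)) := by
      by_contra hodd
      obtain ⟨k, hk⟩ := Nat.not_even_iff_odd.1 hodd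
      have h1 : p ^ (2 * k + 1) ∣ a ^ 2 + b ^ 2 := by
        rw [← hk]; exact pow_multiplicity_dvd _ _
      have h2 := pow_dvd_sq_add_sq_succ hq h7 k a b h1
      have h3 := hfin.le_multiplicity_of_pow_dvd h2
      omega
    obtain ⟨r, hr⟩ := hev
    exact ⟨(r : ℕ∞), by rw [hr]; push_cast; rfl⟩
  · rw [emultiplicity_eq_top.2 hfin]
    exact ⟨⊤, by simp⟩

theorem exists_nat_prime_dvd {p : ℤ√2} (hp : Prime p) :
    ∃ q : ℕ, q.Prime ∧ p ∣ (q : ℤ√2) := by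
  have hN : p.norm ≠ 0 := fun h => hp.ne_zero (norm_eq_zero_iff.1 h)
  have h1 : p ∣ ((p.norm.natAbs : ℕ) : ℤ√2) := by
    have h2 : p ∣ (p.norm : ℤ√2) := by
      rw [Zsqrtd.norm_eq_mul_conj]; exact dvd_mul_right _ _
    rcases Int.natAbs_eq p.norm with h | h
    · rwa [h, Int.cast_natCast] at h2
    · rw [h, Int.cast_neg, Int.cast_natCast] at h2
      exact dvd_neg.1 h2
  have key : ∀ n : ℕ, n ≠ 0 → p ∣ (n : ℤ√2) → ∃ q : ℕ, q.Prime ∧ p ∣ (q : ℤ√2) := by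
    intro n
    induction n using Nat.recOnMul with
    | zero => intro h; exact absurd rfl h
    | one => intro _ h; exact absurd (isUnit_of_dvd_one (by simpa using h)) hp.not_isUnit
    | prime q hq => intro _ h; exact ⟨q, hq, h⟩
    | mul a b iha ihb =>
      intro h0 h
      push_cast at h
      rcases hp.dvd_or_dvd h with h | h
      · exact iha (by rintro rfl; simp at h0) h
      · exact ihb (by rintro rfl; simp at h0) h
  exact key _ (by simpa using hN) h1

/-- Let q be the rational prime below p. For q ≡ 1, 5 (mod 8), -1 is a square mod q. For q ≡ 3, -2
is a square mod q, and √2 turns its root into a root of -1 mod p. For q ≡ 7, 2 is a square mod q, so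
q splits in ℤ[√2] and p has norm ±q, the excluded case. -/
theorem exists_dvd_sq_add_one {p : ℤ√2} (hp : Prime p) (h2 : ¬ p ∣ 2)
    (hin : ¬ (p.norm.natAbs.Prime ∧ p.norm.natAbs % 8 = 7)) : ∃ t : ℤ√2, p ∣ t ^ 2 + 1 := by
  obtain ⟨q, hq, hpq⟩ := exists_nat_prime_dvd hp
  have : Fact q.Prime := ⟨hq⟩
  have hq2 : q ≠ 2 := by
    rintro rfl
    exact h2 (by exact_mod_cast hpq)
  have hlift : ∀ n : ℤ, ((n : ℤ) : ZMod q) = 0 → p ∣ (n : ℤ√2) := by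
    intro n hn
    obtain ⟨u, hu⟩ := (ZMod.intCast_zmod_eq_zero_iff_dvd _ _).1 hn
    rw [hu]
    push_cast
    exact hpq.mul_right _
  have hqodd := hq.eq_two_or_odd.resolve_left hq2
  have hcast : ∀ x : ZMod q, ∃ n : ℤ, (n : ZMod q) = x := ZMod.intCast_surjective
  have h2ne : (2 : ZMod q) ≠ 0 := by
    intro h
    have h' : ((2 : ℕ) : ZMod q) = 0 := by exact_mod_cast h
    rw [ZMod.natCast_eq_zero_iff] at h'
    exact hq2 ((Nat.prime_dvd_prime_iff_eq hq Nat.prime_two).1 h')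
  have hmod : q % 8 = 1 ∨ q % 8 = 3 ∨ q % 8 = 5 ∨ q % 8 = 7 := by omega
  have hneg1 : q % 4 ≠ 3 → ∃ t : ℤ√2, p ∣ t ^ 2 + 1 := by
    intro h4
    obtain ⟨x, hx⟩ := ZMod.exists_sq_eq_neg_one_iff.2 h4
    obtain ⟨n, rfl⟩ := hcast x
    refine ⟨n, ?_⟩
    have := hlift (n ^ 2 + 1) (by push_cast; linear_combination -hx)
    push_cast at this
    exact this
  rcases hmod with h | h | h | h
  · exact hneg1 (by omega)
  · obtain ⟨x, hx⟩ := (ZMod.exists_sq_eq_neg_two_iff hq2).2 (Or.inr h)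
    obtain ⟨n, hn⟩ := hcast (x / 2)
    -- With n = x/2 and x² = -2 one has (n√2)² = x²/2 = -1.
    refine ⟨n * root2, ?_⟩
    have := hlift (2 * n ^ 2 + 1) (by
      push_cast
      rw [hn]
      field_simp
      linear_combination -hx)
    push_cast at this
    rw [mul_pow, root2_sq, mul_comm]
    exact this
  · exact hneg1 (by omega)
  · exfalso
    obtain ⟨x, hx⟩ := (ZMod.exists_sq_eq_two_iff hq2).2 (Or.inr h)
    obtain ⟨n, rfl⟩ := hcast x
    have h1 : p ∣ ((n : ℤ√2) - root2) * (n + root2) := by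
      have := hlift (n ^ 2 - 2) (by push_cast; linear_combination -hx)
      push_cast at this
      rw [← root2_sq] at this
      convert this using 1
      ring
    obtain ⟨w, hw⟩ := hpq
    have hnq : p.norm.natAbs * w.norm.natAbs = q ^ 2 := by
      have := congrArg (fun z => (Zsqrtd.norm z).natAbs) hw
      simp only [Zsqrtd.norm_mul, Int.natAbs_mul, Zsqrtd.norm_natCast, Int.natAbs_natCast] at this
      rw [← this, sq]
    obtain ⟨k, hk, hk2⟩ := (Nat.dvd_prime_pow hq).1 (Dvd.intro _ hnq)
    interval_cases k
    · exact hp.not_isUnit (Zsqrtd.norm_eq_one_iff.1 (by simpa using hk2))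
    · exact hin ⟨by rw [hk2]; simpa using hq, by rw [hk2]; simpa using h⟩
    -- Norm ±q² would make p an associate of q, which divides neither n - √2 nor n + √2 because
    -- their √2-coordinates are ±1.
    · rw [hk2] at hnq
      have hw1 : w.norm.natAbs = 1 := by
        have := pow_pos hq.pos 2
        exact Nat.eq_of_mul_eq_mul_left this (by rw [hnq, mul_one])
      have hwu : IsUnit w := Zsqrtd.norm_eq_one_iff.1 hw1
      have hqp : (q : ℤ√2) ∣ p := by
        rw [hw]
        exact (hwu.mul_right_dvd).2 dvd_rfl
      have hq1 : ¬ (q : ℤ) ∣ 1 := by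
        intro h
        have := Int.natAbs_dvd_natAbs.2 h
        simp at this
        exact hq.one_lt.ne' this
      rcases hp.dvd_or_dvd h1 with h3 | h3
      · have h4 := hqp.trans h3
        have := ((Zsqrtd.intCast_dvd (q : ℤ) _).1 (by exact_mod_cast h4)).2
        simp [root2] at this
        exact hq1 (by simpa using this)
      · have h4 := hqp.trans h3
        have := ((Zsqrtd.intCast_dvd (q : ℤ) _).1 (by exact_mod_cast h4)).2
        simp [root2] at this
        exact hq1 (by simpa using this)

/-! ### The ring `ℤ[ω]` -/

theorem sqrtTwo_sq : sqrtTwo ^ 2 = 2 := by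
  rw [sqrtTwo, ← Complex.ofReal_pow, Real.sq_sqrt (by norm_num)]
  norm_num

theorem sqrtTwo_ne_zero : sqrtTwo ≠ 0 := by
  intro h
  have := sqrtTwo_sq
  rw [h] at this
  norm_num at this

theorem omega_eq : omega = sqrtTwo / 2 * (1 + Complex.I) := by
  rw [omega, mul_comm, Complex.exp_mul_I, ← Complex.ofReal_cos, ← Complex.ofReal_sin,
    Real.cos_pi_div_four, Real.sin_pi_div_four, sqrtTwo]
  push_cast
  ring

theorem omega_sq : omega ^ 2 = Complex.I := by
  rw [omega_eq]
  linear_combination ((1 + Complex.I) ^ 2 / 4) * sqrtTwo_sq + Complex.I_sq / 2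

theorem omega_sq' : omega ^ 2 = sqrtTwo * omega - 1 := by
  rw [omega_sq, omega_eq]
  linear_combination (-(1 + Complex.I) / 2) * sqrtTwo_sq

theorem omega_pow_eight : omega ^ 8 = 1 := by
  rw [show omega ^ 8 = (omega ^ 2) ^ 4 by ring, omega_sq, Complex.I_pow_four]

theorem omega_ne_zero : omega ≠ 0 := Complex.exp_ne_zero _

theorem conj_sqrtTwo : starRingEnd ℂ sqrtTwo = sqrtTwo := Complex.conj_ofReal _

theorem conj_omega : starRingEnd ℂ omega = sqrtTwo - omega := by
  rw [omega_eq]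
  simp only [map_mul, map_div₀, conj_sqrtTwo, map_add, map_one, Complex.conj_I, map_ofNat]
  ring

theorem omega_mul_conj : omega * starRingEnd ℂ omega = 1 := by
  rw [conj_omega]
  linear_combination -omega_sq'

theorem norm_omega : ‖omega‖ = 1 := by
  rw [omega, mul_comm, Complex.norm_exp_ofReal_mul_I]

/-- `ℤ[ω]` as the quadratic algebra `ℤ[√2][X] / (X² - √2 X + 1)`. -/
abbrev ZOmega : Type := QuadraticAlgebra (ℤ√2) (-1) root2

namespace ZOmega

open QuadraticAlgebra

/-- The embedding of `ℤ[ω]` into `ℂ`. -/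
def toC : ZOmega →+* ℂ where
  toFun z := (toReal z.re : ℂ) + (toReal z.im : ℂ) * omega
  map_one' := by simp
  map_zero' := by simp
  map_add' z w := by simp; ring
  map_mul' z w := by
    have := omega_sq'
    rw [sqrtTwo] at this
    simp
    linear_combination (-(toReal z.im : ℂ) * toReal w.im) * this

theorem toC_apply (z : ZOmega) : toC z = (toReal z.re : ℂ) + (toReal z.im : ℂ) * omega := rfl

theorem toC_C (r : ℤ√2) : toC (algebraMap _ _ r) = (toReal r : ℂ) := by
  simp [toC_apply]

theorem toC_injective : Function.Injective toC := by
  rw [injective_iff_map_eq_zero]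
  intro z hz
  rw [toC_apply, omega_eq, sqrtTwo] at hz
  have him := congrArg Complex.im hz
  have hre := congrArg Complex.re hz
  simp at him hre
  rw [him] at hre
  simp at hre
  exact QuadraticAlgebra.ext hre him

instance : IsDomain ZOmega := Function.Injective.isDomain toC toC_injective

theorem conj_toC (z : ZOmega) : starRingEnd ℂ (toC z) = toC (star z) := by
  simp only [toC_apply, map_add, map_mul, Complex.conj_ofReal, conj_omega, re_star, im_star,
    toReal_add, toReal_mul, toReal_neg, toReal_root2, Complex.ofReal_add, Complex.ofReal_mul,
    Complex.ofReal_neg, sqrtTwo]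
  ring

theorem toC_mul_conj (z : ZOmega) : toC z * starRingEnd ℂ (toC z) = (toReal z.norm : ℂ) := by
  rw [conj_toC, ← map_mul, ← algebraMap_norm_eq_mul_star, toC_C]

theorem normSq_toC (z : ZOmega) : Complex.normSq (toC z) = toReal z.norm := by
  have := toC_mul_conj z
  rw [Complex.mul_conj] at this
  exact_mod_cast this

theorem norm_eq_zero {z : ZOmega} : z.norm = 0 ↔ z = 0 := by
  rw [← toReal_eq_zero, ← normSq_toC, Complex.normSq_eq_zero, map_eq_zero_iff _ toC_injective]

/-- The automorphism `√2 ↦ -√2`, `ω ↦ -ω`. -/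
def galois (z : ZOmega) : ZOmega := ⟨star z.re, -star z.im⟩

theorem norm_galois (z : ZOmega) : (galois z).norm = star z.norm := by
  simp [norm_def, galois, star_root2]

theorem toReal_norm_nonneg (z : ZOmega) : 0 ≤ toReal z.norm := by
  rw [← normSq_toC]; exact Complex.normSq_nonneg _

/-- The conjugate of a relative norm is the relative norm of the Galois conjugate; hence |y|² = ξ
requires ξ ≥ 0 in both embeddings. -/
theorem toReal_star_norm_nonneg (z : ZOmega) : 0 ≤ toReal (star z.norm) := by
  rw [← norm_galois]; exact toReal_norm_nonneg _

theorem totPos_norm {z : ZOmega} (hz : z ≠ 0) : TotPos z.norm := by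
  have h1 : z.norm ≠ 0 := fun h => hz (norm_eq_zero.1 h)
  refine ⟨lt_of_le_of_ne (toReal_norm_nonneg z) fun h => h1 (toReal_eq_zero.1 h.symm),
    lt_of_le_of_ne (toReal_star_norm_nonneg z) fun h => h1 ?_⟩
  exact star_eq_zero.1 (toReal_eq_zero.1 h.symm)

/-- `a + bω + cω² + dω³`. -/
def ofCoords (a b c d : ℤ) : ZOmega := ⟨⟨a - c, -d⟩, ⟨b + d, c⟩⟩

/-- The coordinates come from ω² = √2ω - 1 and ω³ = ω - √2. -/
theorem exists_coords (z : ZOmega) : ∃ a b c d : ℤ, z = ofCoords a b c d :=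
  ⟨z.re.re + z.im.im, z.im.re + z.re.im, z.im.im, -z.re.im, by
    ext <;> simp [ofCoords]⟩

theorem norm_ofCoords (a b c d : ℤ) :
    (ofCoords a b c d).norm = ⟨a ^ 2 + b ^ 2 + c ^ 2 + d ^ 2, a * b + b * c + c * d - d * a⟩ := by
  ext <;> simp [norm_def, ofCoords] <;> ring

theorem ofCoords_sub (a b c d a' b' c' d' n : ℤ) :
    ofCoords a b c d - ofCoords a' b' c' d' * (n : ZOmega) =
      ofCoords (a - a' * n) (b - b' * n) (c - c' * n) (d - d' * n) := by
  ext <;> simp [ofCoords] <;> ring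

/-- The left side S² - 2P² is the absolute norm of a + bω + cω² + dω³. Each square is at most n²/4,
so S ≤ n², and only S = n² needs care. Then every coordinate is ±n/2, and the four terms of P are
±n²/4 with product -(abcd)² < 0, so an odd number of them is negative and P ≠ 0. -/
theorem norm_form_lt {a b c d n : ℤ} (hn : 0 < n) (ha : |2 * a| ≤ n) (hb : |2 * b| ≤ n)
    (hc : |2 * c| ≤ n) (hd : |2 * d| ≤ n) :
    (a ^ 2 + b ^ 2 + c ^ 2 + d ^ 2) ^ 2 - 2 * (a * b + b * c + c * d - d * a) ^ 2 < n ^ 4 := by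
  have sq : ∀ x : ℤ, |2 * x| ≤ n → 4 * x ^ 2 ≤ n ^ 2 := by
    intro x hx
    have := sq_le_sq' (abs_le.1 hx).1 (abs_le.1 hx).2
    linarith
  have ha := sq a ha
  have hb := sq b hb
  have hc := sq c hc
  have hd := sq d hd
  have hS : a ^ 2 + b ^ 2 + c ^ 2 + d ^ 2 ≤ n ^ 2 := by linarith
  have hS0 : 0 ≤ a ^ 2 + b ^ 2 + c ^ 2 + d ^ 2 := by positivity
  rcases hS.lt_or_eq with h | h
  · have : (a ^ 2 + b ^ 2 + c ^ 2 + d ^ 2) ^ 2 < (n ^ 2) ^ 2 := by gcongr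
    nlinarith [sq_nonneg (a * b + b * c + c * d - d * a)]
  · rw [h]
    have hP : a * b + b * c + c * d - d * a ≠ 0 := by
      have e0 : 4 * a ^ 2 = n ^ 2 := by linarith
      have e1 : b ^ 2 = a ^ 2 := by linarith
      have e2 : c ^ 2 = a ^ 2 := by linarith
      have e3 : d ^ 2 = a ^ 2 := by linarith
      have ha2 : 0 < a ^ 2 := by nlinarith [pow_pos hn 2]
      rcases sq_eq_sq_iff_eq_or_eq_neg.1 e1 with rfl | rfl <;>
      rcases sq_eq_sq_iff_eq_or_eq_neg.1 e2 with rfl | rfl <;>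
      rcases sq_eq_sq_iff_eq_or_eq_neg.1 e3 with rfl | rfl <;>
      intro h0 <;> nlinarith
    have := sq_pos_of_ne_zero hP
    nlinarith

theorem norm_norm_nonneg (z : ZOmega) : 0 ≤ z.norm.norm := by
  have h : (0 : ℝ) ≤ z.norm.norm := by
    rw [norm_eq_toReal_mul]
    exact mul_nonneg (toReal_norm_nonneg z) (toReal_star_norm_nonneg z)
  exact_mod_cast h

/-- Division by rounding the four coordinates of x/y; `norm_form_lt` makes the absolute norm of the
remainder strictly smaller than that of y. -/
instance : IsPrincipalIdealRing ZOmega := by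
  refine isPrincipalIdealRing_of_size (fun z => z.norm.norm.natAbs) fun x y hy => ?_
  set n : ℤ := y.norm.norm with hn
  have hn0 : 0 < n := (totPos_norm hy).norm_pos
  set w : ZOmega := x * star y * algebraMap _ _ (star y.norm) with hw
  obtain ⟨a, b, c, d, habcd⟩ := exists_coords w
  obtain ⟨a', ha⟩ := exists_int_round a n hn0
  obtain ⟨b', hb⟩ := exists_int_round b n hn0
  obtain ⟨c', hc⟩ := exists_int_round c n hn0
  obtain ⟨d', hd⟩ := exists_int_round d n hn0
  set q := ofCoords a' b' c' d' with hq
  refine ⟨q, Or.inr ?_⟩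
  set r := x - q * y with hr
  set t := w - q * (n : ZOmega) with ht
  have hyy : y * star y * algebraMap _ _ (star y.norm) = (n : ZOmega) := by
    rw [← algebraMap_norm_eq_mul_star, ← map_mul, ← Zsqrtd.norm_eq_mul_conj, map_intCast]
  have key : r * (n : ZOmega) = t * y := by
    rw [ht, hw, hr]
    linear_combination (-x) * hyy
  have hN : r.norm.norm * n ^ 4 = t.norm.norm * n := by
    have := congrArg (fun z : ZOmega => z.norm.norm) key
    simp only [map_mul, Zsqrtd.norm_mul, norm_intCast] at this
    rw [← hn, sq, Zsqrtd.norm_mul, Zsqrtd.norm_intCast] at this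
    linarith
  have htlt : t.norm.norm < n ^ 4 := by
    rw [ht, habcd, hq, ofCoords_sub, norm_ofCoords, Zsqrtd.norm_def]
    have := norm_form_lt hn0 ha hb hc hd
    linarith
  have h3 : r.norm.norm * n ^ 3 < n * n ^ 3 := by
    have : n * (r.norm.norm * n ^ 3 - t.norm.norm) = 0 := by linear_combination hN
    rcases mul_eq_zero.1 this with h | h
    · omega
    · linarith
  have hlt : r.norm.norm < n := lt_of_mul_lt_mul_right h3 (by positivity)
  have h0 := norm_norm_nonneg r
  show r.norm.norm.natAbs < y.norm.norm.natAbs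
  omega

theorem isUnit_norm {z : ZOmega} : IsUnit z.norm ↔ IsUnit z :=
  isUnit_iff_norm_isUnit.symm

theorem prime_of_prime_norm {r : ZOmega} (hr : Prime r.norm) : Prime r := by
  rw [← irreducible_iff_prime]
  refine ⟨fun h => hr.not_isUnit (isUnit_norm.2 h), fun a b hab => ?_⟩
  have := hr.irreducible
  rw [hab, map_mul] at this
  rcases this.isUnit_or_isUnit rfl with h | h
  · exact Or.inl (isUnit_norm.1 h)
  · exact Or.inr (isUnit_norm.1 h)

/-- `ω` as an element of `ℤ[ω]`. -/
def om : ZOmega := ⟨0, 1⟩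

theorem toC_om : toC om = omega := by simp [toC_apply, om]

theorem norm_om : om.norm = 1 := by simp [norm_def, om]

/-- `1 - ω`, the prime above `2`. -/
def lam : ZOmega := 1 - om

theorem toC_lam : toC lam = 1 - omega := by rw [lam, map_sub, map_one, toC_om]

theorem norm_lam : lam.norm = root2 * fundUnit := by
  ext <;> simp [norm_def, lam, om, fundUnit]

theorem lam_sq : lam ^ 2 = algebraMap _ _ root2 * (-om * algebraMap _ _ (fundUnit : ℤ√2)) := by
  ext <;> simp [sq, lam, om, fundUnit]

/-- Modulo 1 - ω one has ω ≡ 1 and residue field 𝔽₂, so divisibility by 1 - ω means that a + b + c +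
d is even. That is also the parity of a² + b² + c² + d², the rational part of the norm. -/
theorem lam_dvd {z : ZOmega} (h : root2 ∣ z.norm) : lam ∣ z := by
  obtain ⟨a, b, c, d, rfl⟩ := exists_coords z
  rw [norm_ofCoords, root2_dvd_iff] at h
  simp only at h
  have h2 : (2 : ℤ) ∣ a - b - c - d := by
    rcases Int.even_or_odd a with ⟨a, rfl⟩ | ⟨a, rfl⟩ <;>
    rcases Int.even_or_odd b with ⟨b, rfl⟩ | ⟨b, rfl⟩ <;>
    rcases Int.even_or_odd c with ⟨c, rfl⟩ | ⟨c, rfl⟩ <;>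
    rcases Int.even_or_odd d with ⟨d, rfl⟩ | ⟨d, rfl⟩ <;>
    ring_nf at h <;> omega
  obtain ⟨e, he⟩ := h2
  have ha : a = 2 * e + b + c + d := by omega
  subst ha
  -- Partial sums invert multiplication by 1 - ω; the constant term closes up through ω⁴ = -1.
  refine ⟨ofCoords e (e + b) (e + b + c) (e + b + c + d), ?_⟩
  ext <;> simp [ofCoords, lam, om] <;> ring

theorem lam_pow_dvd (k : ℕ) {z : ZOmega} (h : root2 ^ k ∣ z.norm) : lam ^ k ∣ z := by
  induction k generalizing z with
  | zero => simp
  | succ k ih =>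
    obtain ⟨w, rfl⟩ := lam_dvd (dvd_trans (dvd_pow_self _ (Nat.succ_ne_zero k)) h)
    rw [map_mul, norm_lam, pow_succ', mul_assoc, mul_dvd_mul_iff_left root2_ne_zero] at h
    rw [pow_succ']
    exact mul_dvd_mul_left _ (ih ((fundUnit.isUnit.dvd_mul_left).1 h))

/-- √2 is (1 - ω)² up to a unit, so divisibility by powers of √2 can be read off the norm. -/
theorem root2_pow_dvd (k : ℕ) {z : ZOmega} (h : root2 ^ (2 * k) ∣ z.norm) :
    (algebraMap _ _ root2) ^ k ∣ z := by
  have h1 := lam_pow_dvd _ h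
  rw [pow_mul, lam_sq, mul_pow] at h1
  exact dvd_trans (dvd_mul_right _ _) h1

/-- The rational part of the norm is a sum of four integer squares; it equals 1 only for the eight
vectors ± a basis vector, which are the powers of ω. -/
theorem eq_om_pow {z : ZOmega} (h : z.norm = 1) : ∃ g < 8, z = om ^ g := by
  obtain ⟨a, b, c, d, rfl⟩ := exists_coords z
  have hS : a ^ 2 + b ^ 2 + c ^ 2 + d ^ 2 = 1 := by
    rw [norm_ofCoords] at h
    simpa using congrArg Zsqrtd.re h
  have e1 : om = ofCoords 0 1 0 0 := by ext <;> simp [om, ofCoords]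
  have e2 : om ^ 2 = ofCoords 0 0 1 0 := by ext <;> simp [sq, om, ofCoords]
  have e3 : om ^ 3 = ofCoords 0 0 0 1 := by
    ext <;> simp [pow_succ, om, ofCoords]
  have e4 : om ^ 4 = ofCoords (-1) 0 0 0 := by
    ext <;> simp [pow_succ, om, ofCoords]
  have e0 : om ^ 0 = ofCoords 1 0 0 0 := by ext <;> simp [ofCoords]
  have e5 : om ^ 5 = ofCoords 0 (-1) 0 0 := by ext <;> simp [pow_succ, om, ofCoords]
  have e6 : om ^ 6 = ofCoords 0 0 (-1) 0 := by ext <;> simp [pow_succ, om, ofCoords]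
  have e7 : om ^ 7 = ofCoords 0 0 0 (-1) := by ext <;> simp [pow_succ, om, ofCoords]
  have bd : ∀ x : ℤ, x ^ 2 ≤ 1 → x = 0 ∨ x = 1 ∨ x = -1 := by
    intro x hx
    have h1 : x ≤ 1 := by nlinarith
    have h2 : -1 ≤ x := by nlinarith
    omega
  rcases bd a (by nlinarith [sq_nonneg b, sq_nonneg c, sq_nonneg d]) with rfl | rfl | rfl
  · rcases bd b (by nlinarith [sq_nonneg c, sq_nonneg d]) with rfl | rfl | rfl
    · rcases bd c (by nlinarith [sq_nonneg d]) with rfl | rfl | rfl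
      · rcases bd d (by nlinarith) with rfl | rfl | rfl
        · norm_num at hS
        · exact ⟨3, by norm_num, e3.symm⟩
        · exact ⟨7, by norm_num, e7.symm⟩
      · have : d = 0 := by nlinarith
        subst this; exact ⟨2, by norm_num, e2.symm⟩
      · have : d = 0 := by nlinarith
        subst this; exact ⟨6, by norm_num, e6.symm⟩
    · have hc : c = 0 := by nlinarith [sq_nonneg d, sq_nonneg c]
      have hd : d = 0 := by nlinarith [sq_nonneg d, sq_nonneg c]
      subst hc hd; exact ⟨1, by norm_num, by rw [pow_one]; exact e1.symm⟩
    · have hc : c = 0 := by nlinarith [sq_nonneg d, sq_nonneg c]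
      have hd : d = 0 := by nlinarith [sq_nonneg d, sq_nonneg c]
      subst hc hd; exact ⟨5, by norm_num, e5.symm⟩
  all_goals
    have hb : b = 0 := by nlinarith [sq_nonneg d, sq_nonneg c, sq_nonneg b]
    have hc : c = 0 := by nlinarith [sq_nonneg d, sq_nonneg c, sq_nonneg b]
    have hd : d = 0 := by nlinarith [sq_nonneg d, sq_nonneg c, sq_nonneg b]
    subst hb hc hd
  · exact ⟨0, by norm_num, e0.symm⟩
  · exact ⟨4, by norm_num, e4.symm⟩

theorem totPos_of_mul {z w : ℤ√2} (hz : TotPos z) (h : TotPos (z * w)) : TotPos w := by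
  obtain ⟨h1, h2⟩ := h
  rw [star_mul'] at h2
  rw [toReal_mul] at h1 h2
  exact ⟨(pos_iff_pos_of_mul_pos h1).1 hz.1, (pos_iff_pos_of_mul_pos h2).1 hz.2⟩

/-- Take p ∣ t² + 1 = (t + i)(t - i), where i = √2ω - 1. As p does not divide √2, it divides neither
factor, so p is not prime in ℤ[ω] and has a non-unit factor whose norm is p up to a unit. Total
positivity makes that unit (√2 - 1)^{2l}, and rescaling by (√2 - 1)^{-l} removes it. -/
theorem exists_norm_eq_prime {p : ℤ√2} (hp : Prime p) (h2 : ¬ p ∣ 2) (hpos : TotPos p)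
    (hin : ¬ (p.norm.natAbs.Prime ∧ p.norm.natAbs % 8 = 7)) : ∃ r : ZOmega, r.norm = p := by
  obtain ⟨t, ht⟩ := exists_dvd_sq_add_one hp h2 hin
  have hr2 : ¬ p ∣ root2 := fun h => h2 (by rw [← root2_sq]; exact dvd_pow h two_ne_zero)
  set P : ZOmega := algebraMap _ _ p with hP
  have hPn : P.norm = p ^ 2 := by rw [hP, QuadraticAlgebra.norm_algebraMap]
  have hP0 : P ≠ 0 := by
    intro h
    rw [h, QuadraticAlgebra.norm_zero] at hPn
    exact hp.ne_zero (pow_eq_zero_iff two_ne_zero |>.1 hPn.symm)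
  have hPu : ¬ IsUnit P := by
    intro h
    rw [← isUnit_norm, hPn, isUnit_pow_iff two_ne_zero] at h
    exact hp.not_isUnit h
  have hPp : ¬ Prime P := by
    intro h
    have h1 : P ∣ (⟨t - 1, root2⟩ : ZOmega) * ⟨t + 1, -root2⟩ := by
      have e : (⟨t - 1, root2⟩ : ZOmega) * ⟨t + 1, -root2⟩ = algebraMap _ _ (t ^ 2 + 1) := by
        rw [algebraMap_eq]
        ext1
        · simp; linear_combination root2_mul_self
        · simp; linear_combination (-root2) * root2_mul_self
      rw [e, hP, algebraMap_dvd_iff_dvd]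
      exact ht
    rcases h.dvd_or_dvd h1 with h | h
    · exact hr2 (algebraMap_dvd_iff.1 h).2
    · exact hr2 ((dvd_neg).1 (algebraMap_dvd_iff.1 h).2)
  rw [← irreducible_iff_prime, irreducible_iff] at hPp
  push Not at hPp
  obtain ⟨a, b, hab, ha, hb⟩ := hPp hPu
  have hAB : a.norm * b.norm = p ^ 2 := by rw [← map_mul, ← hab, hPn]
  obtain ⟨i, hi, hia⟩ := (dvd_prime_pow hp 2).1 (Dvd.intro _ hAB)
  have ha0 : a ≠ 0 := by
    rintro rfl
    exact hP0 (by rw [hab, zero_mul])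
  interval_cases i
  · exact absurd (isUnit_norm.1 (associated_one_iff_isUnit.1 (by simpa using hia))) ha
  · obtain ⟨u, hu⟩ := hia.symm
    rw [pow_one] at hu
    have hpa : TotPos (p * u) := by rw [hu]; exact totPos_norm ha0
    obtain ⟨l, hl⟩ := totPos_unit u.isUnit (totPos_of_mul hpos hpa)
    refine ⟨a * algebraMap _ _ ((fundUnit ^ (-l) : (ℤ√2)ˣ) : ℤ√2), ?_⟩
    rw [map_mul, QuadraticAlgebra.norm_algebraMap, ← hu, hl, mul_assoc, ← Units.val_pow_eq_pow_val, ← Units.val_mul,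
      ← zpow_natCast, ← zpow_mul, ← zpow_add]
    simp [mul_comm]
  · exfalso
    obtain ⟨u, hu⟩ := hia
    apply hb
    rw [← isUnit_norm]
    have : a.norm * b.norm = a.norm * u := by rw [hAB, hu]
    have ha1 : a.norm ≠ 0 := fun h => ha0 (norm_eq_zero.1 h)
    rw [mul_left_cancel₀ ha1 this]
    exact u.isUnit

theorem mem_ringOmega {c : ℂ} : c ∈ ringOmega ↔ ∃ z, toC z = c := by
  constructor
  · intro h
    refine Algebra.adjoin_induction (p := fun c _ => ∃ z, toC z = c) ?_ ?_ ?_ ?_ h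
    · rintro x hx
      rw [Set.mem_singleton_iff] at hx
      exact ⟨om, by rw [toC_om, hx]⟩
    · intro r
      exact ⟨r, by simp⟩
    · rintro x y _ _ ⟨z, rfl⟩ ⟨w, rfl⟩
      exact ⟨z + w, map_add _ _ _⟩
    · rintro x y _ _ ⟨z, rfl⟩ ⟨w, rfl⟩
      exact ⟨z * w, map_mul _ _ _⟩
  · rintro ⟨z, rfl⟩
    obtain ⟨a, b, c, d, rfl⟩ := exists_coords z
    have hom : omega ∈ ringOmega := Algebra.subset_adjoin (Set.mem_singleton _)
    have : toC (ofCoords a b c d) = a + b * omega + c * omega ^ 2 + d * omega ^ 3 := by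
      have h := omega_sq'
      rw [sqrtTwo] at h
      rw [toC_apply]
      simp [ofCoords, toReal]
      have h4 : (Real.sqrt 2 : ℂ) ^ 2 = 2 := sqrtTwo_sq
      linear_combination (-(c : ℂ) - d * omega - d * Real.sqrt 2) * h - (d * omega) * h4
    rw [this]
    have hz : ∀ n : ℤ, (n : ℂ) ∈ ringOmega := fun n => intCast_mem _ n
    exact add_mem (add_mem (add_mem (hz a) (mul_mem (hz b) hom)) (mul_mem (hz c) (pow_mem hom 2)))
      (mul_mem (hz d) (pow_mem hom 3))

theorem toC_root2 : toC (algebraMap _ _ root2) = sqrtTwo := by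
  rw [toC_C, toReal_root2, sqrtTwo]

theorem toC_mem_exactRing (z : ZOmega) : toC z ∈ exactRing := by
  have hI : Complex.I ∈ exactRing := Algebra.subset_adjoin (by simp)
  have hs : sqrtTwo⁻¹ ∈ exactRing := Algebra.subset_adjoin (by simp)
  have hs2 : sqrtTwo ∈ exactRing := by
    have : sqrtTwo = 2 * sqrtTwo⁻¹ := by
      have := sqrtTwo_ne_zero
      field_simp
      exact sqrtTwo_sq
    rw [this]
    exact mul_mem (by exact_mod_cast natCast_mem exactRing 2) hs
  have ho : omega ∈ exactRing := by
    have : omega = sqrtTwo⁻¹ * (1 + Complex.I) := by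
      have := sqrtTwo_ne_zero
      rw [omega_eq]
      field_simp
      linear_combination (1 + Complex.I) * sqrtTwo_sq
    rw [this]
    exact mul_mem hs (add_mem (one_mem _) hI)
  have hr : ∀ r : ℤ√2, (toReal r : ℂ) ∈ exactRing := by
    intro r
    have : (toReal r : ℂ) = r.re + r.im * sqrtTwo := by simp [toReal, sqrtTwo]
    rw [this]
    exact add_mem (intCast_mem _ _) (mul_mem (intCast_mem _ _) hs2)
  rw [toC_apply]
  exact add_mem (hr _) (mul_mem (hr _) ho)

/-- ℤ[i, 1/√2] is ℤ[ω] with √2 inverted, since ω = (1 + i)/√2 and i = ω². -/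
theorem mem_exactRing {c : ℂ} : c ∈ exactRing ↔ ∃ z : ZOmega, ∃ j : ℕ, c * sqrtTwo ^ j = toC z := by
  constructor
  · intro h
    refine Algebra.adjoin_induction (p := fun c _ => ∃ z : ZOmega, ∃ j : ℕ, c * sqrtTwo ^ j = toC z)
      ?_ ?_ ?_ ?_ h
    · rintro x (rfl | hx)
      · exact ⟨om ^ 2, 0, by rw [map_pow, toC_om, omega_sq]; simp⟩
      · rw [Set.mem_singleton_iff] at hx
        refine ⟨1, 1, ?_⟩
        rw [hx, pow_one, inv_mul_cancel₀ sqrtTwo_ne_zero, map_one]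
    · intro r
      exact ⟨r, 0, by simp⟩
    · rintro x y _ _ ⟨z, j, hz⟩ ⟨w, k, hw⟩
      refine ⟨z * algebraMap _ _ root2 ^ k + w * algebraMap _ _ root2 ^ j, j + k, ?_⟩
      rw [map_add, map_mul, map_mul, map_pow, map_pow, toC_root2, ← hz, ← hw]
      ring
    · rintro x y _ _ ⟨z, j, hz⟩ ⟨w, k, hw⟩
      refine ⟨z * w, j + k, ?_⟩
      rw [map_mul, ← hz, ← hw]
      ring
  · rintro ⟨z, j, h⟩
    have : c = toC z * sqrtTwo⁻¹ ^ j := by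
      rw [← h, inv_pow, mul_assoc, mul_inv_cancel₀ (pow_ne_zero _ sqrtTwo_ne_zero), mul_one]
    rw [this]
    exact mul_mem (toC_mem_exactRing z) (pow_mem (Algebra.subset_adjoin (by simp)) j)

end ZOmega

/-! ### Factorization in ℤ[√2] and all solutions of |y|² = ξ in ℤ[ω]. -/

section

open ZOmega QuadraticAlgebra

/-! ### Factorizations in `ℤ[√2]` -/

/-- The conditions imposed on a single prime power by `Factorization.IsFor`. -/
structure PrimePower.Valid (f : PrimePower) : Prop where
  prime : Prime f.prime
  odd : ¬ f.prime ∣ 2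
  pos : TotPos f.prime
  root : ¬ f.IsInert → ∃ r : ZOmega, toC r = f.root ∧ r.norm = f.prime

theorem Factorization.IsFor.valid {F : Factorization} {ξ : ℤ√2} (h : F.IsFor ξ) :
    ∀ f ∈ F.primes, f.Valid := by
  intro f hf
  refine ⟨h.prime f hf, h.odd f hf, h.pos f hf, fun hin => ?_⟩
  obtain ⟨h1, h2⟩ := h.root f hf hin
  obtain ⟨r, hr⟩ := mem_ringOmega.1 h1
  refine ⟨r, hr, toReal_injective ?_⟩
  rw [← hr, toC_mul_conj] at h2
  exact_mod_cast h2

theorem exists_root {p : ℤ√2} (hp : Prime p) (h2 : ¬ p ∣ 2) (hpos : TotPos p) (e : ℕ) :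
    ∃ f : PrimePower, f.Valid ∧ f.prime = p ∧ f.exponent = e := by
  by_cases hin : p.norm.natAbs.Prime ∧ p.norm.natAbs % 8 = 7
  · exact ⟨⟨p, e, 0⟩, ⟨hp, h2, hpos, fun h => absurd hin h⟩, rfl, rfl⟩
  · obtain ⟨r, hr⟩ := exists_norm_eq_prime hp h2 hpos hin
    exact ⟨⟨p, e, toC r⟩, ⟨hp, h2, hpos, fun _ => ⟨r, rfl, hr⟩⟩, rfl, rfl⟩

/-- The product of the listed prime powers. -/
def primeProd (L : List PrimePower) : ℤ√2 := (L.map fun f => f.prime ^ f.exponent).prod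

@[simp] theorem primeProd_nil : primeProd [] = 1 := rfl

@[simp] theorem primeProd_cons (f : PrimePower) (L : List PrimePower) :
    primeProd (f :: L) = f.prime ^ f.exponent * primeProd L := by
  simp [primeProd]

theorem primeProd_perm {L L' : List PrimePower} (h : L.Perm L') : primeProd L = primeProd L' :=
  (h.map _).prod_eq

theorem toReal_primeProd (L : List PrimePower) :
    toReal (primeProd L) = (L.map fun f => toReal f.prime ^ f.exponent).prod := by
  induction L with
  | nil => simp
  | cons f L ih => simp [ih]

/-- The primes listed are pairwise non-associated. -/
abbrev Distinct (L : List PrimePower) : Prop :=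
  L.Pairwise fun f g => ¬ Associated f.prime g.prime

theorem distinct_perm {L L' : List PrimePower} (h : L.Perm L') (hL : Distinct L) : Distinct L' :=
  (h.pairwise_iff (fun {_ _} hab hba => hab hba.symm)).1 hL

theorem dvd_root2_of_dvd_two {p : ℤ√2} (hp : Prime p) (h : p ∣ 2) : Associated p root2 := by
  rw [← root2_mul_self] at h
  have hd : p ∣ root2 := by rcases hp.dvd_or_dvd h with h | h <;> exact h
  obtain ⟨s, hs⟩ := hd
  have hN : 2 = p.norm.natAbs * s.norm.natAbs := by
    rw [← Int.natAbs_mul, ← Zsqrtd.norm_mul, ← hs]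
    simp [Zsqrtd.norm_def]
  have hp1 : p.norm.natAbs ≠ 1 := fun h => hp.not_isUnit (Zsqrtd.norm_eq_one_iff.1 h)
  have hs1 : s.norm.natAbs = 1 := by
    rcases (Nat.dvd_prime Nat.prime_two).1 (Dvd.intro _ hN.symm) with h | h
    · exact absurd h hp1
    · rw [h] at hN; omega
  obtain ⟨u, hu⟩ := Zsqrtd.norm_eq_one_iff.1 hs1
  exact ⟨u, by rw [hu, ← hs]⟩

/-- Each prime is replaced by a totally positive associate, the units being collected in u. If an
associate is already listed its exponent is raised instead, which keeps the list pairwise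
non-associated. -/
theorem exists_factorization_aux (ξ : ℤ√2) : ξ ≠ 0 →
    ∃ (u : (ℤ√2)ˣ) (k : ℕ) (L : List PrimePower), (∀ f ∈ L, f.Valid) ∧ Distinct L ∧
      ξ = u * root2 ^ k * primeProd L := by
  induction ξ using UniqueFactorizationMonoid.induction_on_prime with
  | h₁ => exact fun h => absurd rfl h
  | h₂ x hx =>
    obtain ⟨u, rfl⟩ := hx
    exact fun _ => ⟨u, 0, [], by simp, List.Pairwise.nil, by simp⟩
  | h₃ x q hx hq ih =>
    intro _
    obtain ⟨u, k, L, hL, hd, rfl⟩ := ih hx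
    by_cases hq2 : q ∣ 2
    · obtain ⟨v, hv⟩ := (dvd_root2_of_dvd_two hq hq2).symm
      exact ⟨u * v, k + 1, L, hL, hd, by rw [← hv]; push_cast; ring⟩
    obtain ⟨v, p, hp, hpos⟩ : ∃ v : (ℤ√2)ˣ, ∃ p, p * v = q ∧ TotPos p := by
      obtain ⟨l, p, hpos, h | h⟩ := exists_totPos_associated hq.ne_zero
      · exact ⟨fundUnit ^ l, p, by rw [h, mul_comm], hpos⟩
      · exact ⟨-fundUnit ^ l, p, by rw [h]; push_cast; ring, hpos⟩
    have hpq : Associated q p := Associated.symm ⟨v, hp⟩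
    have hpp : Prime p := hpq.prime hq
    have hp2 : ¬ p ∣ 2 := fun h => hq2 (hpq.dvd.trans h)
    by_cases hex : ∃ f ∈ L, Associated f.prime p
    · obtain ⟨f, hf, w, hw⟩ := hex
      obtain ⟨s, t, hst⟩ := List.append_of_mem hf
      have hperm : L.Perm (f :: (s ++ t)) := by rw [hst]; exact List.perm_middle
      obtain ⟨h1, h2⟩ := List.pairwise_cons.1 (distinct_perm hperm hd)
      have hfv := hL f hf
      refine ⟨u * v * w, k, ⟨f.prime, f.exponent + 1, f.root⟩ :: (s ++ t), ?_, ?_, ?_⟩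
      · intro g hg
        rcases List.mem_cons.1 hg with rfl | hg
        · exact ⟨hfv.prime, hfv.odd, hfv.pos, hfv.root⟩
        · exact hL g (hperm.mem_iff.2 (List.mem_cons_of_mem _ hg))
      · exact List.pairwise_cons.2 ⟨h1, h2⟩
      · rw [primeProd_perm hperm, primeProd_cons, primeProd_cons, ← hp, ← hw]
        push_cast
        ring
    · obtain ⟨f, hfv, hfp, hfe⟩ := exists_root hpp hp2 hpos 1
      refine ⟨u * v, k, f :: L, ?_, ?_, ?_⟩
      · intro g hg
        rcases List.mem_cons.1 hg with rfl | hg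
        · exact hfv
        · exact hL g hg
      · refine List.pairwise_cons.2 ⟨fun g hg h => hex ⟨g, hg, ?_⟩, hd⟩
        rw [hfp] at h
        exact h.symm
      · rw [primeProd_cons, hfp, hfe, ← hp]
        push_cast
        ring

theorem toReal_primeProd_pos {L : List PrimePower} (hL : ∀ f ∈ L, f.Valid) :
    TotPos (primeProd L) := by
  induction L with
  | nil => constructor <;> simp
  | cons f L ih =>
    obtain ⟨h1, h2⟩ := ih fun g hg => hL g (List.mem_cons_of_mem _ hg)
    obtain ⟨h3, h4⟩ := (hL f List.mem_cons_self).pos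
    constructor
    · rw [primeProd_cons, toReal_mul, toReal_pow]; positivity
    · rw [primeProd_cons, star_mul', star_pow', toReal_mul, toReal_pow]; positivity

theorem exists_isFor {ξ : ℤ√2} (hξ : TotPos ξ) : ∃ F : Factorization, F.IsFor ξ := by
  have h0 : ξ ≠ 0 := by
    rintro rfl
    simpa using hξ.1
  obtain ⟨u, k, L, hL, hd, rfl⟩ := exists_factorization_aux ξ h0
  have hLpos := (toReal_primeProd_pos hL).1
  have hupos : 0 < toReal u := by
    have := hξ.1
    rw [toReal_mul, toReal_mul, toReal_pow, toReal_root2] at this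
    have h2 : (0 : ℝ) < Real.sqrt 2 ^ k := by positivity
    exact (pos_iff_pos_of_mul_pos ((pos_iff_pos_of_mul_pos this).2 hLpos)).2 h2
  obtain ⟨l, hl⟩ : ∃ l : ℤ, (u : ℤ√2) = (fundUnit ^ l : (ℤ√2)ˣ) := by
    obtain ⟨l, h | h⟩ := exists_fundUnit_zpow u.isUnit
    · exact ⟨l, h⟩
    · exfalso
      rw [h, toReal_neg, toReal_fundUnit_zpow, ← toReal_fundUnit] at hupos
      linarith [zpow_pos toReal_fundUnit_pos l]
  refine ⟨⟨l, k, L⟩, ?_, fun f hf => (hL f hf).prime, fun f hf => (hL f hf).odd,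
    fun f hf => (hL f hf).pos, hd, fun f hf hin => ?_⟩
  · rw [toReal_mul, toReal_mul, toReal_pow, toReal_root2, toReal_primeProd, hl,
      toReal_fundUnit_zpow]
  · obtain ⟨r, hr, hn⟩ := (hL f hf).root hin
    exact ⟨mem_ringOmega.2 ⟨r, hr⟩, by rw [← hr, toC_mul_conj, hn]⟩

theorem Factorization.IsFor.eq_zsqrtd {F : Factorization} {ξ : ℤ√2} (h : F.IsFor ξ) :
    ξ = (fundUnit ^ F.unitExp : (ℤ√2)ˣ) * root2 ^ F.sqrtExp * primeProd F.primes := by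
  apply toReal_injective
  rw [h.eq, toReal_mul, toReal_mul, toReal_pow, toReal_root2, toReal_primeProd,
    toReal_fundUnit_zpow]

theorem toReal_star_fundUnit_neg : toReal (star (fundUnit : ℤ√2)) < 0 := by
  have : (0 : ℝ) < Real.sqrt 2 := by positivity
  simp [toReal, fundUnit]
  linarith

theorem toReal_star_fundUnit_zpow (l : ℤ) :
    toReal (star ((fundUnit ^ l : (ℤ√2)ˣ) : ℤ√2)) = toReal (star (fundUnit : ℤ√2)) ^ l := by
  have h := map_zpow (Units.map ((toRealHom : ℤ√2 →* ℝ).comp (starRingEnd (ℤ√2) : ℤ√2 →* ℤ√2)))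
    fundUnit l
  have h2 := congrArg (Units.val) h
  simp only [Units.coe_map, Units.val_zpow_eq_zpow_val] at h2
  simp only [toReal_eq]
  exact h2

/-- Under √2 ↦ -√2 both √2 - 1 and √2 become negative, so positivity of the conjugate of ξ forces
the two exponents to have equal parity. The halved exponent in `Factorization.solutions` is thus
exact. -/
theorem Factorization.IsFor.even {F : Factorization} {ξ : ℤ√2} (h : F.IsFor ξ) (hξ : TotPos ξ) :
    Even (F.unitExp - F.sqrtExp) := by
  have h1 := hξ.2
  rw [h.eq_zsqrtd, star_mul', star_mul', star_pow', star_root2, toReal_mul, toReal_mul,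
    toReal_pow, toReal_neg, toReal_root2, toReal_star_fundUnit_zpow] at h1
  have h2 := (pos_iff_pos_of_mul_pos h1).2 (toReal_primeProd_pos h.valid).2
  have h3 : (0 : ℝ) < Real.sqrt 2 := by positivity
  rw [← zpow_natCast] at h2
  by_contra hodd
  rw [Int.not_even_iff_odd, Int.odd_sub] at hodd
  rcases Int.even_or_odd F.unitExp with he | ho
  · have h4 : Odd (F.sqrtExp : ℤ) := by
      rw [← Int.not_even_iff_odd]
      intro h5
      exact (Int.not_odd_iff_even.2 he) (hodd.2 h5)
    have h5 := he.zpow_pos (toReal_star_fundUnit_neg.ne)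
    have h6 := h4.zpow_neg (show -Real.sqrt 2 < 0 by linarith)
    nlinarith
  · have h4 : Even (F.sqrtExp : ℤ) := hodd.1 ho
    have h5 := ho.zpow_neg (toReal_star_fundUnit_neg)
    have h6 := h4.zpow_pos (show -Real.sqrt 2 ≠ 0 by linarith)
    nlinarith

/-- This links the exponents in the list to the multiplicities tested by `IsSolvable`. -/
theorem emultiplicity_prime {F : Factorization} {ξ : ℤ√2} (h : F.IsFor ξ) {f : PrimePower}
    (hf : f ∈ F.primes) : emultiplicity f.prime ξ = f.exponent := by
  obtain ⟨s, t, hst⟩ := List.append_of_mem hf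
  have hperm : F.primes.Perm (f :: (s ++ t)) := by rw [hst]; exact List.perm_middle
  obtain ⟨h1, -⟩ := List.pairwise_cons.1 (distinct_perm hperm h.distinct)
  have hp := h.prime f hf
  have hodd := h.odd f hf
  have hval : ∀ g ∈ s ++ t, g.Valid := fun g hg =>
    h.valid g (hperm.mem_iff.2 (List.mem_cons_of_mem _ hg))
  have hrest : ¬ f.prime ∣ primeProd (s ++ t) := by
    intro hd
    obtain ⟨x, hx, hdx⟩ := (hp.dvd_prod_iff).1 hd
    obtain ⟨g, hg, rfl⟩ := List.mem_map.1 hx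
    have := hp.dvd_of_dvd_pow hdx
    exact h1 g hg (hp.associated_of_dvd (hval g hg).prime this)
  have hnd : ¬ f.prime ∣ (fundUnit ^ F.unitExp : (ℤ√2)ˣ) * root2 ^ F.sqrtExp *
      primeProd (s ++ t) := by
    intro hd
    rcases hp.dvd_or_dvd hd with hd | hd
    · rw [Units.dvd_mul_left] at hd
      have := hp.dvd_of_dvd_pow hd
      exact hodd (by rw [← root2_mul_self]; exact this.mul_right _)
    · exact hrest hd
  rw [h.eq_zsqrtd, primeProd_perm hperm, primeProd_cons, mul_left_comm, emultiplicity_mul hp,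
    emultiplicity_eq_zero.2 hnd, add_zero, emultiplicity_pow_self hp.ne_zero hp.not_isUnit]

/-! ### The relative norm equation -/

theorem not_dvd_two_of_inert {p : ℤ√2} (hq : p.norm.natAbs.Prime)
    (h7 : p.norm.natAbs % 8 = 7) : ¬ p ∣ 2 := by
  rintro ⟨s, hs⟩
  have h4 : (2 : ℕ) ^ 2 = p.norm.natAbs * s.norm.natAbs := by
    rw [← Int.natAbs_mul, ← Zsqrtd.norm_mul, ← hs]
    simp [Zsqrtd.norm_def]
  have h2 : p.norm.natAbs ∣ 2 := hq.dvd_of_dvd_pow (Dvd.intro _ h4.symm)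
  have := (Nat.prime_dvd_prime_iff_eq hq Nat.prime_two).1 h2
  omega

/-- √2(u + vω) has real part √2u + v and imaginary part v. Up to the factor 2, a relative norm is
thus a sum of two squares in ℤ[√2], and the descent for primes over 8n - 1 applies. -/
theorem two_mul_norm (y : ZOmega) :
    2 * y.norm = (root2 * y.re + y.im) ^ 2 + y.im ^ 2 := by
  rw [norm_def]
  linear_combination (-y.re ^ 2) * root2_sq

theorem inert_dvd {p : ℤ√2} (hp : Prime p) (hq : p.norm.natAbs.Prime)
    (h7 : p.norm.natAbs % 8 = 7) {y : ZOmega} (h : p ∣ y.norm) : algebraMap _ _ p ∣ y := by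
  have h1 := two_mul_norm y ▸ (h.mul_left 2)
  obtain ⟨h2, h3⟩ := dvd_of_dvd_sq_add_sq hq h7 h1
  have h4 : p ∣ root2 * y.re := (dvd_add_left h3).1 h2
  refine algebraMap_dvd_iff.2 ⟨(hp.dvd_or_dvd h4).resolve_left fun h5 => ?_, h3⟩
  exact not_dvd_two_of_inert hq h7 (by rw [← root2_mul_self]; exact h5.mul_right _)

theorem isSolvable_norm (y : ZOmega) : IsSolvable y.norm := by
  refine ⟨toReal_norm_nonneg y, toReal_star_norm_nonneg y, fun p hp hq h7 => ?_⟩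
  have h1 := even_emultiplicity_sq_add_sq hq h7 (root2 * y.re + y.im) y.im
  rwa [← two_mul_norm, emultiplicity_mul hp,
    emultiplicity_eq_zero.2 (not_dvd_two_of_inert hq h7), zero_add] at h1

theorem mem_solutions_prime {f : PrimePower} (hf : f.Valid) (hev : f.IsInert → Even f.exponent)
    {c : ℂ} (hc : c ∈ f.solutions) :
    ∃ w : ZOmega, toC w = c ∧ w.norm = f.prime ^ f.exponent := by
  unfold PrimePower.solutions at hc
  split_ifs at hc with hin
  · rw [List.mem_singleton] at hc
    refine ⟨algebraMap _ _ f.prime ^ (f.exponent / 2), by rw [map_pow, toC_C, hc], ?_⟩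
    rw [map_pow, QuadraticAlgebra.norm_algebraMap, ← pow_mul, Nat.two_mul_div_two_of_even (hev hin)]
  · obtain ⟨a, ha, rfl⟩ := List.mem_map.1 hc
    rw [List.mem_range] at ha
    obtain ⟨r, hr, hn⟩ := hf.root hin
    refine ⟨r ^ a * star r ^ (f.exponent - a), ?_, ?_⟩
    · rw [map_mul, map_pow, map_pow, ← conj_toC, hr]
    · rw [map_mul, map_pow, map_pow, QuadraticAlgebra.norm_star, hn, ← pow_add]
      congr 1
      omega

theorem inert_pow_dvd {p : ℤ√2} (hp : Prime p) (hq : p.norm.natAbs.Prime)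
    (h7 : p.norm.natAbs % 8 = 7) (m : ℕ) : ∀ (y : ZOmega) (ρ : ℤ√2),
    y.norm = p ^ (2 * m) * ρ → ∃ y', y = algebraMap _ _ p ^ m * y' ∧ y'.norm = ρ := by
  induction m with
  | zero => intro y ρ h; exact ⟨y, by simp, by simpa using h⟩
  | succ m ih =>
    intro y ρ h
    obtain ⟨y1, rfl⟩ := inert_dvd hp hq h7 (y := y)
      (by rw [h]; exact (dvd_pow_self p (by omega)).mul_right _)
    rw [map_mul, QuadraticAlgebra.norm_algebraMap, show 2 * (m + 1) = 2 + 2 * m by ring, pow_add,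
      mul_assoc] at h
    obtain ⟨y2, rfl, h2⟩ := ih y1 ρ (mul_left_cancel₀ (pow_ne_zero 2 hp.ne_zero) h)
    exact ⟨y2, by ring, h2⟩

/-- The prime r divides y times its conjugate, so r or its conjugate divides y. Factors are peeled
off one at a time; a counts those equal to r. -/
theorem split_pow_dvd {r : ZOmega} (hr : Prime r.norm) (e : ℕ) : ∀ (y : ZOmega) (ρ : ℤ√2),
    y.norm = r.norm ^ e * ρ →
      ∃ a ≤ e, ∃ y', y = r ^ a * star r ^ (e - a) * y' ∧ y'.norm = ρ := by
  induction e with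
  | zero => intro y ρ h; exact ⟨0, le_rfl, y, by simp, by simpa using h⟩
  | succ e ih =>
    intro y ρ h
    have hrp := prime_of_prime_norm hr
    have h1 : r ∣ y * star y := by
      rw [← algebraMap_norm_eq_mul_star, h, map_mul, map_pow, algebraMap_norm_eq_mul_star, pow_succ]
      exact ((dvd_mul_right r _).mul_left _).mul_right _
    have hcancel : ∀ y1 : ZOmega, r.norm * y1.norm = r.norm ^ (e + 1) * ρ →
        y1.norm = r.norm ^ e * ρ := by
      intro y1 h
      rw [pow_succ', mul_assoc] at h
      exact mul_left_cancel₀ hr.ne_zero h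
    rcases hrp.dvd_or_dvd h1 with ⟨y1, rfl⟩ | ⟨y1, hy1⟩
    · rw [map_mul] at h
      obtain ⟨a, ha, y2, rfl, h2⟩ := ih y1 ρ (hcancel _ h)
      refine ⟨a + 1, by omega, y2, ?_, h2⟩
      rw [show e + 1 - (a + 1) = e - a by omega]
      ring
    · have hy : y = star r * star y1 := by
        rw [← star_star y, hy1, StarMul.star_mul, mul_comm]
      rw [hy, map_mul, QuadraticAlgebra.norm_star r] at h
      obtain ⟨a, ha, y2, hy2, h2⟩ := ih (star y1) ρ (hcancel _ h)
      refine ⟨a, by omega, y2, ?_, h2⟩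
      rw [hy, hy2, show e + 1 - a = (e - a) + 1 by omega]
      ring

theorem exists_mem_solutions_prime {f : PrimePower} (hf : f.Valid)
    (hev : f.IsInert → Even f.exponent) {y : ZOmega} {ρ : ℤ√2}
    (h : y.norm = f.prime ^ f.exponent * ρ) :
    ∃ c ∈ f.solutions, ∃ y', toC y = c * toC y' ∧ y'.norm = ρ := by
  unfold PrimePower.solutions
  split_ifs with hin
  · rw [← Nat.two_mul_div_two_of_even (hev hin)] at h
    obtain ⟨y', rfl, hn⟩ := inert_pow_dvd hf.prime hin.1 hin.2 _ _ _ h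
    exact ⟨_, List.mem_singleton_self _, y', by rw [map_mul, map_pow, toC_C], hn⟩
  · obtain ⟨r, hr, hrn⟩ := hf.root hin
    rw [← hrn] at h
    obtain ⟨a, ha, y', rfl, hn⟩ := split_pow_dvd (by rw [hrn]; exact hf.prime) _ _ _ h
    refine ⟨_, List.mem_map.2 ⟨a, List.mem_range.2 (by omega), rfl⟩, y', ?_, hn⟩
    rw [map_mul, map_mul, map_pow, map_pow, ← conj_toC, hr]

theorem mem_productSolutions {L : List PrimePower} (hL : ∀ f ∈ L, f.Valid)
    (hev : ∀ f ∈ L, f.IsInert → Even f.exponent) {c : ℂ} (hc : c ∈ productSolutions L) :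
    ∃ w : ZOmega, toC w = c ∧ w.norm = primeProd L := by
  induction L generalizing c with
  | nil =>
    simp only [productSolutions, List.mem_singleton] at hc
    exact ⟨1, by simp [hc], by simp⟩
  | cons f L ih =>
    simp only [productSolutions, List.mem_flatMap, List.mem_map] at hc
    obtain ⟨z, hz, w, hw, rfl⟩ := hc
    obtain ⟨a, rfl, ha⟩ := mem_solutions_prime (hL f List.mem_cons_self)
      (hev f List.mem_cons_self) hz
    obtain ⟨b, rfl, hb⟩ := ih (fun g hg => hL g (List.mem_cons_of_mem _ hg))
      (fun g hg => hev g (List.mem_cons_of_mem _ hg)) hw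
    exact ⟨a * b, map_mul _ _ _, by rw [map_mul, ha, hb, primeProd_cons]⟩

theorem exists_mem_productSolutions {L : List PrimePower} (hL : ∀ f ∈ L, f.Valid)
    (hev : ∀ f ∈ L, f.IsInert → Even f.exponent) {y : ZOmega} {ρ : ℤ√2}
    (h : y.norm = primeProd L * ρ) :
    ∃ c ∈ productSolutions L, ∃ y', toC y = c * toC y' ∧ y'.norm = ρ := by
  induction L generalizing y with
  | nil => exact ⟨1, by simp [productSolutions], y, by simp, by simpa using h⟩
  | cons f L ih =>
    rw [primeProd_cons, mul_assoc] at h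
    obtain ⟨c, hc, y1, hy1, hn1⟩ := exists_mem_solutions_prime (hL f List.mem_cons_self)
      (hev f List.mem_cons_self) h
    obtain ⟨d, hd, y2, hy2, hn2⟩ := ih (fun g hg => hL g (List.mem_cons_of_mem _ hg))
      (fun g hg => hev g (List.mem_cons_of_mem _ hg)) hn1
    refine ⟨c * d, ?_, y2, by rw [hy1, hy2, mul_assoc], hn2⟩
    simp only [productSolutions, List.mem_flatMap, List.mem_map]
    exact ⟨c, hc, d, hd, rfl⟩

theorem productSolutions_ne_nil (L : List PrimePower) : productSolutions L ≠ [] := by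
  induction L with
  | nil => simp [productSolutions]
  | cons f L ih =>
    obtain ⟨d, hd⟩ := List.exists_mem_of_ne_nil _ ih
    obtain ⟨c, hc⟩ : ∃ c, c ∈ f.solutions := by
      unfold PrimePower.solutions
      split_ifs
      · exact ⟨_, List.mem_singleton_self _⟩
      · exact ⟨_, List.mem_map.2 ⟨0, by simp, rfl⟩⟩
    refine List.ne_nil_of_mem (a := c * d) ?_
    simp only [productSolutions, List.mem_flatMap, List.mem_map]
    exact ⟨c, hc, d, hd, rfl⟩

theorem toC_fundUnit_zpow (l : ℤ) :
    toC (algebraMap _ _ ((fundUnit ^ l : (ℤ√2)ˣ) : ℤ√2)) = (sqrtTwo - 1) ^ l := by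
  rw [toC_C, toReal_fundUnit_zpow, sqrtTwo]
  push_cast
  rfl

/-- For completeness, split the power of 1 - ω and then the prime power solutions off y. The rest
has norm (√2 - 1)^{2j}; division by (√2 - 1)^j leaves an element of norm 1, a power of ω. -/
theorem Factorization.mem_solutions_iff {F : Factorization} {ξ : ℤ√2} (hF : F.IsFor ξ)
    (hξ : TotPos ξ) (hev : ∀ f ∈ F.primes, f.IsInert → Even f.exponent) {c : ℂ} :
    c ∈ F.solutions ↔ ∃ y : ZOmega, toC y = c ∧ y.norm = ξ := by
  obtain ⟨j, hj⟩ := hF.even hξ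
  have hj2 : (F.unitExp - F.sqrtExp) / 2 = j := by omega
  have hu : F.unitExp = 2 * j + F.sqrtExp := by omega
  have hξeq := hF.eq_zsqrtd
  have hunit : ((fundUnit ^ F.unitExp : (ℤ√2)ˣ) : ℤ√2) =
      ((fundUnit ^ j : (ℤ√2)ˣ) : ℤ√2) ^ 2 * (fundUnit : ℤ√2) ^ F.sqrtExp := by
    rw [hu, zpow_add, mul_comm (2 : ℤ) j, zpow_mul, zpow_natCast, Units.val_mul,
      Units.val_pow_eq_pow_val]
    rfl
  simp only [Factorization.solutions, List.mem_flatMap, List.mem_map, List.mem_range, hj2]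
  constructor
  · rintro ⟨g, hg, z, hz, rfl⟩
    obtain ⟨w, rfl, hw⟩ := mem_productSolutions hF.valid hev hz
    refine ⟨algebraMap _ _ ((fundUnit ^ j : (ℤ√2)ˣ) : ℤ√2) * om ^ g * lam ^ F.sqrtExp * w, ?_, ?_⟩
    · rw [map_mul, map_mul, map_mul, map_pow, map_pow, toC_om, toC_lam, toC_fundUnit_zpow]
    · rw [map_mul, map_mul, map_mul, map_pow, map_pow, norm_om, norm_lam, hw,
        QuadraticAlgebra.norm_algebraMap]
      conv_rhs => rw [hξeq, hunit]
      ring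
  · rintro ⟨y, rfl, hy⟩
    obtain ⟨y1, rfl⟩ := lam_pow_dvd F.sqrtExp (z := y)
      (by rw [hy, hξeq]; exact (dvd_mul_left _ _).mul_right _)
    have hy1 : y1.norm = primeProd F.primes * ((fundUnit ^ j : (ℤ√2)ˣ) : ℤ√2) ^ 2 := by
      rw [map_mul, map_pow, norm_lam] at hy
      rw [hξeq, hunit] at hy
      have h0 : (root2 * (fundUnit : ℤ√2)) ^ F.sqrtExp ≠ 0 :=
        pow_ne_zero _ (mul_ne_zero root2_ne_zero fundUnit.ne_zero)
      apply mul_left_cancel₀ h0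
      rw [hy]
      ring
    obtain ⟨z, hz, y2, hy2, hn2⟩ := exists_mem_productSolutions hF.valid hev hy1
    set U : (ℤ√2)ˣ := fundUnit ^ j with hU
    have hy3 : (algebraMap (ℤ√2) ZOmega ((U⁻¹ : (ℤ√2)ˣ) : ℤ√2) * y2).norm = 1 := by
      rw [map_mul, QuadraticAlgebra.norm_algebraMap, hn2, ← mul_pow, Units.inv_mul, one_pow]
    obtain ⟨g, hg, hg2⟩ := eq_om_pow hy3
    have hy2' : y2 = algebraMap (ℤ√2) ZOmega (U : ℤ√2) * om ^ g := by
      rw [← hg2, ← mul_assoc, ← map_mul, Units.mul_inv, map_one, one_mul]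
    refine ⟨g, hg, z, hz, ?_⟩
    rw [map_mul, map_pow, toC_lam, hy2, hy2', map_mul, map_pow, toC_om, hU, toC_fundUnit_zpow]
    ring

theorem totPos_of_isSolvable {ξ : ℤ√2} (h0 : ξ ≠ 0) (h : IsSolvable ξ) : TotPos ξ :=
  ⟨lt_of_le_of_ne h.1 fun h1 => h0 (toReal_eq_zero.1 h1.symm),
    lt_of_le_of_ne h.2.1 fun h1 => h0 (star_eq_zero.1 (toReal_eq_zero.1 h1.symm))⟩

theorem factorize_isFor {ξ : ℤ√2} (h : TotPos ξ) : (factorize ξ).IsFor ξ :=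
  Classical.epsilon_spec (exists_isFor h)

theorem even_exponent {F : Factorization} {ξ : ℤ√2} (hF : F.IsFor ξ) (h : IsSolvable ξ) :
    ∀ f ∈ F.primes, f.IsInert → Even f.exponent := by
  intro f hf hin
  obtain ⟨r, hr⟩ := h.2.2 f.prime (hF.prime f hf) hin.1 hin.2
  rw [emultiplicity_prime hF hf] at hr
  have hrt : r ≠ ⊤ := by
    rintro rfl
    simp at hr
  lift r to ℕ using hrt
  exact ⟨r, by exact_mod_cast hr⟩

theorem mem_solutions_factorize {ξ : ℤ√2} (h0 : ξ ≠ 0) (h : IsSolvable ξ) {c : ℂ} :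
    c ∈ (factorize ξ).solutions ↔ ∃ y : ZOmega, toC y = c ∧ y.norm = ξ :=
  Factorization.mem_solutions_iff (factorize_isFor (totPos_of_isSolvable h0 h))
    (totPos_of_isSolvable h0 h) (even_exponent (factorize_isFor (totPos_of_isSolvable h0 h)) h)

/-- The assembled list is never empty, so IS-SOLVABLE is sufficient; necessity is `isSolvable_norm`.
-/
theorem exists_norm_eq {ξ : ℤ√2} (h0 : ξ ≠ 0) (h : IsSolvable ξ) :
    ∃ y : ZOmega, y.norm = ξ := by
  obtain ⟨z, hz⟩ := List.exists_mem_of_ne_nil _ (productSolutions_ne_nil (factorize ξ).primes)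
  have : (factorize ξ).solutions ≠ [] := by
    refine List.ne_nil_of_mem (List.mem_flatMap.2 ⟨0, by simp, List.mem_map.2 ⟨z, hz, rfl⟩⟩)
  obtain ⟨c, hc⟩ := List.exists_mem_of_ne_nil _ this
  obtain ⟨y, -, hy⟩ := (mem_solutions_factorize h0 h).1 hc
  exact ⟨y, hy⟩

end

/-! ### Unitaries as orthogonal 3×3 matrices and the √2-level of a circuit. -/

section

open Matrix

/-! ### The adjoint representation -/

/-- The Pauli matrices. -/
def pauli : Fin 3 → Mat := ![!![0, 1; 1, 0], !![0, -Complex.I; Complex.I, 0], !![1, 0; 0, -1]]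

/-- The action of `U` by conjugation on the span of the Pauli matrices. -/
def adj (U : Mat) : Matrix (Fin 3) (Fin 3) ℝ :=
  Matrix.of fun i j => (pauli i * U * pauli j * Uᴴ).trace.re / 2

abbrev IsUni (U : Mat) : Prop := U ∈ Matrix.unitaryGroup (Fin 2) ℂ

theorem IsUni.mul_conjTranspose {U : Mat} (h : IsUni U) : U * Uᴴ = 1 :=
  Matrix.mem_unitaryGroup_iff.1 h

theorem IsUni.conjTranspose_mul {U : Mat} (h : IsUni U) : Uᴴ * U = 1 :=
  Matrix.mem_unitaryGroup_iff'.1 h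

theorem IsUni.mul {U V : Mat} (hU : IsUni U) (hV : IsUni V) : IsUni (U * V) :=
  mul_mem hU hV

theorem IsUni.smul {U : Mat} {c : ℂ} (hc : ‖c‖ = 1) (hU : IsUni U) : IsUni (c • U) := by
  rw [IsUni, Matrix.mem_unitaryGroup_iff, star_smul, smul_mul_smul_comm,
    Matrix.mem_unitaryGroup_iff.1 hU]
  have : c * star c = 1 := by
    rw [Complex.star_def, Complex.mul_conj, Complex.normSq_eq_norm_sq, hc]; norm_num
  rw [this, one_smul]

theorem pauli_conjTranspose (j : Fin 3) : (pauli j)ᴴ = pauli j := by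
  fin_cases j <;> ext a b <;> fin_cases a <;> fin_cases b <;> simp [pauli]

theorem pauli_trace (j : Fin 3) : (pauli j).trace = 0 := by
  fin_cases j <;> simp [pauli, Matrix.trace_fin_two]

theorem pauli_expansion {A : Mat} (hA : Aᴴ = A) (htr : A.trace = 0) :
    A = ∑ l, (((pauli l * A).trace.re / 2 : ℝ) : ℂ) • pauli l := by
  have h00 := congrFun (congrFun hA 0) 0
  have h11 := congrFun (congrFun hA 1) 1
  have h01 := congrFun (congrFun hA 0) 1
  rw [Matrix.trace_fin_two] at htr
  simp only [Matrix.conjTranspose_apply, Complex.star_def] at h00 h11 h01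
  have e00 : (A 0 0).im = 0 := Complex.conj_eq_iff_im.1 h00
  have e11 : (A 1 1).im = 0 := Complex.conj_eq_iff_im.1 h11
  have hre := congrArg Complex.re htr
  simp only [Complex.add_re, Complex.zero_re] at hre
  have h01r := congrArg Complex.re h01
  have h01i := congrArg Complex.im h01
  simp only [Complex.conj_re, Complex.conj_im] at h01r h01i
  ext a b
  fin_cases a <;> fin_cases b <;> apply Complex.ext <;>
    simp [Fin.sum_univ_three, pauli, Matrix.trace_fin_two, Matrix.mul_apply, Fin.sum_univ_two] <;>
    linarith

/-- V σ_j V† is Hermitian and traceless, hence a real combination of Pauli matrices whose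
coefficients form column j of `adj V`. -/
theorem adj_mul (U : Mat) {V : Mat} (hV : IsUni V) : adj (U * V) = adj U * adj V := by
  ext i j
  set A : Mat := V * pauli j * Vᴴ with hAdef
  have hA : Aᴴ = A := by
    rw [hAdef]
    simp [Matrix.conjTranspose_mul, pauli_conjTranspose, Matrix.mul_assoc]
  have htr : A.trace = 0 := by
    rw [hAdef, Matrix.trace_mul_comm, ← Matrix.mul_assoc, hV.conjTranspose_mul, Matrix.one_mul,
      pauli_trace]
  have h1 : pauli i * (U * V) * pauli j * (U * V)ᴴ = pauli i * U * A * Uᴴ := by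
    rw [hAdef, Matrix.conjTranspose_mul]
    simp only [Matrix.mul_assoc]
  have h2 : ∀ l, (((pauli l * A).trace.re / 2 : ℝ) : ℂ) = ((adj V l j : ℝ) : ℂ) := by
    intro l
    rw [adj, hAdef, Matrix.of_apply, ← Matrix.mul_assoc, ← Matrix.mul_assoc]
  have h3 := pauli_expansion hA htr
  simp only [h2] at h3
  rw [Matrix.mul_apply]
  simp only [adj, Matrix.of_apply] at h3 ⊢
  rw [h1, h3]
  simp only [Matrix.mul_sum, Matrix.sum_mul, Matrix.trace_sum, Matrix.mul_smul, Matrix.smul_mul,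
    Matrix.trace_smul, Complex.re_sum, smul_eq_mul, Complex.re_ofReal_mul]
  rw [Finset.sum_div]
  refine Finset.sum_congr rfl fun l _ => ?_
  ring

theorem adj_smul {c : ℂ} (hc : ‖c‖ = 1) (U : Mat) : adj (c • U) = adj U := by
  ext i j
  simp only [adj, Matrix.of_apply, Matrix.conjTranspose_smul, Matrix.mul_smul, Matrix.smul_mul,
    smul_smul]
  have : star c * c = 1 := by
    rw [mul_comm, Complex.star_def, Complex.mul_conj, Complex.normSq_eq_norm_sq, hc]; norm_num
  rw [this, one_smul]

theorem adj_conjTranspose (U : Mat) : adj Uᴴ = (adj U)ᵀ := by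
  ext i j
  simp only [adj, Matrix.of_apply, Matrix.transpose_apply, Matrix.conjTranspose_conjTranspose]
  rw [Matrix.mul_assoc, Matrix.trace_mul_comm, ← Matrix.mul_assoc]

theorem adj_one : adj 1 = 1 := by
  ext i j
  fin_cases i <;> fin_cases j <;>
    simp [adj, pauli, Matrix.trace_fin_two, Matrix.mul_apply, Fin.sum_univ_two]

theorem IsUni.conjTranspose {U : Mat} (h : IsUni U) : IsUni Uᴴ :=
  Matrix.mem_unitaryGroup_iff.2 (by
    rw [Matrix.star_eq_conjTranspose, Matrix.conjTranspose_conjTranspose]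
    exact h.conjTranspose_mul)

theorem adj_mul_transpose {U : Mat} (h : IsUni U) : adj U * (adj U)ᵀ = 1 := by
  rw [← adj_conjTranspose, ← adj_mul _ h.conjTranspose, h.mul_conjTranspose, adj_one]

theorem adj_transpose_mul {U : Mat} (h : IsUni U) : (adj U)ᵀ * adj U = 1 := by
  rw [← adj_conjTranspose, ← adj_mul _ h, h.conjTranspose_mul, adj_one]

/-! ### Gates -/

theorem isUni_X : IsUni gateX := by
  rw [IsUni, Matrix.mem_unitaryGroup_iff]
  ext a b
  fin_cases a <;> fin_cases b <;> simp [gateX, Matrix.mul_apply, Fin.sum_univ_two, star_eq_conjTranspose]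

theorem isUni_Z : IsUni gateZ := by
  rw [IsUni, Matrix.mem_unitaryGroup_iff]
  ext a b
  fin_cases a <;> fin_cases b <;> simp [gateZ, Matrix.mul_apply, Fin.sum_univ_two, star_eq_conjTranspose]

theorem isUni_Y : IsUni gateY := (isUni_X.mul isUni_Z).smul (by simp)

theorem gateH_eq : gateH = !![sqrtTwo⁻¹, sqrtTwo⁻¹; sqrtTwo⁻¹, -sqrtTwo⁻¹] := by
  ext a b
  fin_cases a <;> fin_cases b <;> simp [gateH]

theorem sqrtTwo_inv_mul : sqrtTwo⁻¹ * sqrtTwo⁻¹ = 1 / 2 := by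
  rw [← mul_inv, ← sq, sqrtTwo_sq]; norm_num

theorem isUni_H : IsUni gateH := by
  rw [IsUni, Matrix.mem_unitaryGroup_iff, gateH_eq]
  have h := sqrtTwo_inv_mul
  have h' := conj_sqrtTwo
  ext a b
  fin_cases a <;> fin_cases b <;>
    simp [Matrix.mul_apply, Fin.sum_univ_two, star_eq_conjTranspose, h'] <;>
    linear_combination 2 * h

theorem isUni_T : IsUni gateT := by
  rw [IsUni, Matrix.mem_unitaryGroup_iff]
  have h := omega_mul_conj
  ext a b
  fin_cases a <;> fin_cases b <;>
    simp [gateT, Matrix.mul_apply, Fin.sum_univ_two, star_eq_conjTranspose, h]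

theorem gateP_eq : gateP = !![1, 0; 0, Complex.I] := by
  rw [gateP, sq, ← omega_sq]
  ext a b
  fin_cases a <;> fin_cases b <;> simp [gateT, Matrix.mul_apply, Fin.sum_univ_two, sq]

theorem isUni_P : IsUni gateP := by
  rw [gateP, sq]; exact isUni_T.mul isUni_T

theorem isUni_clifford {C : Mat} (h : C ∈ clifford) : IsUni C := by
  have : clifford ≤ (Matrix.unitaryGroup (Fin 2) ℂ) := by
    rw [clifford, Submonoid.closure_le]
    rintro x (rfl | rfl | rfl | rfl | rfl)
    exacts [isUni_X, isUni_Y, isUni_Z, isUni_H, isUni_P]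
  exact this h

theorem X_mem : gateX ∈ clifford := Submonoid.subset_closure (by simp)
theorem H_mem : gateH ∈ clifford := Submonoid.subset_closure (by simp)
theorem P_mem : gateP ∈ clifford := Submonoid.subset_closure (by simp)

theorem adj_X : adj gateX = !![1, 0, 0; 0, -1, 0; 0, 0, -1] := by
  ext i j
  fin_cases i <;> fin_cases j <;>
    simp [adj, pauli, gateX, Matrix.trace_fin_two, Matrix.mul_apply, Fin.sum_univ_two]

theorem adj_Z : adj gateZ = !![-1, 0, 0; 0, -1, 0; 0, 0, 1] := by
  ext i j
  fin_cases i <;> fin_cases j <;>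
    simp [adj, pauli, gateZ, Matrix.trace_fin_two, Matrix.mul_apply, Fin.sum_univ_two]

theorem adj_P : adj gateP = !![0, -1, 0; 1, 0, 0; 0, 0, 1] := by
  rw [gateP_eq]
  ext i j
  fin_cases i <;> fin_cases j <;>
    simp [adj, pauli, Matrix.trace_fin_two, Matrix.mul_apply, Fin.sum_univ_two]

theorem adj_H : adj gateH = !![0, 0, 1; 0, -1, 0; 1, 0, 0] := by
  have h : sqrtTwo⁻¹ = (((Real.sqrt 2)⁻¹ : ℝ) : ℂ) := by rw [sqrtTwo]; push_cast; rfl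
  have h2 : (Real.sqrt 2)⁻¹ * (Real.sqrt 2)⁻¹ = 1 / 2 := by
    rw [← mul_inv, Real.mul_self_sqrt (by norm_num)]; norm_num
  rw [gateH_eq, h]
  generalize (Real.sqrt 2)⁻¹ = s at h2
  ext i j
  fin_cases i <;> fin_cases j <;>
    simp [adj, pauli, Matrix.trace_fin_two, Matrix.mul_apply, Fin.sum_univ_two, -Complex.ofReal_inv] <;>
    linarith

theorem adj_T : adj gateT = !![Real.sqrt 2 / 2, -(Real.sqrt 2 / 2), 0;
    Real.sqrt 2 / 2, Real.sqrt 2 / 2, 0; 0, 0, 1] := by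
  have h : omega = ((Real.sqrt 2 / 2 : ℝ) : ℂ) + ((Real.sqrt 2 / 2 : ℝ) : ℂ) * Complex.I := by
    rw [omega_eq, sqrtTwo]; push_cast; ring
  have h2 : (Real.sqrt 2 / 2) * (Real.sqrt 2 / 2) = 1 / 2 := by
    nlinarith [Real.mul_self_sqrt (show (0 : ℝ) ≤ 2 by norm_num)]
  rw [gateT, h]
  generalize Real.sqrt 2 / 2 = s at h2
  ext i j
  fin_cases i <;> fin_cases j <;>
    simp [adj, pauli, Matrix.trace_fin_two, Matrix.mul_apply, Fin.sum_univ_two] <;>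
    linarith

/-! ### Denominator levels -/

/-- The entries of `√2^N • adj U` lie in `ℤ[√2]`. -/
def Lev (N : ℕ) (U : Mat) : Prop :=
  ∃ W : Matrix (Fin 3) (Fin 3) (ℤ√2), ∀ i j, Real.sqrt 2 ^ N * adj U i j = toReal (W i j)

theorem toReal_sum {ι : Type*} (s : Finset ι) (f : ι → ℤ√2) :
    toReal (∑ i ∈ s, f i) = ∑ i ∈ s, toReal (f i) := by
  simp only [toReal_eq, map_sum]

theorem Lev.mul {a b : ℕ} {U V : Mat} (hU : Lev a U) (hV : Lev b V) (h : IsUni V) :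
    Lev (a + b) (U * V) := by
  obtain ⟨A, hA⟩ := hU
  obtain ⟨B, hB⟩ := hV
  refine ⟨A * B, fun i j => ?_⟩
  rw [adj_mul U h, Matrix.mul_apply, Matrix.mul_apply, toReal_sum, Finset.mul_sum]
  refine Finset.sum_congr rfl fun k _ => ?_
  rw [toReal_mul, ← hA, ← hB]
  ring

theorem Lev.mono {a b : ℕ} {U : Mat} (hU : Lev a U) (h : a ≤ b) : Lev b U := by
  obtain ⟨A, hA⟩ := hU
  refine ⟨fun i j => root2 ^ (b - a) * A i j, fun i j => ?_⟩
  rw [toReal_mul, toReal_pow, toReal_root2, ← hA, ← mul_assoc, ← pow_add]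
  congr 2
  omega

theorem Lev.smul {a : ℕ} {U : Mat} {c : ℂ} (hc : ‖c‖ = 1) (hU : Lev a U) : Lev a (c • U) := by
  obtain ⟨A, hA⟩ := hU
  exact ⟨A, by rw [adj_smul hc]; exact hA⟩

theorem lev_one : Lev 0 1 :=
  ⟨1, fun i j => by
    rw [adj_one, pow_zero, one_mul, Matrix.one_apply, Matrix.one_apply]
    split_ifs <;> simp⟩

theorem lev_X : Lev 0 gateX :=
  ⟨!![1, 0, 0; 0, -1, 0; 0, 0, -1], fun i j => by
    rw [adj_X]; fin_cases i <;> fin_cases j <;> simp⟩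

theorem lev_Z : Lev 0 gateZ :=
  ⟨!![-1, 0, 0; 0, -1, 0; 0, 0, 1], fun i j => by
    rw [adj_Z]; fin_cases i <;> fin_cases j <;> simp⟩

theorem lev_P : Lev 0 gateP :=
  ⟨!![0, -1, 0; 1, 0, 0; 0, 0, 1], fun i j => by
    rw [adj_P]; fin_cases i <;> fin_cases j <;> simp⟩

theorem lev_H : Lev 0 gateH :=
  ⟨!![0, 0, 1; 0, -1, 0; 1, 0, 0], fun i j => by
    rw [adj_H]; fin_cases i <;> fin_cases j <;> simp⟩

theorem lev_Y : Lev 0 gateY := (lev_X.mul lev_Z isUni_Z).smul (by simp)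

theorem lev_T : Lev 1 gateT :=
  ⟨!![1, -1, 0; 1, 1, 0; 0, 0, root2], fun i j => by
    have h := Real.mul_self_sqrt (show (0 : ℝ) ≤ 2 by norm_num)
    rw [adj_T]; fin_cases i <;> fin_cases j <;> simp <;> linarith⟩

theorem lev_clifford {C : Mat} (h : C ∈ clifford) : Lev 0 C := by
  induction h using Submonoid.closure_induction with
  | mem x hx =>
    rcases hx with rfl | rfl | rfl | rfl | rfl
    exacts [lev_X, lev_Y, lev_Z, lev_H, lev_P]
  | one => exact lev_one
  | mul x y hx hy h1 h2 => exact h1.mul h2 (isUni_clifford hy)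

theorem circuits_spec (n : ℕ) : ∀ V ∈ circuits n, IsUni V ∧ Lev n V := by
  induction n with
  | zero => exact fun V hV => ⟨isUni_clifford hV, lev_clifford hV⟩
  | succ n ih =>
    rintro _ ⟨V, hV, C, hC, rfl⟩
    obtain ⟨h1, h2⟩ := ih V hV
    have hC' := isUni_clifford hC
    exact ⟨(h1.mul isUni_T).mul hC', (h2.mul lev_T isUni_T).mul (lev_clifford hC) hC'⟩

theorem ImplementableWith.lev {n : ℕ} {U : Mat} (h : ImplementableWith n U) : Lev n U := by
  obtain ⟨c, hc, V, hV, rfl⟩ := h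
  exact (circuits_spec n V hV).2.smul hc

theorem circuits_clifford_mul {n : ℕ} {V C : Mat} (hC : C ∈ clifford) (hV : V ∈ circuits n) :
    C * V ∈ circuits n := by
  induction n generalizing V with
  | zero => exact mul_mem hC hV
  | succ n ih =>
    obtain ⟨V, hV, D, hD, rfl⟩ := hV
    exact ⟨C * V, ih hV, D, hD, by simp only [Matrix.mul_assoc]⟩

theorem circuits_T_mul {n : ℕ} {V : Mat} (hV : V ∈ circuits n) : gateT * V ∈ circuits (n + 1) := by
  induction n generalizing V with
  | zero => exact ⟨1, one_mem clifford, V, hV, by simp⟩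
  | succ n ih =>
    obtain ⟨V, hV, D, hD, rfl⟩ := hV
    exact ⟨gateT * V, ih hV, D, hD, by simp only [Matrix.mul_assoc]⟩

theorem ImplementableWith.clifford_mul {n : ℕ} {U C : Mat} (hC : C ∈ clifford)
    (h : ImplementableWith n U) : ImplementableWith n (C * U) := by
  obtain ⟨c, hc, V, hV, rfl⟩ := h
  exact ⟨c, hc, _, circuits_clifford_mul hC hV, by rw [Matrix.mul_smul]⟩

theorem ImplementableWith.T_mul {n : ℕ} {U : Mat}
    (h : ImplementableWith n U) : ImplementableWith (n + 1) (gateT * U) := by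
  obtain ⟨c, hc, V, hV, rfl⟩ := h
  exact ⟨c, hc, _, circuits_T_mul hV, by rw [Matrix.mul_smul]⟩

end

/-! ### Exact synthesis: the T-count equals the least level. -/

section

open Matrix

/-! ### Residues modulo `√2` -/

/-- Reduction modulo `√2`. -/
def red : ℤ√2 →+* ZMod 2 := Zsqrtd.lift ⟨0, by decide⟩

theorem red_apply (z : ℤ√2) : red z = (z.re : ZMod 2) := by
  simp [red, Zsqrtd.lift]

theorem red_eq_zero {z : ℤ√2} : red z = 0 ↔ root2 ∣ z := by
  rw [red_apply, root2_dvd_iff, ZMod.intCast_zmod_eq_zero_iff_dvd]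
  rfl

/-- Two distinct nonzero even-weight vectors in 𝔽₂³ have inner product 1, so the nonzero rows all
coincide, and even column sums allow only zero or two of them. If the corner i vanishes, either the
last row is zero or the common row ends in 0 and the last column is zero. -/
theorem residue_row {a b c d e f g h i : ZMod 2}
    (h1 : a + b + c = 0) (h2 : d + e + f = 0) (h3 : g + h + i = 0) (h4 : a + d + g = 0)
    (h5 : b + e + h = 0) (h6 : a * d + b * e + c * f = 0) (h7 : a * g + b * h + c * i = 0)
    (h8 : d * g + e * h + f * i = 0) :
    ((a = 0 ∧ b = 0 ∧ c = 0) ∨ (d = 0 ∧ e = 0 ∧ f = 0) ∨ (g = 0 ∧ h = 0 ∧ i = 0)) ∧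
    (i = 0 → (g = 0 ∧ h = 0) ∨ (c = 0 ∧ f = 0)) := by
  obtain rfl := eq_neg_of_add_eq_zero_right h1
  obtain rfl := eq_neg_of_add_eq_zero_right h2
  obtain rfl := eq_neg_of_add_eq_zero_right h4
  obtain rfl := eq_neg_of_add_eq_zero_right h5
  obtain rfl := eq_neg_of_add_eq_zero_right h3
  revert a b d e
  decide

/-- Scaled orthogonality relations of the rows and columns of `W`. -/
structure ScaledOrtho (N : ℕ) (W : Matrix (Fin 3) (Fin 3) (ℤ√2)) : Prop where
  row : W * Wᵀ = (2 ^ N : ℤ√2) • (1 : Matrix (Fin 3) (Fin 3) (ℤ√2))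
  col : Wᵀ * W = (2 ^ N : ℤ√2) • (1 : Matrix (Fin 3) (Fin 3) (ℤ√2))

theorem scaledOrtho_of_adj {N : ℕ} {U : Mat} (hU : IsUni U) {W : Matrix (Fin 3) (Fin 3) (ℤ√2)}
    (hW : ∀ i j, Real.sqrt 2 ^ N * adj U i j = toReal (W i j)) : ScaledOrtho N W := by
  have h2 : Real.sqrt 2 ^ N * Real.sqrt 2 ^ N = 2 ^ N := by
    rw [← mul_pow, Real.mul_self_sqrt (by norm_num)]
  constructor
  · ext1 i j
    apply toReal_injective
    have h := congrFun (congrFun (adj_mul_transpose hU) i) j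
    rw [Matrix.mul_apply] at h
    rw [Matrix.mul_apply, toReal_sum, Matrix.smul_apply, smul_eq_mul, toReal_mul, toReal_pow,
      toReal_two]
    have e : toReal ((1 : Matrix (Fin 3) (Fin 3) (ℤ√2)) i j) =
        (1 : Matrix (Fin 3) (Fin 3) ℝ) i j := by
      rw [Matrix.one_apply, Matrix.one_apply]; split_ifs <;> simp
    rw [e, ← h, Finset.mul_sum]
    refine Finset.sum_congr rfl fun k _ => ?_
    rw [toReal_mul, Matrix.transpose_apply, Matrix.transpose_apply, ← hW, ← hW]
    linear_combination (adj U i k * adj U j k) * h2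
  · ext1 i j
    apply toReal_injective
    have h := congrFun (congrFun (adj_transpose_mul hU) i) j
    rw [Matrix.mul_apply] at h
    rw [Matrix.mul_apply, toReal_sum, Matrix.smul_apply, smul_eq_mul, toReal_mul, toReal_pow,
      toReal_two]
    have e : toReal ((1 : Matrix (Fin 3) (Fin 3) (ℤ√2)) i j) =
        (1 : Matrix (Fin 3) (Fin 3) ℝ) i j := by
      rw [Matrix.one_apply, Matrix.one_apply]; split_ifs <;> simp
    rw [e, ← h, Finset.mul_sum]
    refine Finset.sum_congr rfl fun k _ => ?_
    rw [toReal_mul, Matrix.transpose_apply, Matrix.transpose_apply, ← hW, ← hW]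
    linear_combination (adj U k i * adj U k j) * h2

theorem ScaledOrtho.row_eq {N : ℕ} {W : Matrix (Fin 3) (Fin 3) (ℤ√2)} (h : ScaledOrtho N W)
    (i j : Fin 3) : W i 0 * W j 0 + W i 1 * W j 1 + W i 2 * W j 2 =
      if i = j then 2 ^ N else 0 := by
  have := congrFun (congrFun h.row i) j
  rw [Matrix.mul_apply, Fin.sum_univ_three, Matrix.smul_apply, Matrix.one_apply] at this
  simp only [Matrix.transpose_apply] at this
  rw [this]
  split_ifs <;> simp

theorem ScaledOrtho.col_eq {N : ℕ} {W : Matrix (Fin 3) (Fin 3) (ℤ√2)} (h : ScaledOrtho N W)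
    (i j : Fin 3) : W 0 i * W 0 j + W 1 i * W 1 j + W 2 i * W 2 j =
      if i = j then 2 ^ N else 0 := by
  have := congrFun (congrFun h.col i) j
  rw [Matrix.mul_apply, Fin.sum_univ_three, Matrix.smul_apply, Matrix.one_apply] at this
  simp only [Matrix.transpose_apply] at this
  rw [this]
  split_ifs <;> simp

theorem ScaledOrtho.residue {N : ℕ} {W : Matrix (Fin 3) (Fin 3) (ℤ√2)}
    (h : ScaledOrtho (N + 1) W) :
    (∃ i, ∀ k, root2 ∣ W i k) ∧
      (root2 ∣ W 2 2 → (∀ k, root2 ∣ W 2 k) ∨ ∀ k, root2 ∣ W k 2) := by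
  have hsq : ∀ x : ZMod 2, x * x = x := by decide
  have h2 : red (2 ^ (N + 1)) = 0 := by
    rw [map_pow, map_ofNat]
    exact zero_pow (Nat.succ_ne_zero N)
  have hrow : ∀ i j, red (W i 0) * red (W j 0) + red (W i 1) * red (W j 1) +
      red (W i 2) * red (W j 2) = 0 := by
    intro i j
    have := congrArg red (h.row_eq i j)
    rw [map_add, map_add, map_mul, map_mul, map_mul] at this
    rw [this]
    split_ifs
    · exact h2
    · exact map_zero _
  have hcol : ∀ i j, red (W 0 i) * red (W 0 j) + red (W 1 i) * red (W 1 j) +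
      red (W 2 i) * red (W 2 j) = 0 := by
    intro i j
    have := congrArg red (h.col_eq i j)
    rw [map_add, map_add, map_mul, map_mul, map_mul] at this
    rw [this]
    split_ifs
    · exact h2
    · exact map_zero _
  have hrow' : ∀ i, red (W i 0) + red (W i 1) + red (W i 2) = 0 := by
    intro i; simpa only [hsq] using hrow i i
  have hcol' : ∀ i, red (W 0 i) + red (W 1 i) + red (W 2 i) = 0 := by
    intro i; simpa only [hsq] using hcol i i
  obtain ⟨h3, h4⟩ := residue_row (hrow' 0) (hrow' 1) (hrow' 2) (hcol' 0)
    (hcol' 1) (hrow 0 1) (hrow 0 2) (hrow 1 2)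
  simp only [red_eq_zero] at h3 h4
  refine ⟨?_, fun h22 => ?_⟩
  · rcases h3 with ⟨a, b, c⟩ | ⟨a, b, c⟩ | ⟨a, b, c⟩
    · exact ⟨0, Fin.forall_fin_succ.2 ⟨a, Fin.forall_fin_two.2 ⟨b, c⟩⟩⟩
    · exact ⟨1, Fin.forall_fin_succ.2 ⟨a, Fin.forall_fin_two.2 ⟨b, c⟩⟩⟩
    · exact ⟨2, Fin.forall_fin_succ.2 ⟨a, Fin.forall_fin_two.2 ⟨b, c⟩⟩⟩
  · rcases h4 h22 with ⟨a, b⟩ | ⟨a, b⟩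
    · exact Or.inl (Fin.forall_fin_succ.2 ⟨a, Fin.forall_fin_two.2 ⟨b, h22⟩⟩)
    · exact Or.inr (Fin.forall_fin_succ.2 ⟨a, Fin.forall_fin_two.2 ⟨b, h22⟩⟩)

/-- Rational parts modulo 2 give x.re ≡ y.re; irrational parts make x.re · x.im + y.re · y.im even,
which compares x.im and y.im when the re-coordinates are odd. -/
theorem column_parity {x y z : ℤ√2} {M : ℤ} (h : x * x + y * y + z * z = (2 * M : ℤ))
    (hz : root2 ∣ z) :
    (2 ∣ x.re - y.re) ∧ (¬ 2 ∣ x.re → 2 ∣ x.im - y.im) := by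
  have h1 := congrArg Zsqrtd.re h
  have h2 := congrArg Zsqrtd.im h
  simp only [Zsqrtd.re_add, Zsqrtd.im_add, Zsqrtd.re_mul, Zsqrtd.im_mul, Zsqrtd.re_intCast,
    Zsqrtd.im_intCast] at h1 h2
  have h3 : x.re * x.im + y.re * y.im + z.re * z.im = 0 := by linarith
  have h4 : Even (x.re * x.re + y.re * y.re + z.re * z.re) :=
    ⟨M - x.im * x.im - y.im * y.im - z.im * z.im, by linarith⟩
  have h5 : Even (x.re * x.im + y.re * y.im + z.re * z.im) := by rw [h3]; exact Even.zero
  rw [root2_dvd_iff] at hz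
  simp only [← even_iff_two_dvd] at hz ⊢
  simp only [Int.even_add, Int.even_mul, Int.even_sub] at h4 h5 ⊢
  tauto

/-- The rational parts read Σ re² + 2 Σ im² = 2M for both rows. Congruent integers mod 2 have equal
squares mod 4, so Σ im² has the same parity in both rows. -/
theorem row_parity {x y : Fin 3 → ℤ√2} {M : ℤ}
    (hx : x 0 * x 0 + x 1 * x 1 + x 2 * x 2 = (2 * M : ℤ))
    (hy : y 0 * y 0 + y 1 * y 1 + y 2 * y 2 = (2 * M : ℤ))
    (hxy : ∀ k, 2 ∣ (x k).re - (y k).re) :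
    2 ∣ (x 0).re + (x 1).re + (x 2).re ∧
      2 ∣ ((x 0).im - (y 0).im) + ((x 1).im - (y 1).im) + ((x 2).im - (y 2).im) := by
  have h1 := congrArg Zsqrtd.re hx
  have h2 := congrArg Zsqrtd.re hy
  simp only [Zsqrtd.re_add, Zsqrtd.re_mul, Zsqrtd.re_intCast] at h1 h2
  have sq : ∀ z : ℤ, ∃ w, z * z = z + 2 * w := by
    intro z
    obtain ⟨w, hw⟩ := Int.even_mul_pred_self z
    exact ⟨w, by linarith⟩
  obtain ⟨a0, ha0⟩ := sq (x 0).im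
  obtain ⟨a1, ha1⟩ := sq (x 1).im
  obtain ⟨a2, ha2⟩ := sq (x 2).im
  constructor
  · obtain ⟨b0, hb0⟩ := sq (x 0).re
    obtain ⟨b1, hb1⟩ := sq (x 1).re
    obtain ⟨b2, hb2⟩ := sq (x 2).re
    refine ⟨M - b0 - b1 - b2 - ((x 0).im * (x 0).im + (x 1).im * (x 1).im + (x 2).im * (x 2).im),
      ?_⟩
    linarith
  · obtain ⟨b0, hb0⟩ := sq (y 0).im
    obtain ⟨b1, hb1⟩ := sq (y 1).im
    obtain ⟨b2, hb2⟩ := sq (y 2).im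
    obtain ⟨s, hs⟩ := hxy 0
    obtain ⟨t, ht⟩ := hxy 1
    obtain ⟨u, hu⟩ := hxy 2
    have e0 : (x 0).re = (y 0).re + 2 * s := by omega
    have e1 : (x 1).re = (y 1).re + 2 * t := by omega
    have e2 : (x 2).re = (y 2).re + 2 * u := by omega
    rw [e0, e1, e2] at h1
    refine ⟨-(s * ((y 0).re + s) + t * ((y 1).re + t) + u * ((y 2).re + u)) -
      (a0 + a1 + a2 - b0 - b1 - b2), ?_⟩
    linarith

/-- If not everything is divisible by √2, exactly two entries of row 0 have odd rational part.
`column_parity` settles those columns, and the parity sum of `row_parity` settles the third. -/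
theorem ScaledOrtho.row_congr {N : ℕ} {W : Matrix (Fin 3) (Fin 3) (ℤ√2)}
    (h : ScaledOrtho (N + 1) W) (hz : ∀ k, root2 ∣ W 2 k) :
    (∀ i k, root2 ∣ W i k) ∨ ∀ k, 2 ∣ W 0 k - W 1 k := by
  have e : (2 ^ (N + 1) : ℤ√2) = ((2 * 2 ^ N : ℤ) : ℤ√2) := by push_cast; ring
  have hcol : ∀ k, (2 ∣ (W 0 k).re - (W 1 k).re) ∧
      (¬ 2 ∣ (W 0 k).re → 2 ∣ (W 0 k).im - (W 1 k).im) := by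
    intro k
    refine column_parity (M := 2 ^ N) ?_ (hz k)
    have := h.col_eq k k
    rw [if_pos rfl, e] at this
    exact this
  have hr0 := h.row_eq 0 0
  have hr1 := h.row_eq 1 1
  rw [if_pos rfl, e] at hr0 hr1
  obtain ⟨h1, h2⟩ := row_parity (x := W 0) (y := W 1) hr0 hr1 fun k => (hcol k).1
  obtain ⟨a0, b0⟩ := hcol 0
  obtain ⟨a1, b1⟩ := hcol 1
  obtain ⟨a2, b2⟩ := hcol 2
  by_cases hall : 2 ∣ (W 0 0).re ∧ 2 ∣ (W 0 1).re ∧ 2 ∣ (W 0 2).re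
  · left
    obtain ⟨c0, c1, c2⟩ := hall
    have hW0 : ∀ k, root2 ∣ W 0 k := by
      intro k
      rw [root2_dvd_iff]
      fin_cases k <;> assumption
    have hW1 : ∀ k, root2 ∣ W 1 k := by
      intro k
      have h3 := (hcol k).1
      have h4 := root2_dvd_iff.1 (hW0 k)
      rw [root2_dvd_iff]
      omega
    intro i
    fin_cases i
    exacts [hW0, hW1, hz]
  · right
    intro k
    rw [two_dvd_iff, Zsqrtd.re_sub, Zsqrtd.im_sub]
    refine ⟨(hcol k).1, ?_⟩
    generalize (W 0 0).re = p0 at *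
    generalize (W 0 1).re = p1 at *
    generalize (W 0 2).re = p2 at *
    have key : 2 ∣ (W 0 0).im - (W 1 0).im ∧ 2 ∣ (W 0 1).im - (W 1 1).im ∧
        2 ∣ (W 0 2).im - (W 1 2).im := by
      by_cases c0 : (2 : ℤ) ∣ p0
      · have c1 : ¬ (2 : ℤ) ∣ p1 := by omega
        have c2 : ¬ (2 : ℤ) ∣ p2 := by omega
        have := b1 c1
        have := b2 c2
        omega
      · have := b0 c0
        by_cases c1 : (2 : ℤ) ∣ p1
        · have c2 : ¬ (2 : ℤ) ∣ p2 := by omega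
          have := b2 c2
          omega
        · have := b1 c1
          omega
    fin_cases k
    exacts [key.1, key.2.1, key.2.2]

theorem adj_T_mul (U : Mat) (hU : IsUni U) (k : Fin 3) :
    adj (gateT * U) 0 k = Real.sqrt 2 / 2 * (adj U 0 k - adj U 1 k) ∧
    adj (gateT * U) 1 k = Real.sqrt 2 / 2 * (adj U 0 k + adj U 1 k) ∧
    adj (gateT * U) 2 k = adj U 2 k := by
  rw [adj_mul _ hU, adj_T]
  refine ⟨?_, ?_, ?_⟩ <;> simp [Matrix.mul_apply, Fin.sum_univ_three] <;> ring

theorem lev_of_root2_dvd {N : ℕ} {U : Mat} {W : Matrix (Fin 3) (Fin 3) (ℤ√2)}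
    (hW : ∀ i j, Real.sqrt 2 ^ (N + 1) * adj U i j = toReal (W i j))
    (h : ∀ i k, root2 ∣ W i k) : Lev N U := by
  choose V hV using h
  refine ⟨V, fun i j => ?_⟩
  have h0 : Real.sqrt 2 ≠ 0 := by positivity
  apply mul_left_cancel₀ h0
  rw [← mul_assoc, ← pow_succ', hW, hV, toReal_mul, toReal_root2]

/-- T replaces rows 0 and 1 by (W₀ ∓ W₁)/√2, so their congruence modulo 2 gains a factor √2; the
unchanged row 2 has one by hypothesis. -/
theorem lev_or_lev_T_mul {N : ℕ} {U : Mat} (hU : IsUni U) {W : Matrix (Fin 3) (Fin 3) (ℤ√2)}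
    (hW : ∀ i j, Real.sqrt 2 ^ (N + 1) * adj U i j = toReal (W i j))
    (hz : ∀ k, root2 ∣ W 2 k) : Lev N U ∨ Lev N (gateT * U) := by
  rcases (scaledOrtho_of_adj hU hW).row_congr hz with h | h
  · exact Or.inl (lev_of_root2_dvd hW h)
  · right
    choose V hV using hz
    choose D hD using h
    have h0 : Real.sqrt 2 ≠ 0 := by positivity
    -- With W₀ - W₁ = 2D the new rows are D and (W₀ + W₁)/2 = D + W₁; V is row 2 divided by √2.
    refine ⟨![D, fun k => D k + W 1 k, V], fun i k => ?_⟩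
    obtain ⟨t0, t1, t2⟩ := adj_T_mul U hU k
    have e := congrArg toReal (hD k)
    have hv := congrArg toReal (hV k)
    rw [toReal_sub, toReal_mul, toReal_two, ← hW, ← hW, pow_succ] at e
    rw [toReal_mul, toReal_root2, ← hW, pow_succ] at hv
    have h1 := hW 1 k
    rw [pow_succ] at h1
    fin_cases i
    · show Real.sqrt 2 ^ N * adj (gateT * U) 0 k = toReal (D k)
      rw [t0]
      linarith
    · show Real.sqrt 2 ^ N * adj (gateT * U) 1 k = toReal (D k + W 1 k)
      rw [t1, toReal_add]
      linarith
    · show Real.sqrt 2 ^ N * adj (gateT * U) 2 k = toReal (V k)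
      rw [t2]
      apply mul_left_cancel₀ h0
      linarith

/-! ### Synthesis -/

theorem gateH_mul_self : gateH * gateH = 1 := by
  rw [gateH_eq]
  have h := sqrtTwo_inv_mul
  ext a b
  fin_cases a <;> fin_cases b <;>
    simp [Matrix.mul_apply, Fin.sum_univ_two] <;>
    linear_combination 2 * h

theorem gateX_mul_self : gateX * gateX = 1 := by
  ext a b
  fin_cases a <;> fin_cases b <;> simp [gateX, Matrix.mul_apply, Fin.sum_univ_two]

theorem gateP_pow (j : ℕ) : gateP ^ j = !![1, 0; 0, Complex.I ^ j] := by
  induction j with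
  | zero => ext a b; fin_cases a <;> fin_cases b <;> simp
  | succ j ih =>
    rw [pow_succ, ih, gateP_eq]
    ext a b
    fin_cases a <;> fin_cases b <;> simp [Matrix.mul_apply, Fin.sum_univ_two, pow_succ]

theorem gateP_pow_four : gateP ^ 4 = 1 := by
  rw [gateP_pow, Complex.I_pow_four]
  ext a b
  fin_cases a <;> fin_cases b <;> simp

theorem gateT_mul_gateP_pow : gateT * gateP ^ 3 * gateT = 1 := by
  have : gateT * gateP ^ 3 * gateT = gateP ^ 4 := by
    rw [gateP, ← pow_mul, ← pow_mul, ← pow_succ', ← pow_succ]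
  rw [this, gateP_pow_four]

/-- H exchanges the x and z axes and HP takes y to z; the sign s does not affect divisibility. -/
theorem exists_clifford_axis (l : Fin 3) : ∃ C ∈ clifford, ∃ C' ∈ clifford, C' * C = 1 ∧
    ∃ s : ℤ√2, s * s = 1 ∧ ∀ U : Mat, IsUni U → ∀ k, adj (C * U) 2 k = toReal s * adj U l k := by
  fin_cases l
  · refine ⟨gateH, H_mem, gateH, H_mem, gateH_mul_self, 1, by simp, fun U hU k => ?_⟩
    rw [adj_mul _ hU, adj_H]
    simp [Matrix.mul_apply, Fin.sum_univ_three]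
  · refine ⟨gateH * gateP, mul_mem H_mem P_mem, gateP ^ 3 * gateH,
      mul_mem (pow_mem P_mem 3) H_mem, ?_, -1, by simp, fun U hU k => ?_⟩
    · rw [Matrix.mul_assoc, ← Matrix.mul_assoc gateH, gateH_mul_self, Matrix.one_mul, ← pow_succ,
        gateP_pow_four]
    · rw [adj_mul _ hU, adj_mul _ isUni_P, adj_H, adj_P]
      simp [Matrix.mul_apply, Fin.sum_univ_three]
  · exact ⟨1, one_mem _, 1, one_mem _, by simp, 1, by simp, fun U hU k => by simp⟩

/-- The rational part of the sum is a positive definite form in six integers, in which the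
irrational coordinates have weight 2 and so must vanish. -/
theorem sq_sum_eq_one {x y z : ℤ√2} (h : x * x + y * y + z * z = 1) :
    ((x = 1 ∨ x = -1) ∧ y = 0 ∧ z = 0) ∨ ((y = 1 ∨ y = -1) ∧ x = 0 ∧ z = 0) ∨
      ((z = 1 ∨ z = -1) ∧ x = 0 ∧ y = 0) := by
  have h1 := congrArg Zsqrtd.re h
  simp only [Zsqrtd.re_add, Zsqrtd.re_mul, Zsqrtd.re_one] at h1
  obtain ⟨x, p⟩ := x
  obtain ⟨y, q⟩ := y
  obtain ⟨z, r⟩ := z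
  simp only at h1
  have h2 := mul_self_nonneg x
  have h3 := mul_self_nonneg y
  have h4 := mul_self_nonneg z
  have zero : ∀ w : ℤ, 2 * (w * w) ≤ 1 → w = 0 := by
    intro w hw
    by_contra h0
    have := mul_self_pos.2 h0
    omega
  have h5 := mul_self_nonneg p
  have h6 := mul_self_nonneg q
  have h7 := mul_self_nonneg r
  obtain rfl := zero p (by linarith)
  obtain rfl := zero q (by linarith)
  obtain rfl := zero r (by linarith)
  have bd : ∀ w : ℤ, w * w ≤ 1 → w = 0 ∨ w = 1 ∨ w = -1 := by
    intro w hw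
    have h1 : w ≤ 1 := by nlinarith
    have h2 : -1 ≤ w := by nlinarith
    omega
  simp only [Zsqrtd.ext_iff, Zsqrtd.re_one, Zsqrtd.im_one, Zsqrtd.re_neg, Zsqrtd.im_neg,
    Zsqrtd.re_zero, Zsqrtd.im_zero]
  rcases bd x (by nlinarith [mul_self_nonneg y, mul_self_nonneg z]) with rfl | rfl | rfl <;>
  rcases bd y (by nlinarith [mul_self_nonneg z]) with rfl | rfl | rfl <;>
  rcases bd z (by nlinarith) with rfl | rfl | rfl <;> simp at h1 ⊢

theorem adj_entry_two_two (U : Mat) : adj U 2 2 =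
    (Complex.normSq (U 0 0) - Complex.normSq (U 0 1) - Complex.normSq (U 1 0) +
      Complex.normSq (U 1 1)) / 2 := by
  simp [adj, pauli, Matrix.trace_fin_two, Matrix.mul_apply, Fin.sum_univ_two,
    Complex.normSq_apply]
  ring

theorem normSq_rows {U : Mat} (hU : IsUni U) :
    Complex.normSq (U 0 0) + Complex.normSq (U 0 1) = 1 ∧
    Complex.normSq (U 1 0) + Complex.normSq (U 1 1) = 1 := by
  have h := hU.mul_conjTranspose
  have h0 := congrArg Complex.re (congrFun (congrFun h 0) 0)
  have h1 := congrArg Complex.re (congrFun (congrFun h 1) 1)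
  simp [Matrix.mul_apply, Fin.sum_univ_two] at h0 h1
  simp only [Complex.normSq_apply]
  constructor <;> linarith

/-- Fixing the z axis makes U diagonal, diag(1, t) up to phase. The first column of `adj U` is (Re
t, Im t, 0), a unit vector over ℤ[√2] and hence a signed basis vector, so t is a power of i. -/
theorem diagonal_of_adj {U : Mat} (hU : IsUni U) (h22 : adj U 2 2 = 1) (hL : Lev 0 U) :
    ImplementableWith 0 U := by
  obtain ⟨h0, h1⟩ := normSq_rows hU
  rw [adj_entry_two_two] at h22
  have hb : Complex.normSq (U 0 1) = 0 := by
    nlinarith [Complex.normSq_nonneg (U 0 1), Complex.normSq_nonneg (U 1 0)]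
  have hc : Complex.normSq (U 1 0) = 0 := by
    nlinarith [Complex.normSq_nonneg (U 0 1), Complex.normSq_nonneg (U 1 0)]
  rw [hb, add_zero] at h0
  rw [hc, zero_add] at h1
  rw [Complex.normSq_eq_zero] at hb hc
  set t := U 1 1 * starRingEnd ℂ (U 0 0) with ht
  have hU' : U = U 0 0 • !![1, 0; 0, t] := by
    ext a b
    fin_cases a <;> fin_cases b
    · simp
    · simp [hb]
    · simp [hc]
    · simp [ht]
      rw [mul_left_comm, Complex.mul_conj, h0]
      simp
  have hnorm : ‖U 0 0‖ = 1 := by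
    rw [Complex.normSq_eq_norm_sq] at h0
    nlinarith [norm_nonneg (U 0 0)]
  obtain ⟨W, hW⟩ := hL
  have hO := scaledOrtho_of_adj hU hW
  have hadj : adj U = adj !![1, 0; 0, t] := by rw [hU', adj_smul hnorm]
  have e0 : toReal (W 0 0) = t.re := by
    rw [← hW, pow_zero, one_mul, hadj]
    simp [adj, pauli, Matrix.trace_fin_two, Matrix.mul_apply, Fin.sum_univ_two]
  have e1 : toReal (W 1 0) = t.im := by
    rw [← hW, pow_zero, one_mul, hadj]
    simp [adj, pauli, Matrix.trace_fin_two, Matrix.mul_apply, Fin.sum_univ_two]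
  have e2 : toReal (W 2 0) = 0 := by
    rw [← hW, pow_zero, one_mul, hadj]
    simp [adj, pauli, Matrix.trace_fin_two, Matrix.mul_apply, Fin.sum_univ_two]
  have hcol := hO.col_eq 0 0
  rw [if_pos rfl, pow_zero] at hcol
  have e2' : W 2 0 = 0 := toReal_eq_zero.1 e2
  have ht4 : ∃ j : ℕ, t = Complex.I ^ j := by
    rcases sq_sum_eq_one hcol with ⟨h | h, h', -⟩ | ⟨h | h, h', -⟩ | ⟨h | h, -⟩
    · exact ⟨0, Complex.ext (by rw [← e0, h]; simp) (by rw [← e1, h']; simp)⟩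
    · exact ⟨2, Complex.ext (by rw [← e0, h]; simp) (by rw [← e1, h']; simp)⟩
    · exact ⟨1, Complex.ext (by rw [← e0, h']; simp) (by rw [← e1, h]; simp)⟩
    · exact ⟨3, Complex.ext (by rw [← e0, h']; simp) (by rw [← e1, h]; simp)⟩
    · rw [e2'] at h; simp at h
    · rw [e2'] at h; simp at h
  obtain ⟨j, hj⟩ := ht4
  refine ⟨U 0 0, hnorm, gateP ^ j, pow_mem P_mem j, ?_⟩
  rw [gateP_pow, ← hj]
  exact hU'

theorem implementable_of_mul {n : ℕ} {U C C' : Mat} (hC' : C' ∈ clifford) (h1 : C' * C = 1)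
    (h : ImplementableWith n (C * U)) : ImplementableWith n U := by
  have := h.clifford_mul hC'
  rwa [← Matrix.mul_assoc, h1, Matrix.one_mul] at this

theorem implementable_zero {U : Mat} (hU : IsUni U) (hL : Lev 0 U) : ImplementableWith 0 U := by
  obtain ⟨W, hW⟩ := id hL
  have hcol := (scaledOrtho_of_adj hU hW).col_eq 2 2
  rw [if_pos rfl, pow_zero] at hcol
  obtain ⟨i, hi⟩ : ∃ i, W i 2 = 1 ∨ W i 2 = -1 := by
    rcases sq_sum_eq_one hcol with ⟨h, -⟩ | ⟨h, -⟩ | ⟨h, -⟩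
    exacts [⟨0, h⟩, ⟨1, h⟩, ⟨2, h⟩]
  obtain ⟨C, hC, C', hC', hCC, s, hs, hadj⟩ := exists_clifford_axis i
  refine implementable_of_mul hC' hCC ?_
  have hCU := (isUni_clifford hC).mul hU
  have hL' : Lev 0 (C * U) := (lev_clifford hC).mul hL hU
  have h22 : adj (C * U) 2 2 = 1 ∨ adj (C * U) 2 2 = -1 := by
    have h1 := hW i 2
    rw [pow_zero, one_mul] at h1
    rw [hadj U hU 2, h1]
    have hs' : toReal s = 1 ∨ toReal s = -1 := by
      rw [← mul_self_eq_one_iff, ← toReal_mul, hs, toReal_one]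
    rcases hi with h | h <;> rcases hs' with h' | h' <;> rw [h, h'] <;> simp
  rcases h22 with h | h
  · exact diagonal_of_adj hCU h hL'
  · refine implementable_of_mul X_mem gateX_mul_self (diagonal_of_adj (isUni_X.mul hCU) ?_
      (lev_X.mul hL' hCU))
    rw [adj_mul _ hCU, adj_X]
    simp [Matrix.mul_apply, Fin.sum_univ_three, h]

/-- A Clifford moves the row divisible by √2 to the z axis; then the level has dropped already or a
T gate lowers it. That T is undone by T P³, at the price of a single T gate. -/
theorem exists_implementable (N : ℕ) : ∀ U : Mat, IsUni U → Lev N U →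
    ∃ n ≤ N, ImplementableWith n U := by
  induction N with
  | zero => exact fun U hU hL => ⟨0, le_rfl, implementable_zero hU hL⟩
  | succ N ih =>
    intro U hU hL
    obtain ⟨W, hW⟩ := hL
    obtain ⟨l, hl⟩ := (scaledOrtho_of_adj hU hW).residue.1
    obtain ⟨C, hC, C', hC', hCC, s, hs, hadj⟩ := exists_clifford_axis l
    have hCU := (isUni_clifford hC).mul hU
    have hL' : Lev (N + 1) (C * U) := by
      simpa using (lev_clifford hC).mul ⟨W, hW⟩ hU
    obtain ⟨V, hV⟩ := hL'
    have hz : ∀ k, root2 ∣ V 2 k := by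
      intro k
      have : V 2 k = s * W l k := by
        apply toReal_injective
        rw [← hV, hadj U hU, toReal_mul, ← hW]
        ring
      rw [this]
      exact (hl k).mul_left _
    rcases lev_or_lev_T_mul hCU hV hz with h | h
    · obtain ⟨n, hn, hi⟩ := ih _ hCU h
      exact ⟨n, by omega, implementable_of_mul hC' hCC hi⟩
    · obtain ⟨n, hn, hi⟩ := ih _ (isUni_T.mul hCU) h
      refine ⟨n + 1, by omega, implementable_of_mul hC' hCC ?_⟩
      have := (hi.clifford_mul (pow_mem P_mem 3)).T_mul
      rwa [← Matrix.mul_assoc, ← Matrix.mul_assoc, gateT_mul_gateP_pow, Matrix.one_mul] at this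

theorem tCount_le {U : Mat} {n : ℕ} (h : ImplementableWith n U) : tCount U ≤ n :=
  iInf₂_le n h

theorem exists_of_tCount_ne_top {U : Mat} (h : tCount U ≠ ⊤) :
    ∃ n : ℕ, tCount U = n ∧ ImplementableWith n U := by
  have hne : {n | ImplementableWith n U}.Nonempty := by
    by_contra hempty
    rw [Set.not_nonempty_iff_eq_empty] at hempty
    apply h
    simp only [tCount, iInf_eq_top]
    intro n hn
    have : n ∈ {n | ImplementableWith n U} := hn
    rw [hempty] at this
    exact this.elim
  refine ⟨sInf {n | ImplementableWith n U}, le_antisymm (tCount_le (Nat.sInf_mem hne)) ?_,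
    Nat.sInf_mem hne⟩
  refine le_iInf₂ fun n hn => ?_
  exact_mod_cast Nat.sInf_le hn

theorem tCount_le_iff {U : Mat} (hU : IsUni U) (N : ℕ) : tCount U ≤ N ↔ Lev N U := by
  constructor
  · intro h
    obtain ⟨n, hn, hi⟩ := exists_of_tCount_ne_top (ne_top_of_le_ne_top (ENat.natCast_ne_top N) h)
    rw [hn] at h
    exact hi.lev.mono (by exact_mod_cast h)
  · intro h
    obtain ⟨n, hn, hi⟩ := exists_implementable N U hU h
    exact (tCount_le hi).trans (by exact_mod_cast hn)

end

/-! ### The minimal T-count of an entry x from the denominator of |x|² and the parity of k. -/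

section

open ZOmega
open Matrix hiding zpow_mul inv_zpow one_zpow zpow_neg zpow_add zpow_sub

/-! ### The matrices `U[x, y, k]` -/

theorem conj_omega_zpow (k : ℤ) : starRingEnd ℂ (omega ^ k) = omega ^ (-k) := by
  have h : starRingEnd ℂ omega = omega⁻¹ :=
    eq_inv_of_mul_eq_one_right (by rw [omega_mul_conj])
  rw [map_zpow₀, h, inv_zpow, ← zpow_neg]

theorem norm_omega_zpow (k : ℤ) : ‖omega ^ k‖ = 1 := by
  rw [norm_zpow, norm_omega, one_zpow]

theorem normSq_omega_zpow (k : ℤ) : Complex.normSq (omega ^ k) = 1 := by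
  rw [Complex.normSq_eq_norm_sq, norm_omega_zpow, one_pow]

theorem normSq_omega : Complex.normSq omega = 1 := by
  rw [Complex.normSq_eq_norm_sq, norm_omega, one_pow]

theorem isUni_uMat_iff {x y : ℂ} {k : ℤ} :
    IsUni (uMat x y k) ↔ Complex.normSq x + Complex.normSq y = 1 := by
  constructor
  · intro h
    have h1 := (normSq_rows h).1
    simpa [uMat, Complex.normSq_mul, normSq_omega, Complex.normSq_conj] using h1
  · intro h
    rw [IsUni, Matrix.mem_unitaryGroup_iff]
    have h' : x * starRingEnd ℂ x + y * starRingEnd ℂ y = 1 := by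
      rw [Complex.mul_conj, Complex.mul_conj]
      exact_mod_cast h
    have hk : omega ^ k * starRingEnd ℂ (omega ^ k) = 1 := by
      rw [Complex.mul_conj, normSq_omega_zpow]; simp
    ext a b
    fin_cases a <;> fin_cases b <;>
      simp only [uMat, Matrix.mul_apply, Fin.sum_univ_two, Matrix.star_eq_conjTranspose,
        Matrix.conjTranspose_apply, Complex.star_def, Fin.zero_eta, Fin.mk_one,
        Matrix.of_apply, Matrix.cons_val', Matrix.cons_val_zero, Matrix.cons_val_one,
        Matrix.cons_val_fin_one, Matrix.one_apply_eq, Matrix.one_apply_ne, ne_eq, zero_ne_one,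
        one_ne_zero, not_false_eq_true, map_mul, map_neg, Complex.conj_conj]
    · linear_combination h' + (y * starRingEnd ℂ y) * hk
    · linear_combination (-starRingEnd ℂ y * x) * hk
    · linear_combination (-starRingEnd ℂ x * y) * hk
    · linear_combination h' + (x * starRingEnd ℂ x) * hk

theorem omega_zpow_smul_uMat (h : ℤ) (x y : ℂ) (k : ℤ) :
    omega ^ h • uMat x y k = uMat (omega ^ h * x) (omega ^ h * y) (k + 2 * h) := by
  have e : omega ^ (k + 2 * h) * omega ^ (-h) = omega ^ h * omega ^ k := by
    rw [← zpow_add₀ omega_ne_zero, ← zpow_add₀ omega_ne_zero]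
    congr 1
    ring
  ext a b
  fin_cases a <;> fin_cases b <;> simp only [uMat, Fin.zero_eta, Fin.mk_one, Matrix.smul_apply,
    Matrix.of_apply, Matrix.cons_val', Matrix.cons_val_zero, Matrix.cons_val_one,
    Matrix.cons_val_fin_one, smul_eq_mul, map_mul, conj_omega_zpow]
  · linear_combination (starRingEnd ℂ y) * e
  · linear_combination (-starRingEnd ℂ x) * e

theorem omega_zpow_periodic (k j : ℤ) : omega ^ (k + 8 * j) = omega ^ k := by
  rw [zpow_add₀ omega_ne_zero, zpow_mul]
  have : omega ^ (8 : ℤ) = 1 := by exact_mod_cast omega_pow_eight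
  rw [this, one_zpow, mul_one]

theorem omega_zpow_mem (k : ℤ) : omega ^ k ∈ exactRing := by
  have h : omega ^ k = omega ^ (k % 8).toNat := by
    rw [← zpow_natCast, Int.toNat_of_nonneg (Int.emod_nonneg _ (by norm_num))]
    conv_lhs => rw [← Int.emod_add_mul_ediv k 8]
    rw [omega_zpow_periodic]
  rw [h, ← toC_om, ← map_pow]
  exact toC_mem_exactRing _

theorem conj_mem_exactRing {c : ℂ} (h : c ∈ exactRing) : starRingEnd ℂ c ∈ exactRing := by
  obtain ⟨z, j, hz⟩ := mem_exactRing.1 h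
  refine mem_exactRing.2 ⟨star z, j, ?_⟩
  rw [← conj_toC, ← hz, map_mul, map_pow, conj_sqrtTwo]

/-- Conjugation negates the ω-coordinate over ℤ[√2], so it vanishes for real elements. -/
theorem exists_of_real_mem {r : ℝ} (h : (r : ℂ) ∈ exactRing) :
    ∃ N : ℕ, ∃ z : ℤ√2, Real.sqrt 2 ^ N * r = toReal z := by
  obtain ⟨z, j, hz⟩ := mem_exactRing.1 h
  have hr : starRingEnd ℂ (toC z) = toC z := by
    rw [← hz, map_mul, map_pow, conj_sqrtTwo, Complex.conj_ofReal]
  rw [conj_toC] at hr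
  have him := congrArg QuadraticAlgebra.im (toC_injective hr)
  rw [QuadraticAlgebra.im_star] at him
  have him0 : z.im = 0 := by
    have : (2 : ℤ√2) * z.im = 0 := by linear_combination -him
    rcases mul_eq_zero.1 this with h | h
    · exact absurd h two_ne_zero
    · exact h
  refine ⟨j, z.re, ?_⟩
  rw [toC_apply, him0, toReal_zero, Complex.ofReal_zero, zero_mul, add_zero, sqrtTwo] at hz
  rw [mul_comm]
  exact_mod_cast hz

/-- Matrices with entries in the exact ring. -/
def HasExactEntries (U : Mat) : Prop := ∀ i j, U i j ∈ exactRing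

theorem HasExactEntries.mul {U V : Mat} (hU : HasExactEntries U) (hV : HasExactEntries V) :
    HasExactEntries (U * V) := fun i j => by
  rw [Matrix.mul_apply]
  exact sum_mem fun k _ => mul_mem (hU i k) (hV k j)

theorem HasExactEntries.conjTranspose {U : Mat} (hU : HasExactEntries U) :
    HasExactEntries Uᴴ := fun i j => by
  rw [Matrix.conjTranspose_apply]
  exact conj_mem_exactRing (hU j i)

theorem I_mem_exactRing : Complex.I ∈ exactRing := Algebra.subset_adjoin (by simp)

theorem sqrtTwo_inv_mem_exactRing : sqrtTwo⁻¹ ∈ exactRing := Algebra.subset_adjoin (by simp)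

theorem hasExactEntries_of {a b c d : ℂ} (ha : a ∈ exactRing) (hb : b ∈ exactRing)
    (hc : c ∈ exactRing) (hd : d ∈ exactRing) : HasExactEntries !![a, b; c, d] := by
  intro i j
  fin_cases i <;> fin_cases j <;> assumption

theorem hasExactEntries_pauli (i : Fin 3) : HasExactEntries (pauli i) := by
  have h0 : (0 : ℂ) ∈ exactRing := zero_mem _
  have h1 : (1 : ℂ) ∈ exactRing := one_mem _
  fin_cases i
  exacts [hasExactEntries_of h0 h1 h1 h0,
    hasExactEntries_of h0 (neg_mem I_mem_exactRing) I_mem_exactRing h0,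
    hasExactEntries_of h1 h0 h0 (neg_mem h1)]

theorem exists_lev {U : Mat} (hU : HasExactEntries U) : ∃ N, Lev N U := by
  have h : ∀ i j, ∃ N : ℕ, ∃ z : ℤ√2, Real.sqrt 2 ^ N * adj U i j = toReal z := by
    intro i j
    apply exists_of_real_mem
    have hM := (((hasExactEntries_pauli i).mul hU).mul (hasExactEntries_pauli j)).mul
      hU.conjTranspose
    set t := (pauli i * U * pauli j * Uᴴ).trace with ht
    have htm : t ∈ exactRing := by
      rw [ht, Matrix.trace_fin_two]
      exact add_mem (hM 0 0) (hM 1 1)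
    have e : ((adj U i j : ℝ) : ℂ) = sqrtTwo⁻¹ * sqrtTwo⁻¹ * (sqrtTwo⁻¹ * sqrtTwo⁻¹) *
        (t + starRingEnd ℂ t) := by
      rw [sqrtTwo_inv_mul, Complex.add_conj]
      simp only [adj, Matrix.of_apply]
      push_cast
      ring
    rw [e]
    have hs := mul_mem sqrtTwo_inv_mem_exactRing sqrtTwo_inv_mem_exactRing
    exact mul_mem (mul_mem hs hs) (add_mem htm (conj_mem_exactRing htm))
  choose N z hz using h
  refine ⟨∑ i, ∑ j, N i j, fun i j => root2 ^ ((∑ i, ∑ j, N i j) - N i j) * z i j, fun i j => ?_⟩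
  have hle : N i j ≤ ∑ i, ∑ j, N i j :=
    (Finset.single_le_sum (f := fun j => N i j) (fun _ _ => Nat.zero_le _)
      (Finset.mem_univ j)).trans (Finset.single_le_sum (f := fun i => ∑ j, N i j)
      (fun _ _ => Nat.zero_le _) (Finset.mem_univ i))
  rw [toReal_mul, toReal_pow, toReal_root2, ← hz, ← mul_assoc, ← pow_add, Nat.sub_add_cancel hle]

theorem IsExactTriple.isUni {x y : ℂ} {k : ℤ} (h : IsExactTriple x y k) : IsUni (uMat x y k) :=
  h.2.2

theorem IsExactTriple.hasExactEntries {x y : ℂ} {k : ℤ} (h : IsExactTriple x y k) :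
    HasExactEntries (uMat x y k) :=
  hasExactEntries_of h.1 (mul_mem (neg_mem (conj_mem_exactRing h.2.1)) (omega_zpow_mem k)) h.2.1
    (mul_mem (conj_mem_exactRing h.1) (omega_zpow_mem k))

theorem isExactTriple_iff {x y : ℂ} {k : ℤ} : IsExactTriple x y k ↔
    x ∈ exactRing ∧ y ∈ exactRing ∧ Complex.normSq x + Complex.normSq y = 1 := by
  rw [IsExactTriple, ← isUni_uMat_iff (k := k)]

/-! ### Smallest denominator exponents -/

theorem natAbs_norm_root2_pow (d : ℕ) : (root2 ^ d).norm.natAbs = 2 ^ d := by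
  induction d with
  | zero => simp
  | succ d ih =>
    rw [pow_succ, Zsqrtd.norm_mul, Int.natAbs_mul, ih, pow_succ]
    simp [Zsqrtd.norm_def]

theorem sde_le_iff {r : ℝ} (hr : ∃ N : ℕ, ∃ z : ℤ√2, Real.sqrt 2 ^ N * r = toReal z) (j : ℕ) :
    sde r ≤ j ↔ ∃ z : ℤ√2, Real.sqrt 2 ^ j * r = toReal z := by
  have hs0 : Real.sqrt 2 ≠ 0 := by positivity
  by_cases h0 : r = 0
  · subst h0
    -- For r = 0 every integer qualifies and `sInf` takes its default value 0; the equivalence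
    -- survives because j ≥ 0.
    have : ¬ BddBelow {m : ℤ | ∃ z : ℤ√2, (0 : ℝ) = toReal z / Real.sqrt 2 ^ m} := by
      have e : {m : ℤ | ∃ z : ℤ√2, (0 : ℝ) = toReal z / Real.sqrt 2 ^ m} = Set.univ := by
        ext m
        simp only [Set.mem_ofPred_eq, Set.mem_univ, iff_true]
        exact ⟨0, by simp⟩
      rw [e]
      exact not_bddBelow_univ
    rw [sde, Int.csInf_of_not_bddBelow this]
    exact ⟨fun _ => ⟨0, by simp⟩, fun _ => by positivity⟩
  set S := {m : ℤ | ∃ z : ℤ√2, r = toReal z / Real.sqrt 2 ^ m} with hS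
  obtain ⟨N, z0, hz0⟩ := hr
  have hmem : ∀ j : ℕ, (j : ℤ) ∈ S ↔ ∃ z : ℤ√2, Real.sqrt 2 ^ j * r = toReal z := by
    intro j
    simp only [hS, Set.mem_ofPred_eq, zpow_natCast]
    refine exists_congr fun z => ?_
    rw [eq_div_iff (pow_ne_zero j hs0), mul_comm]
  have hne : S.Nonempty := ⟨N, (hmem N).2 ⟨z0, hz0⟩⟩
  have hbdd : BddBelow S := by
    -- An exponent N - d makes z0 divisible by √2^d, hence its norm by 2^d, and d < 2^d ≤ |norm|.
    refine ⟨N - z0.norm.natAbs, ?_⟩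
    rintro m ⟨z, hz⟩
    by_contra hlt
    push Not at hlt
    obtain ⟨d, hd⟩ : ∃ d : ℕ, (N : ℤ) - m = d := ⟨(N - m).toNat, by omega⟩
    have hz1 : z0 = root2 ^ d * z := by
      apply toReal_injective
      rw [← hz0, hz, toReal_mul, toReal_pow, toReal_root2, ← zpow_natCast (Real.sqrt 2) d, ← hd,
        zpow_sub₀ hs0, zpow_natCast]
      field_simp
    have hn : z0.norm.natAbs = 2 ^ d * z.norm.natAbs := by
      have hroot : (root2 ^ d).norm.natAbs = 2 ^ d := natAbs_norm_root2_pow d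
      rw [hz1, Zsqrtd.norm_mul, Int.natAbs_mul, hroot]
    have hz00 : z0 ≠ 0 := by
      rintro rfl
      rw [toReal_zero, mul_eq_zero] at hz0
      rcases hz0 with h | h
      · exact pow_ne_zero N hs0 h
      · exact h0 h
    have hzn : z.norm.natAbs ≠ 0 := by
      intro h
      rw [Int.natAbs_eq_zero, norm_eq_zero_iff] at h
      exact hz00 (by rw [hz1, h, mul_zero])
    have h1 : d < 2 ^ d := Nat.lt_two_pow_self
    have h2 : 2 ^ d ≤ z0.norm.natAbs := by
      rw [hn]; exact Nat.le_mul_of_pos_right _ (Nat.pos_of_ne_zero hzn)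
    omega
  rw [← hmem]
  constructor
  · intro h
    obtain ⟨z, hz⟩ := Int.csInf_mem hne hbdd
    change r = toReal z / Real.sqrt 2 ^ sde r at hz
    obtain ⟨d, hd⟩ : ∃ d : ℕ, (j : ℤ) - sde r = d := ⟨(j - sde r).toNat, by omega⟩
    refine ⟨root2 ^ d * z, ?_⟩
    rw [hz, toReal_mul, toReal_pow, toReal_root2, ← zpow_natCast (Real.sqrt 2) d, ← hd,
      zpow_sub₀ hs0]
    field_simp
  · intro h
    exact csInf_le hbdd h

theorem normSq_of_exact {x : ℂ} (h : x ∈ exactRing) :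
    ∃ N : ℕ, ∃ z : ℤ√2, Real.sqrt 2 ^ N * Complex.normSq x = toReal z := by
  apply exists_of_real_mem
  rw [← Complex.mul_conj]
  exact mul_mem h (conj_mem_exactRing h)

/-! ### The T-count of `U[x, y, k]` and the denominator of `|x|²` -/

theorem gateT_pow (n : ℕ) : gateT ^ n = !![1, 0; 0, omega ^ n] := by
  induction n with
  | zero => ext a b; fin_cases a <;> fin_cases b <;> simp
  | succ n ih =>
    rw [pow_succ, ih, gateT]
    ext a b
    fin_cases a <;> fin_cases b <;> simp [Matrix.mul_apply, Fin.sum_univ_two, pow_succ]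

theorem gateT_pow_eight : gateT ^ 8 = 1 := by
  rw [gateT_pow, omega_pow_eight]
  ext a b
  fin_cases a <;> fin_cases b <;> simp

theorem gateT_conjTranspose : gateTᴴ = gateT ^ 7 := by
  have h := isUni_T.conjTranspose_mul
  calc gateTᴴ = gateTᴴ * gateT ^ 8 := by rw [gateT_pow_eight, Matrix.mul_one]
    _ = gateT ^ 7 := by rw [pow_succ', ← Matrix.mul_assoc, h, Matrix.one_mul]

theorem isUni_T_pow (n : ℕ) : IsUni (gateT ^ n) := pow_mem isUni_T n

theorem lev_T_pow (n : ℕ) : Lev 1 (gateT ^ n) := by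
  have hP : ∀ j, Lev 0 (gateP ^ j) := fun j => lev_clifford (pow_mem P_mem j)
  obtain ⟨j, rfl | rfl⟩ := Nat.even_or_odd' n
  · rw [pow_mul]
    exact (hP j).mono (by norm_num)
  · rw [pow_succ, pow_mul]
    exact (zero_add 1) ▸ (hP j).mul lev_T isUni_T

theorem T_pow_conj_uMat (a : ℕ) (x y : ℂ) (k : ℤ) :
    gateT ^ a * uMat x y k * gateT ^ (7 * a) = uMat x (omega ^ a * y) k := by
  have h8 : omega ^ a * omega ^ (7 * a) = 1 := by
    rw [← pow_add, show a + 7 * a = 8 * a by ring, pow_mul, omega_pow_eight, one_pow]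
  have h7 : starRingEnd ℂ omega ^ a = omega ^ (7 * a) := by
    have h1 : omega ^ a * starRingEnd ℂ omega ^ a = 1 := by
      rw [← mul_pow, omega_mul_conj, one_pow]
    exact mul_left_cancel₀ (pow_ne_zero a omega_ne_zero) (h1.trans h8.symm)
  rw [gateT_pow, gateT_pow]
  ext i j
  fin_cases i <;> fin_cases j <;> simp [uMat, Matrix.mul_apply, Fin.sum_univ_two]
  · rw [h7]; ring
  · linear_combination (starRingEnd ℂ x * omega ^ k) * h8

theorem adj_T_pow_two_two (a b : ℕ) (U : Mat) :
    adj (gateT ^ a * U * gateT ^ b) 2 2 = adj U 2 2 := by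
  have h : ∀ n : ℕ, Complex.normSq (omega ^ n) = 1 := fun n => by
    rw [map_pow, Complex.normSq_eq_norm_sq, norm_omega, one_pow, one_pow]
  rw [adj_entry_two_two, adj_entry_two_two, gateT_pow, gateT_pow]
  simp [Matrix.mul_apply, Matrix.vecMul, dotProduct, Fin.sum_univ_two, Complex.normSq_mul,
    normSq_omega]

theorem Lev.conjTranspose {N : ℕ} {U : Mat} (h : Lev N U) : Lev N Uᴴ := by
  obtain ⟨W, hW⟩ := h
  exact ⟨Wᵀ, fun i j => by rw [adj_conjTranspose]; exact hW j i⟩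

theorem adj_uMat_two_two {x y : ℂ} {k : ℤ} (h : IsUni (uMat x y k)) :
    adj (uMat x y k) 2 2 = 2 * Complex.normSq x - 1 := by
  have h1 := isUni_uMat_iff.1 h
  rw [adj_entry_two_two]
  simp [uMat, Complex.normSq_mul, normSq_omega, Complex.normSq_conj]
  linarith

/-- The corner entry of the adjoint matrix is 2|x|² - 1, and 2 = √2² accounts for the shift by 2. -/
theorem sde_le_of_lev {N : ℕ} {x y : ℂ} {k : ℤ} (h : IsExactTriple x y k)
    (hL : Lev N (uMat x y k)) : sde (Complex.normSq x) ≤ N + 2 := by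
  obtain ⟨W, hW⟩ := hL
  have h1 := hW 2 2
  rw [adj_uMat_two_two h.isUni] at h1
  have := (sde_le_iff (normSq_of_exact h.1) (N + 2)).2 ⟨W 2 2 + root2 ^ N, by
    rw [toReal_add, ← h1, toReal_pow, toReal_root2, pow_add, Real.sq_sqrt (by norm_num)]
    ring⟩
  exact_mod_cast this

/-- Choose T^a U T^b of least level N; its corner entry is still 2|x|² - 1. If N ≥ 1 and the scaled
corner were divisible by √2, so would be the last row or column (`ScaledOrtho.residue`), and one
more T on the left or right would lower the level. So the corner has exact denominator √2^N. -/
theorem exists_lev_le_sde {x y : ℂ} {k : ℤ} (h : IsExactTriple x y k) :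
    ∃ N : ℕ, (N = 0 ∨ (N : ℤ) + 2 ≤ sde (Complex.normSq x)) ∧
      ∃ y', IsExactTriple x y' k ∧ Lev (N + 1) (uMat x y' k) := by
  classical
  have hex : ∃ N, ∃ a b, Lev N (gateT ^ a * uMat x y k * gateT ^ b) := by
    obtain ⟨N, hN⟩ := exists_lev h.hasExactEntries
    exact ⟨N, 0, 0, by simpa using hN⟩
  obtain ⟨a, b, hab⟩ := Nat.find_spec hex
  have hmin : ∀ M, M < Nat.find hex → ∀ a b, ¬ Lev M (gateT ^ a * uMat x y k * gateT ^ b) :=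
    fun M hM a b hL => Nat.find_min hex hM ⟨a, b, hL⟩
  generalize Nat.find hex = N at hab hmin
  refine ⟨N, ?_, omega ^ a * y, ?_, ?_⟩
  · rcases N with _ | N
    · exact Or.inl rfl
    right
    set A := gateT ^ a * uMat x y k * gateT ^ b with hA
    have hAu : IsUni A := ((isUni_T_pow a).mul h.isUni).mul (isUni_T_pow b)
    obtain ⟨W, hW⟩ := id hab
    have hbase : ¬ Lev N A := hmin N (by omega) a b
    have hrow : ¬ ∀ k, root2 ∣ W 2 k := by
      intro hz
      rcases lev_or_lev_T_mul hAu hW hz with hL | hL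
      · exact hbase hL
      · refine hmin N (by omega) (a + 1) b ?_
        rwa [pow_succ', Matrix.mul_assoc, Matrix.mul_assoc, ← Matrix.mul_assoc (gateT ^ a)]
    have hcol : ¬ ∀ k, root2 ∣ W k 2 := by
      intro hz
      have hW' : ∀ i j, Real.sqrt 2 ^ (N + 1) * adj Aᴴ i j = toReal (Wᵀ i j) := fun i j => by
        rw [adj_conjTranspose]; exact hW j i
      rcases lev_or_lev_T_mul hAu.conjTranspose hW' hz with hL | hL
      · exact hbase (by simpa using hL.conjTranspose)
      · refine hmin N (by omega) a (b + 7) ?_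
        have := hL.conjTranspose
        rwa [Matrix.conjTranspose_mul, Matrix.conjTranspose_conjTranspose, gateT_conjTranspose,
          hA, Matrix.mul_assoc, ← pow_add] at this
    have h22 : ¬ root2 ∣ W 2 2 := fun hd =>
      ((scaledOrtho_of_adj hAu hW).residue.2 hd).elim hrow hcol
    by_contra hlt
    push Not at hlt
    have hle : sde (Complex.normSq x) ≤ ((N + 2 : ℕ) : ℤ) := by push_cast at hlt ⊢; omega
    obtain ⟨z, hz⟩ := (sde_le_iff (normSq_of_exact h.1) (N + 2)).1 hle
    apply h22
    refine ⟨z - root2 ^ N, toReal_injective ?_⟩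
    rw [← hW, hA, adj_T_pow_two_two, adj_uMat_two_two h.isUni, toReal_mul, toReal_sub, ← hz,
      toReal_pow, toReal_root2]
    have h2 : Real.sqrt 2 ^ 2 = 2 := Real.sq_sqrt (by norm_num)
    linear_combination (-Real.sqrt 2 ^ (N + 1) * Complex.normSq x) * h2
  · rw [isExactTriple_iff] at h ⊢
    refine ⟨h.1, mul_mem ?_ h.2.1, ?_⟩
    · exact_mod_cast omega_zpow_mem a
    · rw [Complex.normSq_mul, ← zpow_natCast, normSq_omega_zpow, one_mul]
      exact h.2.2
  -- Right multiplication by T^(7b + 7a) turns T^a U T^b into T^a U T^(-a), which has the same x and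
  -- k. It costs at most one level, as T² is Clifford.
  · rw [← T_pow_conj_uMat]
    have := hab.mul (lev_T_pow (7 * b + 7 * a)) (isUni_T_pow _)
    rwa [Matrix.mul_assoc, ← pow_add, ← add_assoc, show b + 7 * b = 8 * b by ring, pow_add, pow_mul,
      gateT_pow_eight, one_pow, Matrix.one_mul] at this

/-! ### The parity of the T-count -/

/-- Reduction of `ℤ[ω]` modulo a prime above `41`. -/
def modHom : ZOmega →+* ZMod 41 :=
  let ρ : ℤ√2 →+* ZMod 41 := Zsqrtd.lift ⟨24, by decide⟩
  have hρ : ρ root2 = 24 := by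
    show ((root2.re : ℤ) : ZMod 41) + (root2.im : ℤ) * 24 = 24
    simp
  { toFun := fun z => ρ z.re + ρ z.im * (-3)
    map_one' := by
      show ρ 1 + ρ 0 * (-3) = 1
      simp
    map_zero' := by simp
    map_add' := fun z w => by simp; ring
    map_mul' := fun z w => by
      simp only [QuadraticAlgebra.re_mul, QuadraticAlgebra.im_mul, map_add, map_mul, map_neg,
        map_one, hρ]
      have h82 : (82 : ZMod 41) = 0 := by decide
      linear_combination (-ρ z.im * ρ w.im) * h82 }

theorem modHom_om : modHom om = -3 := by
  simp [modHom, om]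

/-- Since 41 ≡ 9 (mod 16), primitive eighth roots of unity exist modulo 41 but are non-residues,
while 2 is a residue. The image of an odd power of ω times 2^m is therefore no square. -/
theorem sq_ne_odd_om_pow {z : ZOmega} {m r : ℕ} (hr : Odd r) : z ^ 2 ≠ 2 ^ m * om ^ r := by
  intro h
  have e1 : (2 : ZMod 41) ^ 20 = 1 := by decide
  have e2 : (-3 : ZMod 41) ^ 20 = -1 := by decide
  have e3 : (0 : ZMod 41) ^ (2 * 20) ≠ -1 := by decide
  have e4 : (1 : ZMod 41) ≠ -1 := by decide
  have : Fact (Nat.Prime 41) := ⟨by norm_num⟩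
  have h1 := congrArg (fun t => modHom t ^ 20) h
  simp only [map_mul, map_pow, modHom_om, map_ofNat] at h1
  rw [mul_pow, ← pow_mul, ← pow_mul, ← pow_mul, mul_comm m, mul_comm r, pow_mul (2 : ZMod 41),
    pow_mul (-3 : ZMod 41),
    e1, e2, one_pow, one_mul, hr.neg_one_pow] at h1
  by_cases h0 : modHom z = 0
  · exact e3 (h0 ▸ h1)
  · exact e4 (ZMod.pow_card_sub_one_eq_one h0 ▸ h1)

theorem circuits_det_clifford {C : Mat} (h : C ∈ clifford) :
    HasExactEntries C ∧ ∃ j : ℕ, C.det = Complex.I ^ j := by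
  have h0 : (0 : ℂ) ∈ exactRing := zero_mem _
  have h1 : (1 : ℂ) ∈ exactRing := one_mem _
  have hX : HasExactEntries gateX := hasExactEntries_of h0 h1 h1 h0
  have hZ : HasExactEntries gateZ := hasExactEntries_of h1 h0 h0 (neg_mem h1)
  induction h using Submonoid.closure_induction with
  | mem x hx =>
    rcases hx with rfl | rfl | rfl | rfl | rfl
    · exact ⟨hX, 2, by simp [gateX, Matrix.det_fin_two_of]⟩
    · refine ⟨fun i j => ?_, 2, ?_⟩
      · rw [gateY, Matrix.smul_apply]
        exact mul_mem I_mem_exactRing ((hX.mul hZ) i j)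
      · rw [gateY, Matrix.det_smul, Matrix.det_mul]
        simp [gateX, gateZ, Matrix.det_fin_two_of]
    · exact ⟨hZ, 2, by simp [gateZ, Matrix.det_fin_two_of]⟩
    · rw [gateH_eq]
      have hs := sqrtTwo_inv_mem_exactRing
      refine ⟨hasExactEntries_of hs hs hs (neg_mem hs), 2, ?_⟩
      rw [Matrix.det_fin_two_of, Complex.I_sq]
      linear_combination (-2) * sqrtTwo_inv_mul
    · rw [gateP_eq]
      exact ⟨hasExactEntries_of h1 h0 h0 I_mem_exactRing, 1, by simp [Matrix.det_fin_two_of]⟩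
  | one =>
    refine ⟨?_, 0, by simp⟩
    rw [Matrix.one_fin_two]
    exact hasExactEntries_of h1 h0 h0 h1
  | mul x y hx hy ihx ihy =>
    obtain ⟨hx1, a, ha⟩ := ihx
    obtain ⟨hy1, b, hb⟩ := ihy
    exact ⟨hx1.mul hy1, a + b, by rw [Matrix.det_mul, ha, hb, pow_add]⟩

theorem circuits_det (n : ℕ) : ∀ V ∈ circuits n,
    HasExactEntries V ∧ ∃ j : ℕ, V.det = Complex.I ^ j * omega ^ n := by
  induction n with
  | zero =>
    intro V hV
    obtain ⟨h, j, hj⟩ := circuits_det_clifford hV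
    exact ⟨h, j, by simpa using hj⟩
  | succ n ih =>
    rintro _ ⟨V, hV, C, hC, rfl⟩
    obtain ⟨h, j, hj⟩ := ih V hV
    obtain ⟨h', j', hj'⟩ := circuits_det_clifford hC
    have hT : HasExactEntries gateT := by
      have ho : omega ∈ exactRing := by simpa using omega_zpow_mem 1
      exact hasExactEntries_of (one_mem _) (zero_mem _) (zero_mem _) ho
    refine ⟨(h.mul hT).mul h', j + j', ?_⟩
    rw [Matrix.det_mul, Matrix.det_mul, hj, hj', gateT, Matrix.det_fin_two_of]
    ring

/-- Comparing det U[x, y, k] = ω^k with the determinant i^j ω^n of the circuit makes c² a power of ω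
with exponent ≡ k - n (mod 2). The phase c is an entry of V†U, so it lies in ℤ[i, 1/√2], where odd
powers of ω are not squares. -/
theorem parity_of_implementable {n : ℕ} {x y : ℂ} {k : ℤ} (h : IsExactTriple x y k)
    (hi : ImplementableWith n (uMat x y k)) : (n : ℤ) % 2 = k % 2 := by
  obtain ⟨c, hc, V, hV, hUV⟩ := hi
  obtain ⟨hVe, j, hj⟩ := circuits_det n V hV
  have hVu := (circuits_spec n V hV).1
  have hcm : c ∈ exactRing := by
    have e : c = (Vᴴ * uMat x y k) 0 0 := by
      rw [hUV, Matrix.mul_smul, hVu.conjTranspose_mul]; simp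
    rw [e]
    exact (hVe.conjTranspose.mul h.hasExactEntries) 0 0
  have hdet : (uMat x y k).det = omega ^ k := by
    have h1 := (isExactTriple_iff.1 h).2.2
    have h2 : x * starRingEnd ℂ x + y * starRingEnd ℂ y = 1 := by
      rw [Complex.mul_conj, Complex.mul_conj]
      exact_mod_cast h1
    rw [uMat, Matrix.det_fin_two_of]
    linear_combination (omega ^ k) * h2
  rw [hUV, Matrix.det_smul, hj, Fintype.card_fin, ← omega_sq, ← pow_mul] at hdet
  obtain ⟨K, hK⟩ : ∃ K : ℕ, (K : ℤ) = k % 8 :=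
    ⟨(k % 8).toNat, Int.toNat_of_nonneg (Int.emod_nonneg _ (by norm_num))⟩
  have hk : omega ^ k = omega ^ K := by
    rw [← zpow_natCast, hK]
    conv_lhs => rw [← Int.emod_add_mul_ediv k 8]
    rw [omega_zpow_periodic]
  rw [hk, ← pow_add] at hdet
  by_contra hpar
  have hodd : Odd (K + 7 * (2 * j + n)) := by
    rw [Nat.odd_iff]; omega
  have hc2 : c ^ 2 = omega ^ (K + 7 * (2 * j + n)) := by
    have h8 : omega ^ (2 * j + n) * omega ^ (7 * (2 * j + n)) = 1 := by
      rw [← pow_add, show 2 * j + n + 7 * (2 * j + n) = 8 * (2 * j + n) by ring, pow_mul,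
        omega_pow_eight, one_pow]
    rw [pow_add, ← hdet]
    linear_combination (-c ^ 2) * h8
  obtain ⟨z, m, hz⟩ := mem_exactRing.1 hcm
  apply sq_ne_odd_om_pow (z := z) (m := m) hodd
  apply toC_injective
  rw [map_pow, ← hz, map_mul, map_pow, map_pow, toC_om, map_ofNat, mul_pow, hc2, ← pow_mul,
    mul_comm m, pow_mul, sqrtTwo_sq]
  ring

/-! ### Minimal T-counts -/

theorem exists_tCount_eq {x y : ℂ} {k : ℤ} (h : IsExactTriple x y k) :
    ∃ n : ℕ, tCount (uMat x y k) = n ∧ (n : ℤ) % 2 = k % 2 := by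
  obtain ⟨N, hN⟩ := exists_lev h.hasExactEntries
  have h1 := (tCount_le_iff h.isUni N).2 hN
  obtain ⟨n, hn, hi⟩ := exists_of_tCount_ne_top (ne_top_of_le_ne_top (ENat.natCast_ne_top N) h1)
  exact ⟨n, hn, parity_of_implementable h hi⟩

theorem entryTCount_le {x y : ℂ} {k : ℤ} (h : IsExactTriple x y k) :
    entryTCount k x ≤ tCount (uMat x y k) :=
  iInf₂_le y h

theorem exists_entryTCount {x y : ℂ} {k : ℤ} (h : IsExactTriple x y k) :
    ∃ y', IsExactTriple x y' k ∧ tCount (uMat x y' k) = entryTCount k x := by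
  have hne : {t | ∃ y, IsExactTriple x y k ∧ tCount (uMat x y k) = t}.Nonempty := ⟨_, y, h, rfl⟩
  obtain ⟨y', hy', ht⟩ := csInf_mem hne
  refine ⟨y', hy', le_antisymm ?_ (entryTCount_le hy')⟩
  rw [ht]
  exact le_iInf₂ fun y'' hy'' => csInf_le' ⟨y'', hy'', rfl⟩

/-- Once t ≥ 2 the two bounds leave only s - 2 and s - 1, and the parity of k chooses between them.
-/
theorem entryTCount_spec {x y : ℂ} {k : ℤ} (h : IsExactTriple x y k) :
    ∃ t : ℕ, entryTCount k x = t ∧ (t : ℤ) % 2 = k % 2 ∧ sde (Complex.normSq x) ≤ t + 2 ∧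
      (t ≤ 1 ∨ (t : ℤ) + 1 ≤ sde (Complex.normSq x)) := by
  obtain ⟨y1, hy1, ht1⟩ := exists_entryTCount h
  obtain ⟨t, ht, hpar⟩ := exists_tCount_eq hy1
  refine ⟨t, by rw [← ht1, ht], hpar, sde_le_of_lev hy1 ((tCount_le_iff hy1.isUni t).1 ht.le), ?_⟩
  obtain ⟨N, hN, y2, hy2, hL⟩ := exists_lev_le_sde h
  have h1 : (t : ℕ∞) ≤ ((N + 1 : ℕ) : ℕ∞) := by
    rw [← ht, ht1]
    exact (entryTCount_le hy2).trans ((tCount_le_iff hy2.isUni _).2 hL)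
  have h2 : t ≤ N + 1 := by exact_mod_cast h1
  rcases hN with rfl | hN
  · left; omega
  · right; omega

end

/-! ### Correctness of the procedures and of the search loop. -/

section

open ZOmega
open Matrix hiding zpow_mul inv_zpow one_zpow zpow_neg zpow_add zpow_sub

/-! ### Global phases -/

theorem ImplementableWith.smul {n : ℕ} {U : Mat} {c : ℂ} (hc : ‖c‖ = 1)
    (h : ImplementableWith n U) : ImplementableWith n (c • U) := by
  obtain ⟨d, hd, V, hV, rfl⟩ := h
  exact ⟨c * d, by rw [norm_mul, hc, hd, one_mul], V, hV, by rw [smul_smul]⟩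

theorem tCount_smul {U : Mat} {c : ℂ} (hc : ‖c‖ = 1) : tCount (c • U) = tCount U := by
  have hc0 : c ≠ 0 := by
    rintro rfl
    simp at hc
  have h : ∀ n, ImplementableWith n (c • U) ↔ ImplementableWith n U := fun n =>
    ⟨fun h => by
      have := h.smul (c := c⁻¹) (by rw [norm_inv, hc, inv_one])
      rwa [smul_smul, inv_mul_cancel₀ hc0, one_smul] at this, fun h => h.smul hc⟩
  simp only [tCount, h]

theorem gpDist_smul (A U : Mat) {c : ℂ} (hc : ‖c‖ = 1) : gpDist A (c • U) = gpDist A U := by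
  rw [gpDist, gpDist, Matrix.conjTranspose_smul, Matrix.mul_smul, Matrix.trace_smul, norm_smul,
    norm_star, hc, one_mul]

theorem IsExactTriple.omega_zpow_mul {x y : ℂ} {k : ℤ} (h : IsExactTriple x y k) (j : ℤ) :
    IsExactTriple (omega ^ j * x) (omega ^ j * y) (k + 2 * j) := by
  rw [isExactTriple_iff] at h ⊢
  refine ⟨mul_mem (omega_zpow_mem j) h.1, mul_mem (omega_zpow_mem j) h.2.1, ?_⟩
  rw [Complex.normSq_mul, Complex.normSq_mul, normSq_omega_zpow, one_mul, one_mul]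
  exact h.2.2

theorem entryTCount_omega_zpow_le (x : ℂ) (k j : ℤ) :
    entryTCount (k + 2 * j) (omega ^ j * x) ≤ entryTCount k x := by
  refine le_iInf₂ fun y hy => ?_
  refine (entryTCount_le (hy.omega_zpow_mul j)).trans ?_
  rw [← omega_zpow_smul_uMat, tCount_smul (norm_omega_zpow j)]

/-- Together with period 8 in k this reduces every minimal unitary to k ∈ {0, 1}. -/
theorem entryTCount_omega_zpow (x : ℂ) (k j : ℤ) :
    entryTCount (k + 2 * j) (omega ^ j * x) = entryTCount k x := by
  refine le_antisymm (entryTCount_omega_zpow_le x k j) ?_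
  have := entryTCount_omega_zpow_le (omega ^ j * x) (k + 2 * j) (-j)
  rwa [← mul_assoc, ← zpow_add₀ omega_ne_zero, neg_add_cancel, zpow_zero, one_mul,
    show k + 2 * j + 2 * -j = k by ring] at this

theorem uMat_add_eight (x y : ℂ) (k j : ℤ) : uMat x y (k + 8 * j) = uMat x y k := by
  rw [uMat, uMat, omega_zpow_periodic]

theorem entryTCount_add_eight (x : ℂ) (k j : ℤ) :
    entryTCount (k + 8 * j) x = entryTCount k x := by
  simp only [entryTCount, IsExactTriple, uMat_add_eight]

theorem isMinimal_smul_uMat {x y : ℂ} {k : ℤ} (h : IsExactTriple x y k)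
    (ht : tCount (uMat x y k) = entryTCount k x) (j : ℤ) :
    IsMinimal (omega ^ j • uMat x y k) :=
  ⟨_, _, _, h.omega_zpow_mul j, omega_zpow_smul_uMat j x y k, by
    rw [tCount_smul (norm_omega_zpow j), ht, entryTCount_omega_zpow]⟩

/-! ### The distance to a rotation -/

/-- `Re (e^{-iθ} x)`. -/
def overlap (θ : ℝ) (x : ℂ) : ℝ := x.re * Real.cos θ + x.im * Real.sin θ

theorem omega_pow_eq_exp (k : ℕ) : omega ^ k = Complex.exp (Complex.I * (Real.pi * k / 4 : ℝ)) := by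
  rw [omega, ← Complex.exp_nat_mul]
  congr 1
  push_cast
  ring

theorem conj_exp_I_mul (t : ℝ) :
    starRingEnd ℂ (Complex.exp (Complex.I * t)) = Complex.exp (-(Complex.I * t)) := by
  rw [← Complex.exp_conj, map_mul, Complex.conj_I, Complex.conj_ofReal, neg_mul]

/-- Up to the phase e^{-iπk/8}, the trace is E x̄ + Ē x = 2 Re(Ē x) with E = e^{iθ_k}. -/
theorem gpDist_uMat (φ : ℝ) (x y : ℂ) (k : ℕ) :
    gpDist (Rz φ) (uMat x y k) = Real.sqrt (1 - |overlap (theta φ k) x|) := by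
  set E := Complex.exp (Complex.I * (theta φ k : ℝ)) with hE
  have htr : (Rz φ * (uMat x y k)ᴴ).trace = Complex.exp (-(Complex.I * (Real.pi * k / 8 : ℝ))) *
      ((2 * overlap (theta φ k) x : ℝ) : ℂ) := by
    have h1 : ((2 * overlap (theta φ k) x : ℝ) : ℂ) =
        E * starRingEnd ℂ x + starRingEnd ℂ E * x := by
      have h2 : starRingEnd ℂ E * x = starRingEnd ℂ (E * starRingEnd ℂ x) := by
        rw [map_mul, Complex.conj_conj]
      rw [h2, Complex.add_conj]
      congr 2
      rw [hE, mul_comm Complex.I, Complex.exp_mul_I, ← Complex.ofReal_cos, ← Complex.ofReal_sin]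
      simp [overlap, -Complex.ofReal_cos, -Complex.ofReal_sin]
      ring
    have e1 : Complex.exp (-(Complex.I * (φ / 2 : ℝ))) =
        Complex.exp (-(Complex.I * (Real.pi * k / 8 : ℝ))) * E := by
      rw [hE, ← Complex.exp_add]
      congr 1
      rw [theta]
      push_cast
      ring
    have e2 : Complex.exp (Complex.I * (φ / 2 : ℝ)) * starRingEnd ℂ (omega ^ k) =
        Complex.exp (-(Complex.I * (Real.pi * k / 8 : ℝ))) * starRingEnd ℂ E := by
      rw [hE, omega_pow_eq_exp, conj_exp_I_mul, conj_exp_I_mul, ← Complex.exp_add,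
        ← Complex.exp_add]
      congr 1
      rw [theta]
      push_cast
      ring
    rw [h1, mul_add, ← mul_assoc, ← mul_assoc, ← e1, ← e2, Rz, uMat, zpow_natCast]
    generalize Complex.exp (-(Complex.I * (φ / 2 : ℝ))) = a
    generalize Complex.exp (Complex.I * (φ / 2 : ℝ)) = b
    generalize omega ^ k = c
    simp [Matrix.trace_fin_two, Fin.sum_univ_two, Matrix.vecMul, dotProduct]
    ring
  have hn : ‖Complex.exp (-(Complex.I * (Real.pi * k / 8 : ℝ)))‖ = 1 := by
    rw [← conj_exp_I_mul, RCLike.norm_conj, mul_comm, Complex.norm_exp_ofReal_mul_I]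
  rw [gpDist, htr, norm_mul, hn, one_mul, Complex.norm_real, Real.norm_eq_abs, abs_mul, abs_two]
  congr 2
  ring

theorem overlap_le_one {x : ℂ} (hx : Complex.normSq x ≤ 1) (θ : ℝ) : overlap θ x ≤ 1 := by
  rw [Complex.normSq_apply] at hx
  rw [overlap]
  nlinarith [Real.sin_sq_add_cos_sq θ, sq_nonneg (x.re - Real.cos θ), sq_nonneg (x.im - Real.sin θ)]

/-! ### Numerators -/

/-- The numerator as an element of `ℤ[ω]`. -/
def Numerator.toZOmega (x' : Numerator) : ZOmega :=
  algebraMap _ _ x'.re + om ^ 2 * algebraMap _ _ x'.im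

theorem Numerator.toC_toZOmega (x' : Numerator) : toC x'.toZOmega = x'.toComplex := by
  rw [toZOmega, map_add, map_mul, map_pow, toC_C, toC_C, toC_om, omega_sq, toComplex]

theorem Numerator.normSq_toComplex (x' : Numerator) :
    Complex.normSq x'.toComplex = toReal x'.normSq := by
  rw [Complex.normSq_apply]
  simp [toComplex, Numerator.normSq]
  ring

theorem normSq_sqrtTwo_pow (m : ℕ) : Complex.normSq (sqrtTwo ^ m) = 2 ^ m := by
  rw [map_pow, sqrtTwo, Complex.normSq_ofReal, Real.mul_self_sqrt (by norm_num)]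

/-- If |Y|² has no denominator, neither has Y: writing Y = z₀/√2^j, the norm of z₀ is divisible by
√2^{2j}, and `root2_pow_dvd` cancels the denominator. -/
theorem exists_toC_of_normSq {Y : ℂ} (hY : Y ∈ exactRing) {ξ : ℤ√2}
    (h : Complex.normSq Y = toReal ξ) : ∃ z : ZOmega, toC z = Y ∧ z.norm = ξ := by
  obtain ⟨z0, j, hz0⟩ := mem_exactRing.1 hY
  have hn : z0.norm = root2 ^ (2 * j) * ξ := by
    apply toReal_injective
    rw [← normSq_toC, ← hz0, Complex.normSq_mul, normSq_sqrtTwo_pow, h, toReal_mul, toReal_pow,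
      toReal_root2, pow_mul, Real.sq_sqrt (by norm_num), mul_comm]
  obtain ⟨z, rfl⟩ := root2_pow_dvd j (Dvd.intro _ hn.symm)
  have hz : toC z = Y := by
    rw [map_mul, map_pow, toC_root2, mul_comm] at hz0
    exact (mul_left_cancel₀ (pow_ne_zero j sqrtTwo_ne_zero) hz0).symm
  refine ⟨z, hz, toReal_injective ?_⟩
  rw [← normSq_toC, hz, h]

theorem div_sqrtTwo_pow_mem {c : ℂ} (hc : c ∈ exactRing) (m : ℕ) :
    c / sqrtTwo ^ m ∈ exactRing := by
  rw [div_eq_mul_inv, ← inv_pow]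
  exact mul_mem hc (pow_mem sqrtTwo_inv_mem_exactRing m)

theorem Numerator.div_mem (x' : Numerator) (m : ℕ) :
    x'.toComplex / sqrtTwo ^ m ∈ exactRing := by
  apply div_sqrtTwo_pow_mem
  rw [← toC_toZOmega]
  exact toC_mem_exactRing _

theorem Numerator.normSq_div (x' : Numerator) (m : ℕ) :
    Complex.normSq (x'.toComplex / sqrtTwo ^ m) = toReal x'.normSq / 2 ^ m := by
  rw [Complex.normSq_div, normSq_sqrtTwo_pow, normSq_toComplex]

theorem isExactTriple_numerator_iff (x' : Numerator) (m : ℕ) (k : ℤ) (y : ℂ) :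
    IsExactTriple (x'.toComplex / sqrtTwo ^ m) y k ↔
      ∃ z : ZOmega, z.norm = 2 ^ m - x'.normSq ∧ y = toC z / sqrtTwo ^ m := by
  have hs := pow_ne_zero m sqrtTwo_ne_zero
  have h2 : (0 : ℝ) < 2 ^ m := by positivity
  rw [isExactTriple_iff, x'.normSq_div]
  constructor
  · rintro ⟨-, hy, hsum⟩
    have hs2 : sqrtTwo ∈ exactRing := by rw [← toC_root2]; exact toC_mem_exactRing _
    obtain ⟨z, hz, hn⟩ := exists_toC_of_normSq (Y := y * sqrtTwo ^ m) (ξ := 2 ^ m - x'.normSq)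
      (mul_mem hy (pow_mem hs2 m)) (by
        rw [Complex.normSq_mul, normSq_sqrtTwo_pow, toReal_sub, toReal_pow, toReal_two]
        field_simp at hsum
        linarith)
    exact ⟨z, hn, by rw [hz, mul_div_cancel_right₀ _ hs]⟩
  · rintro ⟨z, hn, rfl⟩
    refine ⟨x'.div_mem m, div_sqrtTwo_pow_mem (toC_mem_exactRing z) m, ?_⟩
    rw [Complex.normSq_div, normSq_sqrtTwo_pow, normSq_toC, hn, toReal_sub, toReal_pow, toReal_two]
    field_simp
    ring

/-! ### MIN-T-COUNT and ALL-UNITARIES -/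

/-- The condition s > 4 excludes |x|² = 1, the degenerate case y = 0 in which there is nothing to
factor. -/
theorem norm_ne_zero_of_sde {x' : Numerator} {m : ℕ}
    (hs : ¬ sde (toReal x'.normSq / 2 ^ m) ≤ 4) : (2 ^ m - x'.normSq : ℤ√2) ≠ 0 := by
  intro h
  apply hs
  have h1 : x'.normSq = 2 ^ m := (sub_eq_zero.1 h).symm
  rw [h1, toReal_pow, toReal_two, div_self (by positivity)]
  have h2 : sde 1 ≤ ((0 : ℕ) : ℤ) :=
    (sde_le_iff ⟨0, 1, by simp⟩ 0).2 ⟨1, by simp⟩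
  exact h2.trans (by norm_num)

theorem minTCount_eq_natCast {x' : Numerator} {m : ℕ} {k : ℤ} {n : ℕ}
    (h : minTCount x' m k = n) :
    (2 ^ m - x'.normSq : ℤ√2) ≠ 0 ∧ IsSolvable (2 ^ m - x'.normSq) ∧
      entryTCount k (x'.toComplex / sqrtTwo ^ m) = n := by
  unfold minTCount at h
  simp only at h
  split_ifs at h with h1 h2
  · exact absurd h (ENat.top_ne_natCast n)
  · have h0 := norm_ne_zero_of_sde h1
    refine ⟨h0, h2, ?_⟩
    obtain ⟨z, hz⟩ := exists_norm_eq h0 h2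
    obtain ⟨t, ht, hpar, hle, hor⟩ := entryTCount_spec
      ((isExactTriple_numerator_iff x' m k _).2 ⟨z, hz, rfl⟩)
    rw [x'.normSq_div] at hle hor
    rw [ht]
    have h3 : ((sde (toReal x'.normSq / 2 ^ m) - 2 +
      (k + sde (toReal x'.normSq / 2 ^ m)) % 2).toNat) = n := by exact_mod_cast h
    -- Here s ≥ 5 forces t ≥ 3, which removes the alternative t ≤ 1; the bounds and the parity then
    -- determine t.
    have : t = n := by omega
    rw [this]
  · exact absurd h (ENat.top_ne_natCast n)

theorem minTCount_of_entryTCount {x' : Numerator} {m : ℕ} {k : ℤ} {n : ℕ} (hn : 4 ≤ n) {y : ℂ}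
    (hy : IsExactTriple (x'.toComplex / sqrtTwo ^ m) y k)
    (h : entryTCount k (x'.toComplex / sqrtTwo ^ m) = n) : minTCount x' m k = n := by
  obtain ⟨t, ht, hpar, hle, hor⟩ := entryTCount_spec hy
  have htn : t = n := by
    rw [h] at ht
    exact_mod_cast ht.symm
  subst htn
  rw [x'.normSq_div] at hle hor
  obtain ⟨z, hz, -⟩ := (isExactTriple_numerator_iff x' m k y).1 hy
  have hsol : IsSolvable (2 ^ m - x'.normSq) := hz ▸ isSolvable_norm z
  unfold minTCount
  simp only
  -- From t ≥ 4 follows s ≥ t + 1 ≥ 5: this is where n ≥ 4 keeps MIN-T-COUNT out of its branch for s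
  -- ≤ 4.
  rw [if_neg (by omega), if_pos hsol]
  have : ((sde (toReal x'.normSq / 2 ^ m) - 2 +
      (k + sde (toReal x'.normSq / 2 ^ m)) % 2).toNat) = t := by omega
  rw [this]

theorem mem_allUnitaries {x' : Numerator} {m : ℕ} {k : ℤ} {n : ℕ}
    (h : minTCount x' m k = n) {U : Mat} :
    U ∈ allUnitaries x' m k ↔ ∃ y, ∃ g < 8, IsExactTriple (x'.toComplex / sqrtTwo ^ m) y k ∧
      U = omega ^ g • uMat (x'.toComplex / sqrtTwo ^ m) y k ∧ tCount U = n := by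
  obtain ⟨h0, hsol, -⟩ := minTCount_eq_natCast h
  simp only [allUnitaries, List.mem_toFinset, List.mem_filter, List.mem_flatMap, List.mem_map,
    List.mem_range, decide_eq_true_eq, h, mem_solutions_factorize h0 hsol,
    isExactTriple_numerator_iff]
  constructor
  · rintro ⟨⟨_, ⟨z, rfl, hz⟩, g, hg, rfl⟩, ht⟩
    exact ⟨_, g, hg, ⟨z, hz, rfl⟩, rfl, ht⟩
  · rintro ⟨_, g, hg, ⟨z, hz, rfl⟩, rfl, ht⟩
    exact ⟨⟨_, ⟨z, rfl, hz⟩, g, hg, rfl⟩, ht⟩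

/-! ### The enumeration of candidates -/

/-- `T`-optimal minimal unitaries at distance exactly `e`. -/
def solutionsAt (n : ℕ) (φ e : ℝ) : Set Mat :=
  {U | IsMinimal U ∧ tCount U = (n : ℕ∞) ∧ gpDist (Rz φ) U = e}

theorem mem_findHalves {α : ℝ} {m : ℕ} {δ : ℝ} {h : Half} :
    h ∈ findHalves α m δ ↔
      (⌊-(Real.sqrt 2 ^ m)⌋ ≤ h.b ∧ h.b ≤ ⌈Real.sqrt 2 ^ m⌉) ∧
      |α * Real.sqrt 2 ^ m - h.b * Real.sqrt 2 - h.a| ≤ δ * Real.sqrt 2 ^ (m + 1) ∧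
      h.a ^ 2 + 2 * h.b ^ 2 ≤ 2 ^ m ∧
      h.value = (α * Real.sqrt 2 ^ m - h.b * Real.sqrt 2 - h.a) * (α / Real.sqrt 2 ^ m) := by
  simp only [findHalves, List.mem_mergeSort, List.mem_flatMap, List.mem_map, List.mem_filter,
    Int.mem_range_iff, decide_eq_true_eq, Int.lt_add_one_iff, Int.ceil_le, Int.le_floor, abs_le]
  constructor
  · rintro ⟨b, hb, a, ⟨⟨h1, h2⟩, h3⟩, rfl⟩
    exact ⟨hb, ⟨by simp only; linarith, by simp only; linarith⟩, h3, rfl⟩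
  · rintro ⟨hb, ⟨h1, h2⟩, h3, h4⟩
    refine ⟨h.b, hb, h.a, ⟨⟨by linarith, by linarith⟩, h3⟩, ?_⟩
    rw [← h4]

/-- Tuples produced from `L_{re,k} × L_{im,k}`, without the restriction on `ε`. -/
def IsCandidate (n : ℕ) (φ δ : ℝ) (c : Candidate) : Prop :=
  c.k < 2 ∧ ∃ s ∈ findHalves (Real.cos (theta φ c.k)) (denomExp n) δ,
    ∃ t ∈ findHalves (Real.sin (theta φ c.k)) (denomExp n) δ,
      0 ≤ s.value + t.value ∧ c.eps = Real.sqrt (s.value + t.value) ∧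
        c.num = ⟨⟨s.a, s.b⟩, ⟨t.a, t.b⟩⟩

theorem mem_mergeHalves {n : ℕ} {φ δ : ℝ} {I : Set ℝ} {c : Candidate} :
    c ∈ mergeHalves n φ δ I ↔ IsCandidate n φ δ c ∧ c.eps ∈ I ∩ Set.Icc 0 δ := by
  simp only [mergeHalves, List.mem_mergeSort, List.mem_flatMap, List.mem_map, List.mem_filter,
    List.mem_range, decide_eq_true_eq]
  constructor
  · rintro ⟨k, hk, s, hs, t, ⟨ht, h0, hI⟩, rfl⟩
    exact ⟨⟨hk, s, hs, t, ht, h0, rfl, rfl⟩, hI⟩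
  · rintro ⟨⟨hk, s, hs, t, ht, h0, he, hn⟩, hI⟩
    rw [he] at hI
    refine ⟨c.k, hk, s, hs, t, ⟨ht, h0, hI⟩, ?_⟩
    rw [← he, ← hn]

theorem mem_foldl_solutions (n : ℕ) (L : List Candidate) (init : Finset Mat) (U : Mat) :
    U ∈ L.foldl (fun sol c =>
      open scoped Classical in
      if minTCount c.num (denomExp n) c.k = (n : ℕ∞) then
        sol ∪ allUnitaries c.num (denomExp n) c.k
      else sol) init ↔ U ∈ init ∨ ∃ c ∈ L, minTCount c.num (denomExp n) c.k = (n : ℕ∞) ∧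
        U ∈ allUnitaries c.num (denomExp n) c.k := by
  classical
  induction L generalizing init with
  | nil => simp
  | cons c L ih =>
    rw [List.foldl_cons, ih]
    split_ifs with h
    · simp only [Finset.mem_union, List.mem_cons, exists_eq_or_imp, h, true_and, or_assoc]
    · simp only [List.mem_cons, exists_eq_or_imp, h, false_and, false_or]

theorem mem_solAt {n : ℕ} {A : List Candidate} {e : ℝ} {U : Mat} :
    U ∈ solAt n A e ↔ ∃ c ∈ A, c.eps = e ∧ minTCount c.num (denomExp n) c.k = (n : ℕ∞) ∧
      U ∈ allUnitaries c.num (denomExp n) c.k := by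
  rw [solAt, mem_foldl_solutions]
  simp only [Finset.notMem_empty, false_or, List.mem_filter, decide_eq_true_eq, and_assoc]

theorem half_value_eq {c w : ℝ} {m : ℕ} {a b : ℤ} (hw : w = (a + b * Real.sqrt 2) / Real.sqrt 2 ^ m) :
    (c * Real.sqrt 2 ^ m - b * Real.sqrt 2 - a) * (c / Real.sqrt 2 ^ m) = c * (c - w) := by
  have : Real.sqrt 2 ^ m ≠ 0 := by positivity
  rw [hw]
  field_simp
  ring

theorem Numerator.re_div (x' : Numerator) (m : ℕ) :
    (x'.toComplex / sqrtTwo ^ m).re = (x'.re.re + x'.re.im * Real.sqrt 2) / Real.sqrt 2 ^ m := by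
  rw [sqrtTwo, ← Complex.ofReal_pow, Complex.div_ofReal_re]
  simp [toComplex, toReal]

theorem Numerator.im_div (x' : Numerator) (m : ℕ) :
    (x'.toComplex / sqrtTwo ^ m).im = (x'.im.re + x'.im.im * Real.sqrt 2) / Real.sqrt 2 ^ m := by
  rw [sqrtTwo, ← Complex.ofReal_pow, Complex.div_ofReal_im]
  simp [toComplex, toReal]

/-- Since cos²θ + sin²θ = 1, the two half values add up to 1 - Re(e^{-iθ} x), the square of the
distance when the overlap is non-negative. -/
theorem value_sum_eq {θ : ℝ} {x' : Numerator} {m : ℕ} :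
    (Real.cos θ * Real.sqrt 2 ^ m - x'.re.im * Real.sqrt 2 - x'.re.re) *
        (Real.cos θ / Real.sqrt 2 ^ m) +
      (Real.sin θ * Real.sqrt 2 ^ m - x'.im.im * Real.sqrt 2 - x'.im.re) *
        (Real.sin θ / Real.sqrt 2 ^ m) = 1 - overlap θ (x'.toComplex / sqrtTwo ^ m) := by
  rw [half_value_eq (x'.re_div m), half_value_eq (x'.im_div m), overlap]
  linear_combination Real.sin_sq_add_cos_sq θ

theorem mem_solutionsAt_of_candidate {n : ℕ} {φ δ : ℝ} (hδ : δ ≤ 1 / 2) {c : Candidate}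
    (hc : IsCandidate n φ δ c) (hcδ : c.eps ≤ δ)
    (hm : minTCount c.num (denomExp n) c.k = (n : ℕ∞)) {U : Mat}
    (hU : U ∈ allUnitaries c.num (denomExp n) c.k) : U ∈ solutionsAt n φ c.eps := by
  obtain ⟨-, s, hs, t, ht, h0, he, hn⟩ := hc
  obtain ⟨y, g, -, hex, rfl, htc⟩ := (mem_allUnitaries hm).1 hU
  obtain ⟨-, -, hent⟩ := minTCount_eq_natCast hm
  have hg : ‖omega ^ g‖ = 1 := by rw [norm_pow, norm_omega, one_pow]
  refine ⟨?_, htc, ?_⟩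
  · rw [tCount_smul hg] at htc
    have := isMinimal_smul_uMat hex (htc.trans hent.symm) g
    rwa [zpow_natCast] at this
  · rw [gpDist_smul _ _ hg, gpDist_uMat]
    have hv : s.value + t.value =
        1 - overlap (theta φ c.k) (c.num.toComplex / sqrtTwo ^ denomExp n) := by
      rw [← value_sum_eq, (mem_findHalves.1 hs).2.2.2, (mem_findHalves.1 ht).2.2.2, hn]
    -- From δ ≤ 1/2 the overlap is at least 3/4, so the absolute value in the distance formula
    -- disappears.
    have hsq : s.value + t.value ≤ (1 / 2) ^ 2 := by
      rw [← Real.sqrt_le_left (by norm_num), ← he]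
      linarith
    rw [abs_of_nonneg (by linarith), he, hv]

/-- The bound on |x|² puts √2^m x into ℤ[ω] for m = ⌊(n + 1)/2⌋ + 1. One more factor √2 separates
real and imaginary parts, because √2(u + vω) = (√2u + v) + iv; this explains `denomExp`. -/
theorem exists_numerator {x : ℂ} (hx : x ∈ exactRing) {n : ℕ}
    (hs : sde (Complex.normSq x) ≤ n + 2) :
    ∃ x' : Numerator, x = x'.toComplex / sqrtTwo ^ denomExp n := by
  set m := (n + 1) / 2 + 1 with hm
  have hs' : sde (Complex.normSq x) ≤ ((2 * m : ℕ) : ℤ) := by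
    have : n + 2 ≤ 2 * m := by omega
    omega
  obtain ⟨ξ, hξ⟩ := (sde_le_iff (normSq_of_exact hx) _).1 hs'
  have hs2 : sqrtTwo ∈ exactRing := by rw [← toC_root2]; exact toC_mem_exactRing _
  obtain ⟨z, hz, -⟩ := exists_toC_of_normSq (Y := x * sqrtTwo ^ m) (ξ := ξ)
    (mul_mem hx (pow_mem hs2 m)) (by
      rw [Complex.normSq_mul, normSq_sqrtTwo_pow, ← hξ, pow_mul, Real.sq_sqrt (by norm_num),
        mul_comm])
  refine ⟨⟨root2 * z.re + z.im, z.im⟩, ?_⟩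
  rw [show denomExp n = m + 1 from rfl, eq_div_iff (pow_ne_zero _ sqrtTwo_ne_zero), pow_succ,
    ← mul_assoc, ← hz, toC_apply, Numerator.toComplex, omega_eq]
  simp only [toReal_add, toReal_mul, toReal_root2, Complex.ofReal_add, Complex.ofReal_mul]
  rw [← sqrtTwo]
  linear_combination (toReal z.im * (1 + Complex.I) / 2) * sqrtTwo_sq

theorem mem_findHalves_of_coord {θc w δ : ℝ} {m : ℕ} {z : ℤ√2}
    (hw : w = (z.re + z.im * Real.sqrt 2) / Real.sqrt 2 ^ m)
    (h1 : toReal z ^ 2 ≤ 2 ^ m) (h2 : toReal (star z) ^ 2 ≤ 2 ^ m)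
    (hd : |θc - w| ≤ δ * Real.sqrt 2) :
    (⟨θc * (θc - w), z.re, z.im⟩ : Half) ∈ findHalves θc m δ := by
  have hp : (0 : ℝ) < Real.sqrt 2 ^ m := by positivity
  have hs : Real.sqrt 2 ^ 2 = 2 := Real.sq_sqrt (by norm_num)
  have hpp : (Real.sqrt 2 ^ m) ^ 2 = 2 ^ m := by rw [← pow_mul, mul_comm, pow_mul, hs]
  -- a² + 2b² is the mean of the squares of the conjugates a ± b√2.
  have hab : (z.re : ℝ) ^ 2 + 2 * z.im ^ 2 ≤ 2 ^ m := by
    simp only [toReal, Zsqrtd.re_star, Zsqrtd.im_star, Int.cast_neg] at h1 h2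
    nlinarith
  have hb : |(z.im : ℝ)| ≤ Real.sqrt 2 ^ m := by
    apply abs_le_of_sq_le_sq _ hp.le
    rw [hpp]
    nlinarith [sq_nonneg (z.re : ℝ), sq_nonneg (z.im : ℝ)]
  rw [mem_findHalves]
  refine ⟨⟨?_, ?_⟩, ?_, by exact_mod_cast hab, (half_value_eq hw).symm⟩
  · have := (Int.floor_le (-(Real.sqrt 2 ^ m))).trans (abs_le.1 hb).1
    exact_mod_cast this
  · have := (abs_le.1 hb).2.trans (Int.le_ceil _)
    exact_mod_cast this
  · have e : θc * Real.sqrt 2 ^ m - z.im * Real.sqrt 2 - z.re = (θc - w) * Real.sqrt 2 ^ m := by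
      rw [hw]
      field_simp
      ring
    simp only
    rw [e, abs_mul, abs_of_pos hp, pow_succ]
    nlinarith

theorem exists_candidate_of_exact {n : ℕ} (hn : 4 ≤ n) {φ δ e : ℝ} (he : e ≤ δ) {x y : ℂ} {k : ℕ}
    (hk : k < 2) (hex : IsExactTriple x y k) (hent : entryTCount k x = n)
    (hov : 0 ≤ overlap (theta φ k) x) (hdist : gpDist (Rz φ) (uMat x y k) = e) :
    ∃ c, IsCandidate n φ δ c ∧ c.eps = e ∧ c.k = k ∧
      x = c.num.toComplex / sqrtTwo ^ denomExp n ∧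
      minTCount c.num (denomExp n) k = (n : ℕ∞) := by
  have hsde : sde (Complex.normSq x) ≤ n + 2 := by
    obtain ⟨t, ht, -, h, -⟩ := entryTCount_spec hex
    have : n = t := by
      rw [hent] at ht
      exact_mod_cast ht
    rwa [this]
  obtain ⟨x', rfl⟩ := exists_numerator hex.1 hsde
  have hm := minTCount_of_entryTCount hn hex hent
  obtain ⟨-, hsol, -⟩ := minTCount_eq_natCast hm
  set m := denomExp n with hmdef
  set x := x'.toComplex / sqrtTwo ^ m with hx
  set θ := theta φ k with hθ
  have hx1 : Complex.normSq x ≤ 1 := by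
    have := (isExactTriple_iff.1 hex).2.2
    linarith [Complex.normSq_nonneg y]
  have hov1 : 0 ≤ 1 - overlap θ x := by linarith [overlap_le_one hx1 θ]
  rw [gpDist_uMat, abs_of_nonneg hov] at hdist
  have he0 : 0 ≤ e := hdist ▸ Real.sqrt_nonneg _
  have he2 : 1 - overlap θ x = e ^ 2 := by rw [← hdist, Real.sq_sqrt hov1]
  have hs2 : Real.sqrt 2 ^ 2 = 2 := Real.sq_sqrt (by norm_num)
  have hδe : e ^ 2 ≤ δ ^ 2 := pow_le_pow_left₀ he0 he 2
  -- |e^{iθ} - x|² = 1 + |x|² - 2 overlap ≤ 2e² ≤ 2δ², the source of the window δ√2^(m+1) in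
  -- FIND-HALVES.
  have hclose : (Real.cos θ - x.re) ^ 2 + (Real.sin θ - x.im) ^ 2 ≤ (δ * Real.sqrt 2) ^ 2 := by
    rw [Complex.normSq_apply] at hx1
    rw [overlap] at he2
    rw [mul_pow, hs2]
    nlinarith [Real.sin_sq_add_cos_sq θ]
  have hδ0 : 0 ≤ δ * Real.sqrt 2 := mul_nonneg (he0.trans he) (Real.sqrt_nonneg _)
  -- Existence of y makes 2^m - |x'|² non-negative in both embeddings, which bounds each coordinate
  -- of x' together with its conjugate.
  obtain ⟨hξ1, hξ2, -⟩ := hsol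
  have hstar : star (2 ^ m - x'.normSq) = (2 ^ m - (star x'.re ^ 2 + star x'.im ^ 2) : ℤ√2) := by
    rw [star_sub, star_pow', Numerator.normSq, star_add, star_pow', star_pow']
    congr 2
  rw [hstar] at hξ2
  simp only [Numerator.normSq, toReal_sub, toReal_add, toReal_pow, toReal_two] at hξ1 hξ2
  refine ⟨⟨e, x', k⟩, ⟨hk, ⟨Real.cos θ * (Real.cos θ - x.re), x'.re.re, x'.re.im⟩, ?_,
    ⟨Real.sin θ * (Real.sin θ - x.im), x'.im.re, x'.im.im⟩, ?_, ?_, ?_, rfl⟩, rfl, rfl, rfl, hm⟩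
  · exact mem_findHalves_of_coord (x'.re_div m)
      (by nlinarith [sq_nonneg (toReal x'.im)]) (by nlinarith [sq_nonneg (toReal (star x'.im))])
      (abs_le_of_sq_le_sq (by nlinarith [sq_nonneg (Real.sin θ - x.im)]) hδ0)
  · exact mem_findHalves_of_coord (x'.im_div m)
      (by nlinarith [sq_nonneg (toReal x'.re)]) (by nlinarith [sq_nonneg (toReal (star x'.re))])
      (abs_le_of_sq_le_sq (by nlinarith [sq_nonneg (Real.cos θ - x.re)]) hδ0)
  · simp only
    rw [overlap] at hov1
    nlinarith [Real.sin_sq_add_cos_sq θ]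
  · simp only
    rw [← hdist]
    congr 1
    rw [overlap]
    linear_combination -Real.sin_sq_add_cos_sq θ

theorem overlap_neg (θ : ℝ) (x : ℂ) : overlap θ (-x) = -overlap θ x := by
  simp [overlap]; ring

theorem exists_candidate {n : ℕ} (hn : 4 ≤ n) {φ δ e : ℝ} (he : e ≤ δ) {U : Mat}
    (hU : U ∈ solutionsAt n φ e) :
    ∃ c, IsCandidate n φ δ c ∧ c.eps = e ∧ minTCount c.num (denomExp n) c.k = (n : ℕ∞) ∧
      U ∈ allUnitaries c.num (denomExp n) c.k := by
  obtain ⟨⟨x, y, k, hex, rfl, hmin⟩, ht, hd⟩ := hU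
  obtain ⟨k0, hk0⟩ : ∃ k0 : ℕ, (k0 : ℤ) = k % 2 :=
    ⟨(k % 2).toNat, Int.toNat_of_nonneg (Int.emod_nonneg _ (by norm_num))⟩
  have hk2 : k0 < 2 := by omega
  -- The phase ω^(-⌊k/2⌋) brings k to k mod 2. If the overlap is then negative, four more powers
  -- give the sign ω^(-4) = -1 and shift k by 8, which leaves the matrix form unchanged.
  obtain ⟨h, x1, y1, hx1, hy1, j, hkj, hov⟩ : ∃ (h : ℤ) (x1 y1 : ℂ), x1 = omega ^ (-h) * x ∧
      y1 = omega ^ (-h) * y ∧ ∃ j : ℤ, k + 2 * -h = k0 + 8 * j ∧ 0 ≤ overlap (theta φ k0) x1 := by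
    have h4 : omega ^ (-4 : ℤ) = -1 := by
      have : omega ^ 4 = -1 := by
        rw [show omega ^ 4 = (omega ^ 2) ^ 2 by ring, omega_sq, Complex.I_sq]
      rw [zpow_neg, show omega ^ (4 : ℤ) = omega ^ 4 by exact_mod_cast rfl, this]
      norm_num
    rcases le_total 0 (overlap (theta φ k0) (omega ^ (-(k / 2)) * x)) with h | h
    · exact ⟨k / 2, _, _, rfl, rfl, 0, by omega, h⟩
    · refine ⟨k / 2 + 4, _, _, rfl, rfl, -1, by omega, ?_⟩
      rw [neg_add, zpow_add₀ omega_ne_zero, h4, mul_neg_one, neg_mul, overlap_neg]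
      linarith
  have hU : uMat x y k = omega ^ h • uMat x1 y1 k0 := by
    rw [← uMat_add_eight x1 y1 k0 j, ← hkj, omega_zpow_smul_uMat, hx1, hy1, ← mul_assoc,
      ← mul_assoc, ← zpow_add₀ omega_ne_zero, add_neg_cancel, zpow_zero, one_mul, one_mul]
    congr 1
    ring
  have hex1 : IsExactTriple x1 y1 k0 := by
    have := hex.omega_zpow_mul (-h)
    rw [← hx1, ← hy1, isExactTriple_iff] at this
    exact isExactTriple_iff.2 this
  have hent : entryTCount k0 x1 = n := by
    rw [← entryTCount_add_eight x1 k0 j, ← hkj, hx1, entryTCount_omega_zpow, ← hmin, ht]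
  obtain ⟨g, hg, hgh⟩ : ∃ g : ℕ, g < 8 ∧ omega ^ h = omega ^ g := by
    refine ⟨(h % 8).toNat, by omega, ?_⟩
    rw [← zpow_natCast, Int.toNat_of_nonneg (Int.emod_nonneg _ (by norm_num))]
    conv_lhs => rw [← Int.emod_add_mul_ediv h 8]
    rw [omega_zpow_periodic]
  rw [hU] at ht hd ⊢
  rw [gpDist_smul _ _ (norm_omega_zpow h)] at hd
  obtain ⟨c, hc, hce, hck, hcx, hcm⟩ := exists_candidate_of_exact hn he hk2 hex1 hent hov hd
  subst hck
  refine ⟨c, hc, hce, hcm, (mem_allUnitaries hcm).2 ⟨y1, g, hg, ?_, ?_, ht⟩⟩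
  · rwa [← hcx]
  · rw [← hcx, hgh]

theorem coe_solAt_mergeHalves {n : ℕ} (hn : 4 ≤ n) {φ δ : ℝ} (hδ : δ ≤ 1 / 2) {I : Set ℝ} {e : ℝ}
    (he : e ∈ I ∩ Set.Icc 0 δ) :
    (solAt n (mergeHalves n φ δ I) e : Set Mat) = solutionsAt n φ e := by
  ext U
  rw [Finset.mem_coe, mem_solAt]
  constructor
  · rintro ⟨c, hcA, rfl, hm, hU⟩
    exact mem_solutionsAt_of_candidate hδ (mem_mergeHalves.1 hcA).1 he.2.2 hm hU
  · intro hU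
    obtain ⟨c, hc, rfl, hm, hcU⟩ := exists_candidate hn he.2.2 hU
    exact ⟨c, mem_mergeHalves.2 ⟨hc, he⟩, rfl, hm, hcU⟩

/-! ### The main loop -/

theorem firstSolution_eq_none {n : ℕ} {A : List Candidate} {L : List ℝ}
    (h : firstSolution n A L = none) : ∀ e ∈ L, solAt n A e = ∅ := by
  induction L with
  | nil => simp
  | cons e L ih =>
    rw [firstSolution] at h
    split_ifs at h with h1
    push Not at h1
    intro e' he'
    rcases List.mem_cons.1 he' with rfl | he'
    · exact h1
    · exact ih h e' he'

theorem firstSolution_eq_some {n : ℕ} {A : List Candidate} {L : List ℝ} (hL : L.Pairwise (· ≤ ·))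
    {out : ℝ × Finset Mat} (h : firstSolution n A L = some out) :
    out.1 ∈ L ∧ out.2 = solAt n A out.1 ∧ out.2.Nonempty ∧
      ∀ e ∈ L, solAt n A e ≠ ∅ → out.1 ≤ e := by
  induction L with
  | nil => simp [firstSolution] at h
  | cons e L ih =>
    obtain ⟨h2, h3⟩ := List.pairwise_cons.1 hL
    rw [firstSolution] at h
    split_ifs at h with h1
    · obtain rfl := Option.some.inj h
      refine ⟨List.mem_cons_self, rfl, Finset.nonempty_iff_ne_empty.2 h1, fun e' he' _ => ?_⟩
      rcases List.mem_cons.1 he' with rfl | he'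
      · exact le_rfl
      · exact h2 e' he'
    · push Not at h1
      obtain ⟨i1, i2, i3, i4⟩ := ih h3 h
      refine ⟨List.mem_cons_of_mem _ i1, i2, i3, fun e' he' hne => ?_⟩
      rcases List.mem_cons.1 he' with rfl | he'
      · exact absurd h1 hne
      · exact i4 e' he' hne

theorem mem_eps_sort {A : List Candidate} {e : ℝ} :
    (e ∈ (open scoped Classical in (A.map Candidate.eps).toFinset.sort)) ↔
      ∃ c ∈ A, c.eps = e := by
  rw [Finset.mem_sort, List.mem_toFinset, List.mem_map]

theorem processInterval_eq_none {n : ℕ} (hn : 4 ≤ n) {φ δ : ℝ} (hδ : δ ≤ 1 / 2) {I : Set ℝ}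
    (h : processInterval n φ δ I = none) :
    ∀ e ∈ I ∩ Set.Icc 0 δ, solutionsAt n φ e = ∅ := by
  intro e he
  rw [← coe_solAt_mergeHalves hn hδ he, Finset.coe_eq_empty, Finset.eq_empty_iff_forall_notMem]
  intro U hU
  obtain ⟨c, hc, hce, -⟩ := mem_solAt.1 hU
  have := firstSolution_eq_none h e (mem_eps_sort.2 ⟨c, hc, hce⟩)
  rw [this] at hU
  exact Finset.notMem_empty _ hU

theorem processInterval_eq_some {n : ℕ} (hn : 4 ≤ n) {φ δ : ℝ} (hδ : δ ≤ 1 / 2) {I : Set ℝ}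
    {out : ℝ × Finset Mat} (h : processInterval n φ δ I = some out) :
    out.1 ∈ I ∩ Set.Icc 0 δ ∧ (out.2 : Set Mat) = solutionsAt n φ out.1 ∧ out.2.Nonempty ∧
      ∀ e ∈ I ∩ Set.Icc 0 δ, (solutionsAt n φ e).Nonempty → out.1 ≤ e := by
  obtain ⟨h1, h2, h3, h4⟩ := firstSolution_eq_some (Finset.pairwise_sort _ _) h
  obtain ⟨c, hc, hce⟩ := mem_eps_sort.1 h1
  have hmem : out.1 ∈ I ∩ Set.Icc 0 δ := hce ▸ (mem_mergeHalves.1 hc).2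
  refine ⟨hmem, by rw [h2, coe_solAt_mergeHalves hn hδ hmem], h3, ?_⟩
  rintro e he ⟨U, hU⟩
  rw [← coe_solAt_mergeHalves hn hδ he] at hU
  obtain ⟨c', hc', hce', -⟩ := mem_solAt.1 hU
  exact h4 e (mem_eps_sort.2 ⟨c', hc', hce'⟩) (Finset.ne_empty_of_mem hU)

/-- The specification of the output of the `while` loop. -/
def IsOutput (n : ℕ) (φ δ : ℝ) (out : ℝ × Finset Mat) : Prop :=
  (out = (δ, ∅) ∧ ∀ e ∈ Set.Icc 0 δ, solutionsAt n φ e = ∅) ∨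
  (out.1 ∈ Set.Icc 0 δ ∧ (out.2 : Set Mat) = solutionsAt n φ out.1 ∧ out.2.Nonempty ∧
    ∀ e ∈ Set.Icc 0 δ, (solutionsAt n φ e).Nonempty → out.1 ≤ e)

/-- Induction on a bound N for the number of intervals needed to pass δ; the invariant is that no
solution lies at a distance below α₀. Adjacent closed intervals share an endpoint, so no distance is
skipped. Uniqueness of the output holds because the three rules exclude each other. -/
theorem whileLoop_spec {n : ℕ} (hn : 4 ≤ n) {φ δ α : ℝ} (hδ : δ ≤ 1 / 2) (hα : 0 < α) (N : ℕ) :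
    ∀ α₀ : ℝ, 0 ≤ α₀ → δ - α₀ < N * α → (∀ e ∈ Set.Icc 0 δ, e < α₀ → solutionsAt n φ e = ∅) →
      ∃ out, (∀ out', WhileLoop n φ δ α₀ (α₀ + α) out' ↔ out' = out) ∧ IsOutput n φ δ out := by
  induction N with
  | zero =>
    intro α₀ h0 hlt hprev
    rw [Nat.cast_zero, zero_mul] at hlt
    have hemp : ¬ (Set.Icc α₀ (α₀ + α) ∩ Set.Icc 0 δ).Nonempty := by
      rintro ⟨e, he⟩
      linarith [he.1.1, he.2.2]
    refine ⟨(δ, ∅), fun out' => ⟨fun h => ?_, fun h => h ▸ WhileLoop.exit hemp⟩, Or.inl ⟨rfl,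
      fun e he => hprev e he (by linarith [he.2])⟩⟩
    cases h with
    | exit => rfl
    | found h => exact absurd h hemp
    | next h => exact absurd h hemp
  | succ N ih =>
    intro α₀ h0 hlt hprev
    by_cases hne : (Set.Icc α₀ (α₀ + α) ∩ Set.Icc 0 δ).Nonempty
    · rcases hp : processInterval n φ δ (Set.Icc α₀ (α₀ + α)) with _ | out
      · have hnone := processInterval_eq_none hn hδ hp
        obtain ⟨out, hout, hspec⟩ := ih (α₀ + α) (by linarith) (by push_cast at hlt; linarith)
          (fun e he hlt' => by
            rcases lt_or_ge e α₀ with h | h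
            · exact hprev e he h
            · exact hnone e ⟨⟨h, hlt'.le⟩, he⟩)
        have e2 : 2 * (α₀ + α) - α₀ = α₀ + α + α := by ring
        refine ⟨out, fun out' => ⟨fun h => ?_, fun h => ?_⟩, hspec⟩
        · cases h with
          | exit h => exact absurd hne h
          | found h hs => rw [hp] at hs; cases hs
          | next h hn' hrest =>
            rw [e2] at hrest
            exact (hout out').1 hrest
        · refine WhileLoop.next hne hp ?_
          rw [e2]
          exact (hout out').2 h
      · obtain ⟨h1, h2, h3, h4⟩ := processInterval_eq_some hn hδ hp
        refine ⟨out, fun out' => ⟨fun h => ?_, fun h => h ▸ WhileLoop.found hne hp⟩,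
          Or.inr ⟨h1.2, h2, h3, fun e he hse => ?_⟩⟩
        · cases h with
          | exit h => exact absurd hne h
          | found h hs => rw [hp] at hs; exact (Option.some.inj hs).symm
          | next h hn' hrest => rw [hp] at hn'; cases hn'
        · rcases lt_or_ge e α₀ with h | h
          · rw [hprev e he h] at hse
            exact absurd hse Set.not_nonempty_empty
          · rcases le_total e (α₀ + α) with h' | h'
            · exact h4 e ⟨⟨h, h'⟩, he⟩ hse
            · exact h1.1.2.trans h'
    · refine ⟨(δ, ∅), fun out' => ⟨fun h => ?_, fun h => h ▸ WhileLoop.exit hne⟩, Or.inl ⟨rfl,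
        fun e he => hprev e he ?_⟩⟩
      · cases h with
        | exit => rfl
        | found h => exact absurd h hne
        | next h => exact absurd h hne
      · by_contra hle
        push Not at hle
        -- A distance e ∈ [0, δ] with α₀ ≤ e would put α₀ itself into the intersection.
        exact hne ⟨α₀, ⟨le_rfl, by linarith⟩, h0, hle.trans he.2⟩

theorem feasible_eq_empty_of {n : ℕ} {φ δ : ℝ}
    (h : ∀ e ∈ Set.Icc 0 δ, solutionsAt n φ e = ∅) : feasible n φ δ = ∅ := by
  rw [Set.eq_empty_iff_forall_notMem]
  rintro U ⟨h1, h2, h3⟩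
  have : U ∈ solutionsAt n φ (gpDist (Rz φ) U) := ⟨h1, h2, rfl⟩
  rw [h (gpDist (Rz φ) U) ⟨Real.sqrt_nonneg _, h3⟩] at this
  exact this

theorem IsOutput.spec {n : ℕ} {φ δ : ℝ} {out : ℝ × Finset Mat} (h : IsOutput n φ δ out) :
    out.1 = rcupDist n φ δ ∧ (out.2 : Set Mat) = rcupSet n φ δ ∧
      ((feasible n φ δ).Nonempty →
        IsLeast (gpDist (Rz φ) '' feasible n φ δ) out.1 ∧ out.2.Nonempty) ∧
      (feasible n φ δ = ∅ → out = (δ, ∅)) := by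
  rcases h with ⟨rfl, h⟩ | ⟨h1, h2, h3, h4⟩
  · have hemp := feasible_eq_empty_of h
    have hdist : rcupDist n φ δ = δ := by
      rw [rcupDist, if_neg (by rw [hemp]; exact Set.not_nonempty_empty)]
    refine ⟨hdist.symm, ?_, fun hne => ?_, fun _ => rfl⟩
    · rw [rcupSet, hdist, Finset.coe_empty]
      exact hemp.symm
    · rw [hemp] at hne
      exact absurd hne Set.not_nonempty_empty
  · obtain ⟨U, hU⟩ := h3
    have hU' : U ∈ solutionsAt n φ out.1 := h2 ▸ hU
    have hUf : U ∈ feasible n φ δ := ⟨hU'.1, hU'.2.1, hU'.2.2.le.trans h1.2⟩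
    have hle : ∀ V, IsMinimal V → tCount V = n → gpDist (Rz φ) V ≤ δ →
        out.1 ≤ gpDist (Rz φ) V := fun V hV1 hV2 hV3 =>
      h4 _ ⟨Real.sqrt_nonneg _, hV3⟩ ⟨V, hV1, hV2, rfl⟩
    have hleast : IsLeast (gpDist (Rz φ) '' feasible n φ δ) out.1 := by
      refine ⟨⟨U, hUf, hU'.2.2⟩, ?_⟩
      rintro _ ⟨V, hV, rfl⟩
      exact hle V hV.1 hV.2.1 hV.2.2
    have hdist : rcupDist n φ δ = out.1 := by
      rw [rcupDist, if_pos ⟨U, hUf⟩, hleast.csInf_eq]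
    refine ⟨hdist.symm, ?_, fun _ => ⟨hleast, U, hU⟩, fun hemp => ?_⟩
    · rw [h2, rcupSet, hdist]
      ext V
      constructor
      · rintro ⟨hV1, hV2, hV3⟩
        exact ⟨hV1, hV2, hV3.le⟩
      · rintro ⟨hV1, hV2, hV3⟩
        exact ⟨hV1, hV2, le_antisymm hV3 (hle V hV1 hV2 (hV3.trans h1.2))⟩
    · rw [hemp] at hUf
      exact hUf.elim

end

end RCU

end

theorem mainTheorem1 (n : ℕ) (hn : 4 ≤ n) (φ δ : ℝ) (hδ : δ ≤ 1 / 2) (α : ℝ) (hα : 0 < α) :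
    ∃ out : ℝ × Finset RCU.Mat,
      (∀ out', RCU.Returns n φ δ α out' ↔ out' = out) ∧
      out.1 = RCU.rcupDist n φ δ ∧
      (out.2 : Set RCU.Mat) = RCU.rcupSet n φ δ ∧
      ((RCU.feasible n φ δ).Nonempty →
        IsLeast (RCU.gpDist (RCU.Rz φ) '' RCU.feasible n φ δ) out.1 ∧ out.2.Nonempty) ∧
      (RCU.feasible n φ δ = ∅ → out = (δ, ∅)) := by
  obtain ⟨N, hN⟩ := exists_nat_gt (δ / α)
  rw [div_lt_iff₀ hα, ← sub_zero δ] at hN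
  obtain ⟨out, hout, hspec⟩ := RCU.whileLoop_spec hn hδ hα N 0 le_rfl hN
    (fun e he h => absurd he.1 (not_le.2 h))
  rw [zero_add] at hout
  exact ⟨out, hout, hspec.spec⟩
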